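/- Let $N$ be a lattice of rank $n$ (a free abelian group), $M=\operatorname{Hom}(N,\mathbb Z)$ and $N_{\mathbb R}=N\otimes\mathbb R$. Let $\operatorname{Sym}^*(M)$ be the ring of polynomials with integer coefficients on $N$, and let $\operatorname{Sym}^{\pm}(M)$ be its localization at the nonzero homogeneous elements, a subring of the fraction field of $\operatorname{Sym}^*(M)$. For an $n$-dimensional rational polyhedral cone $\sigma\subset N_{\mathbb R}$ with dual cone $\sigma^*$, let $\operatorname{Hilb}(\sigma)=\sum_{u\in\sigma^*\cap M}x^u$, expressed as a rational function on the torus $T$ with character lattice $M$. For a rational function $r=g/h$ on $T$ with $g,h$ regular at the identity $1_T$, let $r_\circ=g_\circ/h_\circ$ be its principal part at $1_T$, where $g_\circ$, $h_\circ$ are the lowest-degree terms of the power series expansions of $g$, $h$ in local parameters at $1_T$, viewed as polynomials on the tangent space of $T$ at $1_T$ (so the class of $x^u-1$ in the cotangent space is identified with $u\in M$). Put $e_\sigma=(-1)^n\operatorname{Hilb}(\sigma)_\circ\in\operatorname{Sym}^{\pm}(M)$. Let $\Delta$ be a complete fan in $N_{\mathbb R}$: a finite set of strongly convex rational polyhedral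 cones that is closed under taking faces, in which any two cones meet in a common face, and whose union is $N_{\mathbb R}$. For $\tau\in\Delta$ and a maximal cone $\sigma\in\Delta$ containing $\tau$ (written $\sigma\succeq\tau$), let $e_{\sigma,\tau}=e_{\overline\sigma}$, where $\overline\sigma$ is the image of $\sigma$ in $\bigl(N/(N\cap\operatorname{Span}\tau)\bigr)_{\mathbb R}$; it lies in $\operatorname{Sym}^{\pm}(\tau^\perp\cap M)\subset\operatorname{Sym}^{\pm}(M)$. Let $f\in PP^k(\Delta)$, $k\ge 0$, i.e. $f:|\Delta|=N_{\mathbb R}\to\mathbb R$ is a continuous function whose restriction $f_\sigma$ to each maximal cone $\sigma\in\Delta$ is a homogeneous polynomial of degree $k$ in $\operatorname{Sym}^*(M)$. **Proposition.** For every $\tau\in\Delta$, the rational function $$c(\tau)=\sum_{\sigma\succeq\tau}e_{\sigma,\tau}\,f_\sigma ,$$ where the sum is over the maximal cones $\sigma\in\Delta$ containing $\tau$, is a homogeneous polynomial in $\operatorname{Sym}^*(M)$ of degree $k+\dim\tau-n$. In particular $c(\tau)=0$ if $k+\dim\tau<n$. -/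

import Mathlib

open scoped TensorProduct nonZeroDivisors

noncomputable section

namespace ToricLocalization

/-! ### Lattices, dual lattices, polynomials

`N` is a lattice (a finitely generated free abelian group), `M = Hom(N, ℤ)`, `N_ℝ = ℝ ⊗ N`. -/

/-- The real vector space `N_ℝ = ℝ ⊗ N` spanned by a lattice `N`. -/
abbrev RealSpace (N : Type*) [AddCommGroup N] : Type _ := ℝ ⊗[ℤ] N

/-- The dual lattice `M = Hom(N, ℤ)`. -/
abbrev DualLattice (N : Type*) [AddCommGroup N] : Type _ := Module.Dual ℤ N

/-- The ring `Sym^*(M)` of polynomials with integer coefficients on `N`. -/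
abbrev Poly (N : Type*) [AddCommGroup N] : Type _ := SymmetricAlgebra ℤ (DualLattice N)

/-- The field of fractions of `Sym^*(M)`. It contains the localization `Sym^±(M)` of `Sym^*(M)` at
its nonzero homogeneous elements. -/
abbrev RatFunc (N : Type*) [AddCommGroup N] : Type _ := FractionRing (Poly N)

/-- The Laurent polynomial ring `ℤ[M]`, spanned by the characters `x^u`, `u ∈ M`. -/
abbrev Laurent (N : Type*) [AddCommGroup N] : Type _ := AddMonoidAlgebra ℤ (DualLattice N)

section Lattice

variable {N : Type*} [AddCommGroup N]

/-- The map `N → N_ℝ`. -/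
def latticeMap (N : Type*) [AddCommGroup N] : N →+ RealSpace N where
  toFun a := (1 : ℝ) ⊗ₜ[ℤ] a
  map_zero' := TensorProduct.tmul_zero _ _
  map_add' a b := TensorProduct.tmul_add _ a b

/-- The pairing `⟨u, v⟩` of `u ∈ M` with `v ∈ N_ℝ`, as a function of `u`; on lattice points it is
`⟨u, r ⊗ a⟩ = r * u a`. -/
def pairing (v : RealSpace N) : DualLattice N →ₗ[ℤ] ℝ where
  toFun u := TensorProduct.rid ℤ ℝ (LinearMap.lTensor ℝ u v)
  map_add' u w := by simp [LinearMap.lTensor_add]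
  map_smul' c u := by
    rw [LinearMap.lTensor_smul, LinearMap.smul_apply, map_smul, RingHom.id_apply]

/-- The value of a polynomial in `Sym^*(M)` at a point of `N_ℝ`. -/
def evalAt (v : RealSpace N) : Poly N →ₐ[ℤ] ℝ := SymmetricAlgebra.lift (pairing v)

/-- The homogeneous polynomials of degree `d`, i.e. the summand `Sym^d(M)` of `Sym^*(M)`, spanned
by the `d`-fold products of elements of `M`. It is zero for negative `d`. -/
def homogeneous (N : Type*) [AddCommGroup N] (d : ℤ) : Submodule ℤ (Poly N) :=
  if 0 ≤ d then LinearMap.range (SymmetricAlgebra.ι ℤ (DualLattice N)) ^ d.toNat else ⊥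

/-! ### Generating functions of lattice points -/

/-- The rational function `r` is the generating function `∑_{u ∈ P} x^u` of the set `P ⊆ M`:
`r = g / h` for Laurent polynomials `g`, `h` with `h * ∑_{u ∈ P} x^u = g`, as formal (doubly
infinite) series, where `h` is not a zero divisor. The coefficient of `x^w` in
`h * ∑_{u ∈ P} x^u` is the sum of the coefficients in `h` of the `x^u` with `w - u ∈ P`. -/
def IsGeneratingFunction (P : Set (DualLattice N)) (r : FractionRing (Laurent N)) : Prop :=
  open scoped Classical in
  ∃ (g : Laurent N) (h : (Laurent N)⁰),
    (∀ w : DualLattice N,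
      g.coeff w = (h : Laurent N).coeff.sum fun u c => if w - u ∈ P then c else 0) ∧
    r = IsLocalization.mk' (FractionRing (Laurent N)) g h

/-- The lattice points of the dual cone, `σ^* ∩ M`. -/
def dualPoints (σ : PointedCone ℝ (RealSpace N)) : Set (DualLattice N) :=
  {u | ∀ v ∈ σ, 0 ≤ pairing v u}

/-- The multigraded Hilbert function `Hilb(σ) = ∑_{u ∈ σ^* ∩ M} x^u`, as a rational function. (It
is unique, and it exists for every rational polyhedral cone; the value in other cases is `0`.) -/
def hilb (σ : PointedCone ℝ (RealSpace N)) : FractionRing (Laurent N) :=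
  open scoped Classical in
  if h : ∃ r, IsGeneratingFunction (dualPoints σ) r then h.choose else 0

end Lattice

/-! ### Principal parts at the identity of the torus -/

section PrincipalPart

variable {N : Type*} [AddCommGroup N] [Module.Finite ℤ N]

/-- The unit `1 + t_i` in the power series ring in variables `t_i`. -/
def onePlusX {I : Type*} (i : I) : (MvPowerSeries I ℤ)ˣ :=
  IsUnit.unit (a := 1 + MvPowerSeries.X i)
    (MvPowerSeries.isUnit_iff_constantCoeff.2 (by simp))

/-- A basis `b_i` of the lattice `M`. The functions `t_i = x^{b_i} - 1` are a system of local
parameters at the identity of the torus. -/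
def dualBasis (N : Type*) [AddCommGroup N] [Module.Finite ℤ N] :
    Module.Basis (Module.Free.ChooseBasisIndex ℤ (DualLattice N)) ℤ (DualLattice N) :=
  Module.Free.chooseBasis ℤ (DualLattice N)

/-- The expansion of the character `x^u = ∏ (x^{b_i})^{u_i}`, where `u = ∑ u_i b_i`, as a power
series in the local parameters `t_i = x^{b_i} - 1`. -/
def expandChar (N : Type*) [AddCommGroup N] [Module.Finite ℤ N] :
    Multiplicative (DualLattice N) →*
      MvPowerSeries (Module.Free.ChooseBasisIndex ℤ (DualLattice N)) ℤ where
  toFun u := ((∏ i, onePlusX i ^ ((dualBasis N).repr u.toAdd i) :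
    (MvPowerSeries (Module.Free.ChooseBasisIndex ℤ (DualLattice N)) ℤ)ˣ) :
      MvPowerSeries (Module.Free.ChooseBasisIndex ℤ (DualLattice N)) ℤ)
  map_one' := by simp
  map_mul' u w := by simp [zpow_add, Finset.prod_mul_distrib]

/-- The expansion of a Laurent polynomial as a power series in the local parameters
`t_i = x^{b_i} - 1` at the identity of the torus. -/
def expand (N : Type*) [AddCommGroup N] [Module.Finite ℤ N] :
    Laurent N →ₐ[ℤ] MvPowerSeries (Module.Free.ChooseBasisIndex ℤ (DualLattice N)) ℤ :=
  AddMonoidAlgebra.lift ℤ _ (DualLattice N) (expandChar N)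

/-- The leading form of a Laurent polynomial at the identity of the torus: the sum of the terms of
lowest degree of its power series expansion, where the class of the local parameter
`t_i = x^{b_i} - 1` in the cotangent space is identified with `b_i ∈ M`. The leading form of `0`
is `0`. -/
def leadingForm (g : Laurent N) : Poly N :=
  ∑ m ∈ Finset.finsuppAntidiag Finset.univ (MvPowerSeries.order (expand N g)).toNat,
    MvPowerSeries.coeff m (expand N g) •
      ∏ i, SymmetricAlgebra.ι ℤ (DualLattice N) (dualBasis N i) ^ m i

/-- The principal part `g_∘ / h_∘` of a rational function `g / h` on the torus. -/
def principalPart (r : FractionRing (Laurent N)) : RatFunc N :=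
  algebraMap (Poly N) (RatFunc N) (leadingForm (IsLocalization.sec (Laurent N)⁰ r).1) /
    algebraMap (Poly N) (RatFunc N) (leadingForm (IsLocalization.sec (Laurent N)⁰ r).2.1)

/-- The equivariant multiplicity `e_σ = (-1)^n Hilb(σ)_∘` of a full-dimensional cone in `N_ℝ`,
where `n` is the rank of `N`. -/
def mult (σ : PointedCone ℝ (RealSpace N)) : RatFunc N :=
  (-1) ^ Module.finrank ℤ N * principalPart (hilb σ)

end PrincipalPart

/-! ### The quotient lattice `N / (N ∩ Span τ)` and relative multiplicities -/

section Relative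

variable {N : Type*} [AddCommGroup N]

/-- The sublattice `N ∩ Span τ`. -/
def spanLattice (τ : PointedCone ℝ (RealSpace N)) : AddSubgroup N :=
  (Submodule.span ℝ (τ : Set (RealSpace N))).toAddSubgroup.comap (latticeMap N)

/-- The lattice `N / (N ∩ Span τ)`. -/
abbrev QuotLattice (τ : PointedCone ℝ (RealSpace N)) : Type _ := N ⧸ spanLattice τ

/-- The projection `N → N / (N ∩ Span τ)`. -/
def quotMap (τ : PointedCone ℝ (RealSpace N)) : N →ₗ[ℤ] QuotLattice τ :=
  (QuotientAddGroup.mk' (spanLattice τ)).toIntLinearMap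

theorem quotMap_surjective (τ : PointedCone ℝ (RealSpace N)) :
    Function.Surjective (quotMap τ) :=
  QuotientAddGroup.mk'_surjective (spanLattice τ)

variable [Module.Finite ℤ N]

instance quotLattice_finite (τ : PointedCone ℝ (RealSpace N)) :
    Module.Finite ℤ (QuotLattice τ) :=
  Module.Finite.of_surjective (quotMap τ) (quotMap_surjective τ)

/-- The inclusion of the dual of `N / (N ∩ Span τ)` into `M`, with image `τ^⊥ ∩ M`. -/
def dualIncl (τ : PointedCone ℝ (RealSpace N)) : DualLattice (QuotLattice τ) →ₗ[ℤ] DualLattice N :=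
  (quotMap τ).dualMap

/-- The inclusion of `Sym^*(τ^⊥ ∩ M)` into `Sym^*(M)`. -/
def polyIncl (τ : PointedCone ℝ (RealSpace N)) : Poly (QuotLattice τ) →ₐ[ℤ] Poly N :=
  SymmetricAlgebra.lift (SymmetricAlgebra.ι ℤ (DualLattice N) ∘ₗ dualIncl τ)

theorem quotLattice_free (τ : PointedCone ℝ (RealSpace N)) :
    Module.Free ℤ (QuotLattice τ) := by
  have : Module.IsTorsionFree ℤ (QuotLattice τ) := by
    refine Module.IsTorsionFree.of_smul_eq_zero ?_
    intro c x h
    by_cases hc : c = 0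
    · exact Or.inl hc
    right
    obtain ⟨a, rfl⟩ := quotMap_surjective τ x
    rw [← map_smul] at h
    have h2 : latticeMap N (c • a) ∈ Submodule.span ℝ (τ : Set (RealSpace N)) :=
      (QuotientAddGroup.eq_zero_iff (N := spanLattice τ) (c • a)).1 h
    refine (QuotientAddGroup.eq_zero_iff (N := spanLattice τ) a).2 ?_
    change latticeMap N a ∈ Submodule.span ℝ (τ : Set (RealSpace N))
    have h3 := Submodule.smul_mem _ ((c : ℝ)⁻¹) h2
    rw [map_zsmul, ← Int.cast_smul_eq_zsmul ℝ, smul_smul,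
      inv_mul_cancel₀ (by exact_mod_cast hc), one_smul] at h3
    exact h3
  infer_instance

theorem polyIncl_injective (τ : PointedCone ℝ (RealSpace N)) :
    Function.Injective (polyIncl τ) := by
  have := quotLattice_free τ
  obtain ⟨s, hs⟩ := Module.projective_lifting_property (quotMap τ) LinearMap.id
    (quotMap_surjective τ)
  have hcomp : (SymmetricAlgebra.lift
      (SymmetricAlgebra.ι ℤ (DualLattice (QuotLattice τ)) ∘ₗ s.dualMap)).comp (polyIncl τ) =
      AlgHom.id ℤ _ := by
    apply SymmetricAlgebra.algHom_ext
    ext1 u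
    have hu : s.dualMap (dualIncl τ u) = u := by
      refine LinearMap.ext fun a => ?_
      have := LinearMap.congr_fun hs a
      simp only [LinearMap.comp_apply, LinearMap.id_apply] at this
      change u (quotMap τ (s a)) = u a
      rw [this]
    simp [polyIncl, hu]
  intro p q hpq
  have h1 := DFunLike.congr_fun hcomp p
  have h2 := DFunLike.congr_fun hcomp q
  simp only [AlgHom.comp_apply, AlgHom.id_apply] at h1 h2
  rw [← h1, ← h2, hpq]

/-- The inclusion of the rational functions on `N / (N ∩ Span τ)` into those on `N`. -/
def ratIncl (τ : PointedCone ℝ (RealSpace N)) : RatFunc (QuotLattice τ) →+* RatFunc N :=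
  IsFractionRing.map (A := Poly (QuotLattice τ)) (B := Poly N) (j := (polyIncl τ).toRingHom)
    (polyIncl_injective τ)

/-- The image of a cone `σ` in `(N / (N ∩ Span τ))_ℝ`. -/
def coneImage (σ τ : PointedCone ℝ (RealSpace N)) : PointedCone ℝ (RealSpace (QuotLattice τ)) :=
  σ.map ((quotMap τ).baseChange ℝ)

/-- The relative multiplicity `e_{σ,τ}`: the multiplicity of the image of `σ` in
`(N / (N ∩ Span τ))_ℝ`, regarded as a rational function on `N`. -/
def relMult (σ τ : PointedCone ℝ (RealSpace N)) : RatFunc N :=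
  ratIncl τ (mult (coneImage σ τ))

/-- The dimension of a cone. -/
def coneDim (τ : PointedCone ℝ (RealSpace N)) : ℕ :=
  Module.finrank ℝ (Submodule.span ℝ (τ : Set (RealSpace N)))

end Relative

/-! ### Fans and piecewise polynomials -/

/-- A fan in `N_ℝ`: a finite collection of strongly convex rational polyhedral cones, containing
every face of each of its cones, such that any two of its cones meet in a common face. -/
structure Fan (N : Type*) [AddCommGroup N] where
  cones : Finset (PointedCone ℝ (RealSpace N))
  rational : ∀ σ ∈ cones, ∃ S : Finset N, σ = PointedCone.hull ℝ (latticeMap N '' (S : Set N))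
  salient : ∀ σ ∈ cones, (σ : ConvexCone ℝ (RealSpace N)).Salient
  face_mem : ∀ σ ∈ cones, ∀ τ : PointedCone ℝ (RealSpace N), τ.IsFaceOf σ → τ ∈ cones
  inter_face : ∀ σ ∈ cones, ∀ σ' ∈ cones, (σ ⊓ σ').IsFaceOf σ ∧ (σ ⊓ σ').IsFaceOf σ'

namespace Fan

variable {N : Type*} [AddCommGroup N]

/-- The support `|Δ|`, the union of the cones of `Δ`. -/
def support (Δ : Fan N) : Set (RealSpace N) := {v | ∃ σ ∈ Δ.cones, v ∈ σ}

/-- A fan is complete if its support is all of `N_ℝ`. -/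
def IsComplete (Δ : Fan N) : Prop := Δ.support = Set.univ

/-- The cones of `Δ` that are maximal with respect to inclusion. -/
def maximalCones (Δ : Fan N) : Finset (PointedCone ℝ (RealSpace N)) :=
  open scoped Classical in Δ.cones.filter fun σ => Maximal (· ∈ Δ.cones) σ

/-- The maximal cones of `Δ` that contain `τ`. -/
def maximalConesOver (Δ : Fan N) (τ : PointedCone ℝ (RealSpace N)) :
    Finset (PointedCone ℝ (RealSpace N)) :=
  open scoped Classical in Δ.maximalCones.filter fun σ => τ ≤ σ

end Fan

/-- An element of `PP^k(Δ)`: a continuous function on `|Δ|` (given by a function on `N_ℝ`, of which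
only the values on `|Δ|` matter) whose restriction to each maximal cone is a homogeneous polynomial
of degree `k` with integer coefficients. The finite-dimensional real vector space `N_ℝ` has its
usual topology, which is the module topology. -/
structure PiecewisePolynomial {N : Type*} [AddCommGroup N] (Δ : Fan N) (k : ℕ) where
  toFun : RealSpace N → ℝ
  continuousOn : @ContinuousOn _ _ (moduleTopology ℝ (RealSpace N)) _ toFun Δ.support
  exists_poly : ∀ σ ∈ Δ.maximalCones, ∃ p ∈ homogeneous N k, ∀ v ∈ σ, toFun v = evalAt v p

/-- The restriction `f_σ` of a piecewise polynomial function to a maximal cone `σ`, as an element of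
`Sym^*(M)`. (The polynomial is unique when `σ` is full-dimensional. The value for cones which are
not maximal is `0`.) -/
def PiecewisePolynomial.restrict {N : Type*} [AddCommGroup N] {Δ : Fan N} {k : ℕ}
    (f : PiecewisePolynomial Δ k) (σ : PointedCone ℝ (RealSpace N)) : Poly N :=
  open scoped Classical in
  if hσ : σ ∈ Δ.maximalCones then (f.exists_poly σ hσ).choose else 0

end ToricLocalization

end

/-! The sum $c(\tau)$ has at most simple poles along finitely many rational hyperplanes, and these
cancel because $f$ takes the same values on both sides of each wall. Everything takes place in the
lattice $N/(N\cap\operatorname{Span}\tau)$, of rank $n'=n-\dim\tau$.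

For a finite set `L` of functionals, `part L` is the component of degree $-n'$ at the identity of
the generating function of the lattice points dual to the cone $\{u\ge 0 : u\in L\}$. Fixing the
degree, instead of taking the lowest nonzero term, makes it additive. Three facts are used.

Poles (`exists_hasPart`): the dual points split into disjoint translates $w+\mathbb N B$ with
$B\subseteq L$ independent, whose generating functions are $x^w/\prod_{u\in B}(1-x^u)$. Hence the
pole has order at most $n'$, and `part L` times $\prod_{u\in L}u$ is a form of degree $|L|-n'$.

Comparison (`principalPart_hilb_eq_part`): if the cone contains no line and has an interior point,
then at that point the full-rank pieces contribute with equal signs, so `part L` is nonzero and is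
the principal part of Hilb. If there is no interior point, the series is invariant under a
translation and both sides vanish.

Additivity (`part_insert_add_part_insert_neg`): cutting a cone by a hyperplane splits `part`, since
the slice in the hyperplane contributes zero.

Now take one vector from each pair $\pm u$ among the defining inequalities of all the cones, and cut
every cone by all these hyperplanes. The sum becomes a sum over chambers, each weighted by the
polynomial of the cone containing it. For a fixed $u$, pair the chambers that differ only in the
sign of $u$. Their parts add up to the part of a cone not involving $u$, so without a pole along
$u$; the two polynomials differ by a multiple of $u$, which cancels the remaining simple pole. The
chosen $u$ are primitive, hence pairwise nonassociate primes of the polynomial ring, so the sum is a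
polynomial, and its degree follows from that of the parts (`exists_sum_part_mul_eq`).

The fan enters through three facts: the images of the maximal cones over $\tau$ cover the quotient,
two with a common interior point coincide, and the polynomials agree on common walls. -/

open scoped TensorProduct nonZeroDivisors

noncomputable section

namespace ToricLocalization

/-! ### Graded power series expansion at the identity of the torus -/

section Expansion

variable {N : Type*} [AddCommGroup N] [Module.Finite ℤ N]

/-- The monomial in the basis of `M` with a given exponent. -/
def basisMonomial (m : Module.Free.ChooseBasisIndex ℤ (DualLattice N) →₀ ℕ) : Poly N :=
  ∏ i, SymmetricAlgebra.ι ℤ (DualLattice N) (dualBasis N i) ^ m i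

theorem basisMonomial_add (m m' : Module.Free.ChooseBasisIndex ℤ (DualLattice N) →₀ ℕ) :
    basisMonomial (m + m') = basisMonomial m * basisMonomial m' := by
  simp [basisMonomial, pow_add, Finset.prod_mul_distrib]

theorem basisMonomial_zero :
    basisMonomial (0 : Module.Free.ChooseBasisIndex ℤ (DualLattice N) →₀ ℕ) = 1 := by
  simp [basisMonomial]

/-- The graded expansion of a power series in the local parameters: the form of degree `d` is the
coefficient of `T ^ d`. -/
def gradedSeries (f : MvPowerSeries (Module.Free.ChooseBasisIndex ℤ (DualLattice N)) ℤ) :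
    PowerSeries (Poly N) :=
  PowerSeries.mk fun d => ∑ m ∈ Finset.finsuppAntidiag Finset.univ d,
    MvPowerSeries.coeff m f • basisMonomial m

theorem gradedSeries_mul
    (f g : MvPowerSeries (Module.Free.ChooseBasisIndex ℤ (DualLattice N)) ℤ) :
    gradedSeries (f * g) = gradedSeries f * gradedSeries g := by
  classical
  ext d
  simp only [gradedSeries, PowerSeries.coeff_mk, PowerSeries.coeff_mul, MvPowerSeries.coeff_mul,
    Finset.sum_smul, Finset.sum_mul_sum]
  simp only [← Finset.sum_product', Finset.sum_sigma']
  -- Both sides sum over pairs of exponents: on the left grouped by their sum, on the right by their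
  -- two degrees.
  refine Finset.sum_bij' (fun x _ => ⟨(x.2.1.sum fun _ a => a, x.2.2.sum fun _ a => a), x.2⟩)
    (fun y _ => ⟨y.2.1 + y.2.2, y.2⟩) ?_ ?_ ?_ ?_ ?_
  · rintro ⟨m, p, q⟩ h
    simp only [Finset.mem_sigma, Finset.mem_finsuppAntidiag, Finset.HasAntidiagonal.mem_antidiagonal,
      Finset.mem_product] at h ⊢
    obtain ⟨⟨h1, -⟩, rfl⟩ := h
    simp [Finsupp.sum_fintype, ← h1, Finset.sum_add_distrib]
  · rintro ⟨⟨i, j⟩, p, q⟩ h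
    simp only [Finset.mem_sigma, Finset.mem_finsuppAntidiag, Finset.HasAntidiagonal.mem_antidiagonal,
      Finset.mem_product] at h ⊢
    simp [← h.1, ← h.2.1.1, ← h.2.2.1, Finset.sum_add_distrib]
  · rintro ⟨m, p, q⟩ h
    simp only [Finset.mem_sigma, Finset.HasAntidiagonal.mem_antidiagonal] at h
    simp [h.2]
  · rintro ⟨⟨i, j⟩, p, q⟩ h
    simp only [Finset.mem_sigma, Finset.mem_finsuppAntidiag, Finset.HasAntidiagonal.mem_antidiagonal,
      Finset.mem_product] at h
    simp [Finsupp.sum_fintype, h.2.1.1, h.2.2.1]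
  · rintro ⟨m, p, q⟩ h
    simp only [Finset.mem_sigma, Finset.HasAntidiagonal.mem_antidiagonal] at h
    simp only [← h.2, basisMonomial_add, smul_mul_smul_comm]

theorem gradedSeries_one :
    gradedSeries (1 : MvPowerSeries (Module.Free.ChooseBasisIndex ℤ (DualLattice N)) ℤ) = 1 := by
  classical
  ext d
  simp only [gradedSeries, PowerSeries.coeff_mk, PowerSeries.coeff_one, MvPowerSeries.coeff_one]
  split_ifs with h
  · subst h
    simp [Finset.finsuppAntidiag_zero, basisMonomial_zero]
  · refine Finset.sum_eq_zero fun m hm => ?_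
    rw [if_neg, zero_smul]
    rintro rfl
    simp [Finset.mem_finsuppAntidiag] at hm
    exact h hm.symm

theorem linearIndependent_basisMonomial :
    LinearIndependent ℤ (basisMonomial (N := N)) := by
  have h := (MvPolynomial.basisMonomials
    (Module.Free.ChooseBasisIndex ℤ (DualLattice N)) ℤ).linearIndependent
  have h2 := h.map' (SymmetricAlgebra.equivMvPolynomial (dualBasis N)).symm.toLinearMap
    (LinearEquiv.ker (SymmetricAlgebra.equivMvPolynomial (dualBasis N)).symm.toLinearEquiv)
  have h3 : (SymmetricAlgebra.equivMvPolynomial (dualBasis N)).symm.toLinearMap ∘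
      MvPolynomial.basisMonomials (Module.Free.ChooseBasisIndex ℤ (DualLattice N)) ℤ =
      basisMonomial (N := N) := by
    ext m
    simp [basisMonomial, MvPolynomial.monomial_eq, Finsupp.prod_fintype]
  rw [h3] at h2
  convert h2

theorem gradedSeries_coeff_eq_zero_iff (d : ℕ)
    (f : MvPowerSeries (Module.Free.ChooseBasisIndex ℤ (DualLattice N)) ℤ) :
    PowerSeries.coeff d (gradedSeries f) = 0 ↔ ∀ m : _ →₀ ℕ, m.degree = d → MvPowerSeries.coeff m f = 0 := by
  classical
  simp only [gradedSeries, PowerSeries.coeff_mk]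
  constructor
  · intro h m hm
    exact linearIndependent_iff'.1 linearIndependent_basisMonomial _ _ h m
      (by simp [Finset.mem_finsuppAntidiag, ← hm, Finsupp.degree_eq_sum])
  · intro h
    refine Finset.sum_eq_zero fun m hm => ?_
    rw [h m, zero_smul]
    simp only [Finset.mem_finsuppAntidiag] at hm
    rw [Finsupp.degree_eq_sum, hm.1]

/-- `gradedSeries` as a ring homomorphism. -/
def gradedSeriesHom : MvPowerSeries (Module.Free.ChooseBasisIndex ℤ (DualLattice N)) ℤ →+*
    PowerSeries (Poly N) where
  toFun := gradedSeries
  map_one' := gradedSeries_one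
  map_mul' := gradedSeries_mul
  map_zero' := by ext; simp [gradedSeries]
  map_add' f g := by ext; simp [gradedSeries, add_smul, Finset.sum_add_distrib]

theorem gradedSeriesHom_injective : Function.Injective (gradedSeriesHom (N := N)) := by
  rw [injective_iff_map_eq_zero]
  intro f hf
  ext m
  exact (gradedSeries_coeff_eq_zero_iff m.degree f).1
    (by change PowerSeries.coeff _ (gradedSeriesHom f) = 0; simp [hf]) m rfl

/-- The expansion of a Laurent polynomial at the identity, graded by degree. -/
def gradedExpand (N : Type*) [AddCommGroup N] [Module.Finite ℤ N] :
    Laurent N →+* PowerSeries (Poly N) :=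
  gradedSeriesHom.comp (expand N).toRingHom

theorem prod_pow_mem_pow_sum {R A ι : Type*} [CommSemiring R] [CommSemiring A] [Algebra R A]
    (P : Submodule R A) (s : Finset ι) (x : ι → A) (m : ι → ℕ) (hx : ∀ i ∈ s, x i ∈ P) :
    ∏ i ∈ s, x i ^ m i ∈ P ^ ∑ i ∈ s, m i := by
  classical
  induction s using Finset.induction_on with
  | empty => simpa using (Submodule.one_le (P := (1 : Submodule R A))).1 le_rfl
  | insert i s hi ih =>
    rw [Finset.prod_insert hi, Finset.sum_insert hi, pow_add]
    exact Submodule.mul_mem_mul (Submodule.pow_mem_pow _ (hx i (by simp)) _)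
      (ih fun j hj => hx j (by simp [hj]))

theorem coeff_gradedSeries_mem (d : ℕ)
    (f : MvPowerSeries (Module.Free.ChooseBasisIndex ℤ (DualLattice N)) ℤ) :
    PowerSeries.coeff d (gradedSeries f) ∈ homogeneous N d := by
  simp only [gradedSeries, PowerSeries.coeff_mk, homogeneous, Nat.cast_nonneg, if_true,
    Int.toNat_natCast]
  refine Submodule.sum_mem _ fun m hm => zsmul_mem ?_ _
  simp only [Finset.mem_finsuppAntidiag] at hm
  rw [← hm.1]
  exact prod_pow_mem_pow_sum _ _ _ _ fun i _ => ⟨_, rfl⟩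

theorem expand_single (u : DualLattice N) (c : ℤ) :
    expand N (AddMonoidAlgebra.single u c) =
      (c : MvPowerSeries (Module.Free.ChooseBasisIndex ℤ (DualLattice N)) ℤ) *
        expandChar N (Multiplicative.ofAdd u) := by
  rw [expand, AddMonoidAlgebra.lift_single, Algebra.smul_def, eq_intCast]

theorem expandChar_basis (i : Module.Free.ChooseBasisIndex ℤ (DualLattice N)) :
    expandChar N (Multiplicative.ofAdd (dualBasis N i)) = 1 + MvPowerSeries.X i := by
  classical
  simp only [expandChar, MonoidHom.coe_mk, OneHom.coe_mk, toAdd_ofAdd, Module.Basis.repr_self]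
  rw [Finset.prod_eq_single i]
  · simp [onePlusX]
  · intro j _ hj
    rw [Finsupp.single_eq_of_ne hj, zpow_zero]
  · simp

/-- The inclusion of the polynomial ring in the `x^{b_i}` into the Laurent polynomials. -/
def polyToLaurent (N : Type*) [AddCommGroup N] [Module.Finite ℤ N] :
    MvPolynomial (Module.Free.ChooseBasisIndex ℤ (DualLattice N)) ℤ →ₐ[ℤ] Laurent N :=
  MvPolynomial.aeval fun i => AddMonoidAlgebra.single (dualBasis N i) 1

/-- On polynomials in the `x^{b_i}` the expansion is the substitution `X_i ↦ 1 + X_i`, which `X_i ↦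
X_i - 1` inverts. -/
theorem expand_polyToLaurent_injective :
    Function.Injective ((expand N).comp (polyToLaurent N)) := by
  have h : (expand N).comp (polyToLaurent N) =
      (MvPolynomial.coeToMvPowerSeries.algHom ℤ).comp
        (MvPolynomial.aeval fun i => 1 + MvPolynomial.X i) := by
    ext i
    simp [polyToLaurent, expand_single, expandChar_basis]
  have h2 : Function.Injective (MvPolynomial.aeval fun i => 1 + MvPolynomial.X i :
      MvPolynomial (Module.Free.ChooseBasisIndex ℤ (DualLattice N)) ℤ →ₐ[ℤ]
      MvPolynomial (Module.Free.ChooseBasisIndex ℤ (DualLattice N)) ℤ) := by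
    apply Function.LeftInverse.injective (g := MvPolynomial.aeval fun i => MvPolynomial.X i - 1)
    intro p
    rw [← AlgHom.comp_apply]
    conv_rhs => rw [← AlgHom.id_apply (R := ℤ) p]
    congr 1
    ext i
    simp
  rw [h]
  intro p q hpq
  simp only [AlgHom.comp_apply, MvPolynomial.coeToMvPowerSeries.algHom_apply, Algebra.algebraMap_self] at hpq
  exact h2 (MvPolynomial.coe_injective _ _ hpq)

theorem exists_mul_mem_range_polyToLaurent (g : Laurent N) :
    ∃ n : ℕ, g * AddMonoidAlgebra.single (∑ i, dualBasis N i) 1 ^ n ∈ (polyToLaurent N).range := by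
  have hT : AddMonoidAlgebra.single (∑ i, dualBasis N i) 1 ∈ (polyToLaurent N).range := by
    refine ⟨∏ i, MvPolynomial.X i, ?_⟩
    simp only [polyToLaurent, AlgHom.toRingHom_eq_coe, RingHom.coe_coe, map_prod,
      MvPolynomial.aeval_X]
    simp
  induction g using AddMonoidAlgebra.induction_linear with
  | zero => exact ⟨0, by simp⟩
  | add f g hf hg =>
    obtain ⟨n, hn⟩ := hf
    obtain ⟨m, hm⟩ := hg
    refine ⟨n + m, ?_⟩
    rw [add_mul]
    refine add_mem ?_ ?_
    · rw [pow_add, ← mul_assoc]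
      exact mul_mem hn (pow_mem hT _)
    · rw [add_comm n, pow_add, ← mul_assoc]
      exact mul_mem hm (pow_mem hT _)
  | single u c =>
    have hu : ∀ i, ((dualBasis N).repr u i).natAbs ≤ ∑ i, ((dualBasis N).repr u i).natAbs :=
      fun i => Finset.single_le_sum (f := fun i => ((dualBasis N).repr u i).natAbs)
        (fun _ _ => Nat.zero_le _) (Finset.mem_univ i)
    -- The sum of the absolute values of the exponents bounds each of them, so this power makes all
    -- exponents nonnegative.
    refine ⟨∑ i, ((dualBasis N).repr u i).natAbs, MvPolynomial.C c * ∏ i, MvPolynomial.X i ^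
      ((dualBasis N).repr u i + ((∑ i, ((dualBasis N).repr u i).natAbs : ℕ) : ℤ)).toNat, ?_⟩
    generalize ∑ i, ((dualBasis N).repr u i).natAbs = n at hu
    have he : ∑ i, ((dualBasis N).repr u i + (n : ℤ)).toNat • dualBasis N i =
        u + n • ∑ i, dualBasis N i := by
      rw [Finset.smul_sum]
      conv_rhs => rw [← (dualBasis N).sum_repr u, ← Finset.sum_add_distrib]
      refine Finset.sum_congr rfl fun i _ => ?_
      rw [← natCast_zsmul, ← natCast_zsmul, ← add_smul, Int.toNat_of_nonneg]
      have := hu i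
      omega
    simp only [polyToLaurent, AlgHom.toRingHom_eq_coe, RingHom.coe_coe, map_mul, map_prod, map_pow,
      MvPolynomial.aeval_X, MvPolynomial.aeval_C, AddMonoidAlgebra.single_pow, one_pow]
    rw [AddMonoidAlgebra.single_mul_single, ← he, mul_one]
    simp [← zsmul_eq_mul, AddMonoidAlgebra.smul_single]

theorem expand_injective : Function.Injective (expand N) := by
  rw [injective_iff_map_eq_zero]
  intro g hg
  obtain ⟨n, p, hp⟩ := exists_mul_mem_range_polyToLaurent g
  have hu : IsUnit (AddMonoidAlgebra.single (∑ i, dualBasis N i) 1 ^ n : Laurent N) := by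
    apply IsUnit.pow
    refine IsUnit.of_mul_eq_one (AddMonoidAlgebra.single (-∑ i, dualBasis N i) 1) ?_
    simp [AddMonoidAlgebra.single_mul_single, AddMonoidAlgebra.one_def]
  have hp2 : polyToLaurent N p = g * AddMonoidAlgebra.single (∑ i, dualBasis N i) 1 ^ n := hp
  have h0 : p = 0 := by
    apply expand_polyToLaurent_injective
    simp [hp2, hg]
  rw [h0, map_zero] at hp2
  exact (hu.mul_left_eq_zero).1 hp2.symm

theorem gradedExpand_injective : Function.Injective (gradedExpand N) :=
  gradedSeriesHom_injective.comp expand_injective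

instance laurent_isDomain : IsDomain (Laurent N) :=
  gradedExpand_injective.isDomain _

theorem constantCoeff_expandChar (u : Multiplicative (DualLattice N)) :
    MvPowerSeries.constantCoeff (expandChar N u) = 1 := by
  have h : ∀ i : Module.Free.ChooseBasisIndex ℤ (DualLattice N),
      Units.map (MvPowerSeries.constantCoeff (R := ℤ)).toMonoidHom (onePlusX i) = 1 := by
    intro i
    ext
    simp [onePlusX]
  change ((Units.map (MvPowerSeries.constantCoeff (R := ℤ)).toMonoidHom
    (∏ i, onePlusX i ^ ((dualBasis N).repr u.toAdd i)) : ℤˣ) : ℤ) = 1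
  rw [map_prod, Finset.prod_eq_one fun i _ => by rw [map_zpow, h, one_zpow], Units.val_one]

theorem coeff_zero_gradedSeries
    (f : MvPowerSeries (Module.Free.ChooseBasisIndex ℤ (DualLattice N)) ℤ) :
    PowerSeries.coeff 0 (gradedSeries f) = ((MvPowerSeries.constantCoeff f : ℤ) : Poly N) := by
  simp [gradedSeries, Finset.finsuppAntidiag_zero, basisMonomial_zero]

theorem coeff_zero_gradedExpand_single (u : DualLattice N) :
    PowerSeries.coeff 0 (gradedExpand N (AddMonoidAlgebra.single u 1)) = 1 := by
  change PowerSeries.coeff 0 (gradedSeries (expand N _)) = 1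
  rw [coeff_zero_gradedSeries, expand_single, Int.cast_one, one_mul, constantCoeff_expandChar,
    Int.cast_one]

theorem coeff_one_gradedSeries_X (i : Module.Free.ChooseBasisIndex ℤ (DualLattice N)) :
    PowerSeries.coeff 1 (gradedSeries (MvPowerSeries.X i)) =
      SymmetricAlgebra.ι ℤ (DualLattice N) (dualBasis N i) := by
  classical
  simp only [gradedSeries, PowerSeries.coeff_mk, MvPowerSeries.coeff_X]
  rw [Finset.sum_eq_single (Finsupp.single i 1)]
  · rw [if_pos rfl, one_smul, basisMonomial, Finset.prod_eq_single i]
    · simp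
    · intro j _ hj
      simp [Finsupp.single_eq_of_ne hj]
    · simp
  · intro m _ hm
    rw [if_neg hm, zero_smul]
  · intro h
    simp [Finset.mem_finsuppAntidiag, Finsupp.single_apply] at h

/-- Constant terms of characters are `1`, so the linear term is additive in `u` and can be compared
on a basis. -/
theorem coeff_one_gradedExpand_single (u : DualLattice N) :
    PowerSeries.coeff 1 (gradedExpand N (AddMonoidAlgebra.single u 1)) =
      SymmetricAlgebra.ι ℤ (DualLattice N) u := by
  let F : DualLattice N →+ Poly N := AddMonoidHom.mk'
    (fun u => PowerSeries.coeff 1 (gradedExpand N (AddMonoidAlgebra.single u 1))) (by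
      intro u v
      have h : (AddMonoidAlgebra.single (u + v) 1 : Laurent N) =
          AddMonoidAlgebra.single u 1 * AddMonoidAlgebra.single v 1 := by
        simp [AddMonoidAlgebra.single_mul_single]
      simp only [h, map_mul, PowerSeries.coeff_mul, Finset.Nat.antidiagonal_succ,
        Finset.Nat.antidiagonal_zero, Finset.map_singleton, Finset.sum_cons,
        Finset.sum_singleton, Function.Embedding.prodMap, Function.Embedding.coeFn_mk, Prod.map,
        coeff_zero_gradedExpand_single]
      simp [coeff_zero_gradedExpand_single, add_comm])
  have hF : F.toIntLinearMap = SymmetricAlgebra.ι ℤ (DualLattice N) := by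
    refine (dualBasis N).ext fun i => ?_
    change PowerSeries.coeff 1 (gradedSeriesHom (expand N _)) = _
    rw [expand_single, Int.cast_one, one_mul, expandChar_basis, map_add, map_add, map_one,
      PowerSeries.coeff_one, if_neg one_ne_zero, zero_add]
    exact coeff_one_gradedSeries_X i
  exact LinearMap.congr_fun hF u

end Expansion

/-! ### Laurent polynomials acting on doubly infinite series -/

section Action

variable {N : Type*} [AddCommGroup N]

/-- Translation of functions on `M`. -/
def translate (N : Type*) [AddCommGroup N] :
    Multiplicative (DualLattice N) →* Module.End ℤ (DualLattice N → ℤ) where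
  toFun u :=
    { toFun := fun φ w => φ (w - u.toAdd)
      map_add' := fun _ _ => rfl
      map_smul' := fun _ _ => rfl }
  map_one' := by ext; simp
  map_mul' u v := by
    refine LinearMap.ext fun φ => funext fun w => ?_
    simp [sub_sub]

/-- Laurent polynomials act on functions on `M`, i.e. on doubly infinite series. -/
def act (N : Type*) [AddCommGroup N] : Laurent N →ₐ[ℤ] Module.End ℤ (DualLattice N → ℤ) :=
  AddMonoidAlgebra.lift ℤ _ (DualLattice N) (translate N)

theorem act_single (u : DualLattice N) (φ : DualLattice N → ℤ) (w : DualLattice N) :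
    act N (AddMonoidAlgebra.single u 1) φ w = φ (w - u) := by
  simp [act, translate]

theorem act_apply (h : Laurent N) (φ : DualLattice N → ℤ) (w : DualLattice N) :
    act N h φ w = h.coeff.sum fun u c => c * φ (w - u) := by
  simp [act, AddMonoidAlgebra.lift_apply, Finsupp.sum, translate, LinearMap.sum_apply]

theorem act_coeff (h g : Laurent N) : act N h (fun w => g.coeff w) = fun w => (h * g).coeff w := by
  induction h using AddMonoidAlgebra.induction_linear with
  | zero => ext; simp
  | add f g hf hg => ext w; simp [hf, hg, add_mul]
  | single u c =>
    ext w
    rw [act_apply, AddMonoidAlgebra.coeff_single, Finsupp.sum_single_index (by simp)]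
    simp [AddMonoidAlgebra.coeff_single_mul_apply, sub_eq_neg_add]

open scoped Classical in
theorem isGeneratingFunction_iff (P : Set (DualLattice N)) (r : FractionRing (Laurent N)) :
    IsGeneratingFunction P r ↔ ∃ (g : Laurent N) (h : (Laurent N)⁰),
      act N h (P.indicator 1) = (fun w => g.coeff w) ∧
      r = IsLocalization.mk' (FractionRing (Laurent N)) g h := by
  simp only [IsGeneratingFunction, funext_iff, act_apply, Set.indicator_apply, Pi.one_apply,
    mul_ite, mul_one, mul_zero]
  refine exists_congr fun g => exists_congr fun h => and_congr_left fun _ => ?_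
  exact forall_congr' fun w => eq_comm

/-- The products `h' * g` and `h * g'` both describe the action of `h * h'` on the series, so they
coincide. -/
theorem IsGeneratingFunction.unique {P : Set (DualLattice N)} {r r' : FractionRing (Laurent N)}
    (hr : IsGeneratingFunction P r) (hr' : IsGeneratingFunction P r') : r = r' := by
  rw [isGeneratingFunction_iff] at hr hr'
  obtain ⟨g, h, h1, rfl⟩ := hr
  obtain ⟨g', h', h1', rfl⟩ := hr'
  rw [IsLocalization.mk'_eq_iff_eq]
  congr 1
  apply AddMonoidAlgebra.coeff_injective
  apply DFunLike.coe_injective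
  change (fun w => ((h' : Laurent N) * g).coeff w) = (fun w => ((h : Laurent N) * g').coeff w)
  rw [← act_coeff, ← act_coeff, ← h1, ← h1', ← Module.End.mul_apply, ← Module.End.mul_apply,
    ← map_mul, ← map_mul, mul_comm]

theorem hilb_eq {σ : PointedCone ℝ (RealSpace N)} {r : FractionRing (Laurent N)}
    (hr : IsGeneratingFunction (dualPoints σ) r) : hilb σ = r := by
  have h : ∃ r, IsGeneratingFunction (dualPoints σ) r := ⟨r, hr⟩
  rw [hilb, dif_pos h]
  exact h.choose_spec.unique hr

end Action

/-! ### Values of polynomials at lattice points -/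

section Evaluation

variable {N : Type*} [AddCommGroup N]

/-- The value of a polynomial at a lattice point. -/
def evalInt (x : N) : Poly N →ₐ[ℤ] ℤ := SymmetricAlgebra.lift (LinearMap.applyₗ x)

@[simp]
theorem evalInt_ι (x : N) (u : DualLattice N) :
    evalInt x (SymmetricAlgebra.ι ℤ (DualLattice N) u) = u x := by
  simp [evalInt]

theorem ι_injective : Function.Injective (SymmetricAlgebra.ι ℤ (DualLattice N)) := by
  intro u v huv
  ext x
  rw [← evalInt_ι, huv, evalInt_ι]

end Evaluation

/-! ### Leading coefficients of products of power series -/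

section PowerSeries

theorem coeff_add_mul_of_X_pow_dvd {R : Type*} [CommRing R] {f g : PowerSeries R} {a b : ℕ}
    (hf : PowerSeries.X ^ a ∣ f) (hg : PowerSeries.X ^ b ∣ g) :
    PowerSeries.coeff (a + b) (f * g) = PowerSeries.coeff a f * PowerSeries.coeff b g := by
  obtain ⟨f, rfl⟩ := hf
  obtain ⟨g, rfl⟩ := hg
  rw [mul_mul_mul_comm, ← pow_add]
  have h := fun (f : PowerSeries R) n => PowerSeries.coeff_X_pow_mul f n 0
  simp only [zero_add] at h
  rw [h, h, h]
  simp

theorem X_pow_dvd_prod_and_coeff {R ι : Type*} [CommRing R] (s : Finset ι)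
    (f : ι → PowerSeries R) (hf : ∀ i ∈ s, PowerSeries.X ∣ f i) :
    PowerSeries.X ^ s.card ∣ ∏ i ∈ s, f i ∧
      PowerSeries.coeff s.card (∏ i ∈ s, f i) = ∏ i ∈ s, PowerSeries.coeff 1 (f i) := by
  classical
  induction s using Finset.induction_on with
  | empty => simp
  | insert i s hi ih =>
    obtain ⟨h1, h2⟩ := ih fun j hj => hf j (by simp [hj])
    have h3 := hf i (by simp)
    rw [Finset.prod_insert hi, Finset.card_insert_of_notMem hi, Finset.prod_insert hi, ← h2,
      add_comm, pow_add, pow_one]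
    exact ⟨mul_dvd_mul h3 h1, coeff_add_mul_of_X_pow_dvd (by simpa using h3) h1⟩

end PowerSeries

/-! ### Principal parts, and parts of degree `-n` -/

section PrincipalPart

variable {N : Type*} [AddCommGroup N] [Module.Finite ℤ N]

theorem leadingForm_eq {g : Laurent N} {b : ℕ} (h1 : PowerSeries.X ^ b ∣ gradedExpand N g)
    (h2 : PowerSeries.coeff b (gradedExpand N g) ≠ 0) :
    leadingForm g = PowerSeries.coeff b (gradedExpand N g) := by
  have h : MvPowerSeries.order (expand N g) = b := by
    rw [MvPowerSeries.order_eq_nat]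
    constructor
    · by_contra! h
      exact h2 ((gradedSeries_coeff_eq_zero_iff b _).2 fun m hm => by_contra fun h3 => h m h3 hm)
    · intro m hm
      exact (gradedSeries_coeff_eq_zero_iff m.degree _).1 (PowerSeries.X_pow_dvd_iff.1 h1 _ hm) m rfl
  rw [leadingForm, h, ENat.toNat_natCast]
  change _ = PowerSeries.coeff b (gradedSeries (expand N g))
  rw [gradedSeries, PowerSeries.coeff_mk]
  rfl

theorem exists_leading {g : Laurent N} (hg : g ≠ 0) :
    ∃ b, PowerSeries.X ^ b ∣ gradedExpand N g ∧ PowerSeries.coeff b (gradedExpand N g) ≠ 0 := by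
  have h : gradedExpand N g ≠ 0 := (map_ne_zero_iff _ gradedExpand_injective).2 hg
  exact ⟨_, PowerSeries.X_pow_order_dvd, PowerSeries.coeff_order h⟩

theorem leadingForm_ne_zero {g : Laurent N} (hg : g ≠ 0) : leadingForm g ≠ 0 := by
  obtain ⟨b, h1, h2⟩ := exists_leading hg
  rwa [leadingForm_eq h1 h2]

theorem leadingForm_zero : leadingForm (0 : Laurent N) = 0 := by
  simp [leadingForm]

theorem leadingForm_mul (g h : Laurent N) :
    leadingForm (g * h) = leadingForm g * leadingForm h := by
  by_cases hg : g = 0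
  · simp [hg, leadingForm_zero]
  by_cases hh : h = 0
  · simp [hh, leadingForm_zero]
  obtain ⟨a, h1, h2⟩ := exists_leading hg
  obtain ⟨b, h3, h4⟩ := exists_leading hh
  have h5 := coeff_add_mul_of_X_pow_dvd h1 h3
  rw [← map_mul] at h5
  rw [leadingForm_eq h1 h2, leadingForm_eq h3 h4, ← h5, leadingForm_eq]
  · rw [map_mul, pow_add]
    exact mul_dvd_mul h1 h3
  · rw [h5]
    exact mul_ne_zero h2 h4

/-- Leading forms are multiplicative, so the quotient does not depend on the fraction picked by
`IsLocalization.sec`. -/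
theorem principalPart_mk' (g : Laurent N) (h : (Laurent N)⁰) :
    principalPart (IsLocalization.mk' (FractionRing (Laurent N)) g h) =
      algebraMap (Poly N) (RatFunc N) (leadingForm g) /
        algebraMap (Poly N) (RatFunc N) (leadingForm h) := by
  set r := IsLocalization.mk' (FractionRing (Laurent N)) g h with hr
  have h1 := IsLocalization.mk'_sec (M := (Laurent N)⁰) (FractionRing (Laurent N)) r
  rw [hr, IsLocalization.mk'_eq_iff_eq] at h1
  have h2 := congrArg leadingForm (IsFractionRing.injective (Laurent N) _ h1)
  rw [leadingForm_mul, leadingForm_mul] at h2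
  have h3 : ∀ d : (Laurent N)⁰, algebraMap (Poly N) (RatFunc N) (leadingForm d) ≠ 0 := fun d =>
    (map_ne_zero_iff _ (IsFractionRing.injective _ _)).2
      (leadingForm_ne_zero (nonZeroDivisors.ne_zero d.2))
  rw [principalPart, div_eq_div_iff (h3 _) (h3 _), ← map_mul, ← map_mul, mul_comm, h2, mul_comm]

/-- The series `φ` on `M` is the expansion of a rational function with a pole of order at most
`n = rank N` at the identity of the torus, and `e` is its part of degree `-n`. -/
def HasPart (φ : DualLattice N → ℤ) (e : RatFunc N) : Prop :=
  ∃ (g h : Laurent N) (b : ℕ), act N h φ = (fun w => g.coeff w) ∧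
    -- Here `b` is the exact order of `h`; the factor `X ^ n` expresses "order of `g` at least `b -
    -- n`" without negative exponents.
    PowerSeries.X ^ b ∣ PowerSeries.X ^ Module.finrank ℤ N * gradedExpand N g ∧
    PowerSeries.X ^ b ∣ gradedExpand N h ∧ PowerSeries.coeff b (gradedExpand N h) ≠ 0 ∧
    algebraMap (Poly N) (RatFunc N)
      (PowerSeries.coeff b (PowerSeries.X ^ Module.finrank ℤ N * gradedExpand N g)) =
        e * algebraMap (Poly N) (RatFunc N) (PowerSeries.coeff b (gradedExpand N h))

theorem HasPart.unique {φ : DualLattice N → ℤ} {e e' : RatFunc N} (h : HasPart φ e)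
    (h' : HasPart φ e') : e = e' := by
  obtain ⟨g1, h1, b1, ha1, hg1, hh1, hn1, he1⟩ := h
  obtain ⟨g2, h2, b2, ha2, hg2, hh2, hn2, he2⟩ := h'
  have hgh : h2 * g1 = h1 * g2 := by
    apply AddMonoidAlgebra.coeff_injective
    apply DFunLike.coe_injective
    change (fun w => (h2 * g1).coeff w) = (fun w => (h1 * g2).coeff w)
    rw [← act_coeff, ← act_coeff, ← ha1, ← ha2, ← Module.End.mul_apply, ← Module.End.mul_apply,
      ← map_mul, ← map_mul, mul_comm]
  have h3 := coeff_add_mul_of_X_pow_dvd hg1 hh2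
  have h4 := coeff_add_mul_of_X_pow_dvd hg2 hh1
  have h34 : PowerSeries.X ^ Module.finrank ℤ N * gradedExpand N g1 * gradedExpand N h2 =
      PowerSeries.X ^ Module.finrank ℤ N * gradedExpand N g2 * gradedExpand N h1 := by
    rw [mul_assoc, mul_assoc, mul_comm _ (gradedExpand N h2), ← map_mul (gradedExpand N), hgh,
      map_mul, mul_comm (gradedExpand N h1)]
  rw [h34, add_comm, h4] at h3
  have h5 := congrArg (algebraMap (Poly N) (RatFunc N)) h3
  rw [map_mul (algebraMap _ _), map_mul (algebraMap _ _), he1, he2] at h5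
  have hn : ∀ p : Poly N, p ≠ 0 → algebraMap (Poly N) (RatFunc N) p ≠ 0 := fun p hp =>
    (map_ne_zero_iff _ (IsFractionRing.injective _ _)).2 hp
  have h6 := mul_ne_zero (hn _ hn1) (hn _ hn2)
  apply mul_right_cancel₀ h6
  linear_combination -h5

/-- Additivity is the reason for fixing the degree at `-n`: lowest terms may cancel in a sum, but `e
= 0` is allowed here. -/
theorem HasPart.add {φ φ' : DualLattice N → ℤ} {e e' : RatFunc N} (h : HasPart φ e)
    (h' : HasPart φ' e') : HasPart (φ + φ') (e + e') := by
  obtain ⟨g1, h1, b1, ha1, hg1, hh1, hn1, he1⟩ := h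
  obtain ⟨g2, h2, b2, ha2, hg2, hh2, hn2, he2⟩ := h'
  refine ⟨h2 * g1 + h1 * g2, h1 * h2, b1 + b2, ?_, ?_, ?_, ?_, ?_⟩
  · have h3 : act N (h1 * h2) φ = fun w => (h2 * g1).coeff w := by
      rw [← act_coeff, ← ha1, ← Module.End.mul_apply, ← map_mul, mul_comm]
    have h4 : act N (h1 * h2) φ' = fun w => (h1 * g2).coeff w := by
      rw [← act_coeff, ← ha2, ← Module.End.mul_apply, ← map_mul]
    rw [map_add, h3, h4]
    rfl
  · rw [map_add, map_mul, map_mul, mul_add, mul_left_comm, pow_add,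
      mul_left_comm _ (gradedExpand N h1)]
    refine dvd_add ?_ (mul_dvd_mul hh1 hg2)
    rw [mul_comm]
    exact mul_dvd_mul hh2 hg1
  · rw [map_mul, pow_add]
    exact mul_dvd_mul hh1 hh2
  · rw [map_mul, coeff_add_mul_of_X_pow_dvd hh1 hh2]
    exact mul_ne_zero hn1 hn2
  · rw [map_add (gradedExpand N), map_mul (gradedExpand N), map_mul (gradedExpand N), mul_add,
      mul_left_comm, map_mul (gradedExpand N), coeff_add_mul_of_X_pow_dvd hh1 hh2,
      map_add (PowerSeries.coeff _), mul_left_comm _ (gradedExpand N h1),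
      coeff_add_mul_of_X_pow_dvd hh1 hg2, add_comm b1, coeff_add_mul_of_X_pow_dvd hh2 hg1]
    simp only [map_add, map_mul, he1, he2]
    ring

theorem X_dvd_gradedExpand_one_sub (u : DualLattice N) :
    PowerSeries.X ∣ gradedExpand N (1 - AddMonoidAlgebra.single u 1) := by
  rw [PowerSeries.X_dvd_iff, ← PowerSeries.coeff_zero_eq_constantCoeff_apply, map_sub, map_sub,
    coeff_zero_gradedExpand_single]
  simp

theorem coeff_one_gradedExpand_one_sub (u : DualLattice N) :
    PowerSeries.coeff 1 (gradedExpand N (1 - AddMonoidAlgebra.single u 1)) =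
      -SymmetricAlgebra.ι ℤ (DualLattice N) u := by
  rw [map_sub, map_sub, coeff_one_gradedExpand_single]
  simp [PowerSeries.coeff_one]

theorem HasPart.of_invariant {φ : DualLattice N → ℤ} {u : DualLattice N} (hu : u ≠ 0)
    (h : ∀ w, φ (w - u) = φ w) : HasPart φ 0 := by
  have h1 := X_pow_dvd_prod_and_coeff (Finset.range (Module.finrank ℤ N + 1))
    (fun _ => gradedExpand N (1 - AddMonoidAlgebra.single u 1))
    (fun _ _ => X_dvd_gradedExpand_one_sub u)
  simp only [Finset.prod_const, Finset.card_range, coeff_one_gradedExpand_one_sub,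
    ← map_pow (gradedExpand N)] at h1
  -- The factor `1 - x^u` annihilates the series, so it is represented by numerator `0`; any
  -- positive power would serve as denominator.
  refine ⟨0, (1 - AddMonoidAlgebra.single u 1) ^ (Module.finrank ℤ N + 1), _, ?_, ?_, h1.1, ?_, ?_⟩
  · rw [pow_succ, map_mul, Module.End.mul_apply]
    have h2 : act N (1 - AddMonoidAlgebra.single u 1) φ = 0 := by
      ext w
      rw [map_sub, map_one]
      simp [act_single, h]
    rw [h2, map_zero]
    ext; simp
  · simp
  · rw [h1.2]
    exact pow_ne_zero _ (neg_ne_zero.2 ((map_ne_zero_iff _ ι_injective).2 hu))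
  · simp

theorem HasPart.principalPart_hilb {σ : PointedCone ℝ (RealSpace N)} {e : RatFunc N}
    (h : HasPart ((dualPoints σ).indicator 1) e) (he : e ≠ 0) : principalPart (hilb σ) = e := by
  obtain ⟨g, h, b, ha, hg, hh, hn, he'⟩ := h
  have hn' : algebraMap (Poly N) (RatFunc N) (PowerSeries.coeff b (gradedExpand N h)) ≠ 0 :=
    (map_ne_zero_iff _ (IsFractionRing.injective _ _)).2 hn
  have hne : h ≠ 0 := by
    rintro rfl
    simp at hn
  rw [hilb_eq ((isGeneratingFunction_iff _ _).2
    ⟨g, ⟨h, mem_nonZeroDivisors_of_ne_zero hne⟩, ha, rfl⟩), principalPart_mk']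
  have h1 : PowerSeries.coeff b (PowerSeries.X ^ Module.finrank ℤ N * gradedExpand N g) ≠ 0 := by
    intro h0
    rw [h0, map_zero] at he'
    exact mul_ne_zero he hn' he'.symm
  -- As `e ≠ 0`, the coefficient of degree `b - n` of the numerator is nonzero. It is thus the
  -- leading one, and the part of degree `-n` is the principal part.
  have hb : Module.finrank ℤ N ≤ b := by
    by_contra hb
    rw [PowerSeries.coeff_X_pow_mul', if_neg hb] at h1
    exact h1 rfl
  obtain ⟨a, rfl⟩ := Nat.exists_eq_add_of_le hb
  rw [add_comm (Module.finrank ℤ N) a, PowerSeries.coeff_X_pow_mul] at h1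
  rw [add_comm (Module.finrank ℤ N) a] at *
  rw [PowerSeries.coeff_X_pow_mul] at he'
  have h2 : PowerSeries.X ^ a ∣ gradedExpand N g := by
    rw [add_comm, pow_add] at hg
    exact (mul_dvd_mul_iff_left (pow_ne_zero _ PowerSeries.X_ne_zero)).1 hg
  rw [leadingForm_eq h2 h1, leadingForm_eq hh hn, he', mul_div_assoc, div_self hn', mul_one]

theorem principalPart_hilb_of_invariant {σ : PointedCone ℝ (RealSpace N)} {u : DualLattice N}
    (hu : u ≠ 0) (h : ∀ w, w - u ∈ dualPoints σ ↔ w ∈ dualPoints σ) :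
    principalPart (hilb σ) = 0 := by
  have hne : (1 - AddMonoidAlgebra.single u 1 : Laurent N) ≠ 0 := by
    intro h0
    have := coeff_one_gradedExpand_one_sub u
    rw [h0, map_zero, map_zero, eq_comm, neg_eq_zero] at this
    exact (map_ne_zero_iff _ ι_injective).2 hu this
  rw [hilb_eq ((isGeneratingFunction_iff _ _).2
    ⟨0, ⟨_, mem_nonZeroDivisors_of_ne_zero hne⟩, ?_, rfl⟩), principalPart_mk', leadingForm_zero,
    map_zero, zero_div]
  classical
  ext w
  rw [map_sub, map_one]
  simp [act_single, Set.indicator_apply, h]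

end PrincipalPart

/-! ### Rational cones: Fourier-Motzkin elimination and Farkas' lemma -/

section FourierMotzkin

variable {N : Type*} [AddCommGroup N]

theorem mem_closure_insert_iff (S : Finset N) [DecidableEq N] (s x : N) :
    x ∈ AddSubmonoid.closure (↑(insert s S) : Set N) ↔
      ∃ t : ℕ, x - t • s ∈ AddSubmonoid.closure (S : Set N) := by
  rw [Finset.coe_insert, Set.insert_eq, AddSubmonoid.closure_union, AddSubmonoid.mem_sup]
  constructor
  · rintro ⟨y, hy, z, hz, rfl⟩
    obtain ⟨t, rfl⟩ := AddSubmonoid.mem_closure_singleton.1 hy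
    exact ⟨t, by simpa using hz⟩
  · rintro ⟨t, ht⟩
    exact ⟨t • s, AddSubmonoid.mem_closure_singleton.2 ⟨t, rfl⟩, _, ht, by abel⟩

/-- Fourier-Motzkin elimination of one variable. -/
theorem exists_description_insert (A : Finset (Module.Dual ℤ N)) (s : N) :
    ∃ A' : Finset (Module.Dual ℤ N), ∀ x, (∀ u ∈ A', 0 ≤ u x) ↔
      ∃ m t : ℕ, 0 < m ∧ ∀ u ∈ A, 0 ≤ u (m • x - t • s) := by
  classical
  -- Keep the inequalities that stay valid when a multiple of `s` is added, and for each pair of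
  -- opposite signs at `s` take the positive combination that vanishes at `s`.
  refine ⟨A.filter (fun u => 0 ≤ u s) ∪ Finset.image₂ (fun u v => u s • v - v s • u)
    (A.filter fun u => 0 < u s) (A.filter fun v => v s < 0), fun x => ?_⟩
  constructor
  · intro h
    have h0 : ∀ u ∈ A, 0 ≤ u s → 0 ≤ u x := fun u hu hus =>
      h u (Finset.mem_union_left _ (Finset.mem_filter.2 ⟨hu, hus⟩))
    have h1 : ∀ u ∈ A, ∀ v ∈ A, 0 < u s → v s < 0 → 0 ≤ u s * v x - v s * u x := by
      intro u hu v hv hus hvs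
      have := h (u s • v - v s • u) (Finset.mem_union_right _ (Finset.mem_image₂.2
        ⟨u, Finset.mem_filter.2 ⟨hu, hus⟩, v, Finset.mem_filter.2 ⟨hv, hvs⟩, rfl⟩))
      simpa using this
    by_cases hpos : ∀ v ∈ A, v s < 0 → 0 ≤ v x
    · refine ⟨1, 0, one_pos, fun u hu => ?_⟩
      rcases le_or_gt 0 (u s) with hus | hus
      · simpa using h0 u hu hus
      · simpa using hpos u hu hus
    push Not at hpos
    obtain ⟨v0, hv0, hv0s, hv0x⟩ := hpos
    -- Each `v` with `v s < 0` bounds `t / m` below by `v x / v s`. The largest of these bounds is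
    -- used as `t / m`.
    obtain ⟨v, hv, hmax⟩ := Finset.exists_max_image (A.filter fun v => v s < 0)
      (fun v => (v x : ℚ) / v s) ⟨v0, Finset.mem_filter.2 ⟨hv0, hv0s⟩⟩
    rw [Finset.mem_filter] at hv
    obtain ⟨hv, hvs⟩ := hv
    have hcross : ∀ u ∈ A, u s < 0 → u x * v s ≤ v x * u s := by
      intro u hu hus
      have h2 := hmax u (Finset.mem_filter.2 ⟨hu, hus⟩)
      have hus' : (u s : ℚ) < 0 := by exact_mod_cast hus
      have hvs' : (v s : ℚ) < 0 := by exact_mod_cast hvs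
      rw [← neg_div_neg_eq (u x : ℚ), ← neg_div_neg_eq (v x : ℚ),
        div_le_div_iff₀ (by linarith) (by linarith)] at h2
      have h3 : (u x : ℚ) * v s ≤ v x * u s := by linarith
      exact_mod_cast h3
    have hvx : v x < 0 := by
      have := hcross v0 hv0 hv0s
      by_contra hvx
      nlinarith
    refine ⟨(-v s).toNat, (-v x).toNat, by omega, fun u hu => ?_⟩
    rw [map_sub, map_nsmul, map_nsmul, nsmul_eq_mul, nsmul_eq_mul, Int.toNat_of_nonneg (by omega),
      Int.toNat_of_nonneg (by omega)]
    rcases lt_trichotomy (u s) 0 with hus | hus | hus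
    · linarith [hcross u hu hus]
    · nlinarith [h0 u hu hus.ge]
    · linarith [h1 u hu v hv hus hvs]
  · rintro ⟨m, t, hm, h⟩ u hu
    have hm' : (0 : ℤ) < m := by exact_mod_cast hm
    have ht' : (0 : ℤ) ≤ t := by positivity
    simp only [map_sub, map_nsmul, nsmul_eq_mul] at h
    rcases Finset.mem_union.1 hu with hu | hu
    · obtain ⟨hu, hus⟩ := Finset.mem_filter.1 hu
      have h1 := h u hu
      refine nonneg_of_mul_nonneg_right ?_ hm'
      nlinarith
    · obtain ⟨u, hu', v, hv, rfl⟩ := Finset.mem_image₂.1 hu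
      obtain ⟨hu', hus⟩ := Finset.mem_filter.1 hu'
      obtain ⟨hv, hvs⟩ := Finset.mem_filter.1 hv
      have h1 := mul_nonneg hus.le (h v hv)
      have h2 := mul_nonneg (neg_nonneg.2 hvs.le) (h u hu')
      have h3 : 0 ≤ (m : ℤ) * (u s * v x - v s * u x) := by nlinarith
      simpa using nonneg_of_mul_nonneg_right h3 hm'

variable [Module.Free ℤ N] [Module.Finite ℤ N]

/-- A finitely generated rational cone is the intersection of finitely many rational
half-spaces. -/
theorem exists_dual_description (S : Finset N) :
    ∃ A : Finset (Module.Dual ℤ N), ∀ x, (∀ u ∈ A, 0 ≤ u x) ↔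
      ∃ m : ℕ, 0 < m ∧ m • x ∈ AddSubmonoid.closure (S : Set N) := by
  classical
  induction S using Finset.induction_on with
  | empty =>
    let b := Module.Free.chooseBasis ℤ N
    -- The coordinates and their negatives cut out the origin.
    refine ⟨Finset.univ.image b.coord ∪ Finset.univ.image (-b.coord), fun x => ?_⟩
    simp only [Finset.coe_empty, AddSubmonoid.closure_empty, AddSubmonoid.mem_bot]
    constructor
    · intro h
      refine ⟨1, one_pos, ?_⟩
      rw [one_smul, ← b.forall_coord_eq_zero_iff]
      intro i
      have h1 := h (b.coord i) (by simp)
      have h2 := h (-b.coord i) (Finset.mem_union_right _ (Finset.mem_image.2 ⟨i, by simp, rfl⟩))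
      simp only [LinearMap.neg_apply] at h2
      omega
    · rintro ⟨m, hm, hx⟩
      have hx0 : x = 0 := by
        have := (smul_eq_zero (R := ℤ) (r := (m : ℤ)) (m := x)).1 (by simpa using hx)
        rcases this with h | h
        · omega
        · exact h
      simp [hx0]
  | insert s S hs ih =>
    obtain ⟨A, hA⟩ := ih
    obtain ⟨A', hA'⟩ := exists_description_insert A s
    refine ⟨A', fun x => (hA' x).trans ?_⟩
    constructor
    · rintro ⟨m, t, hm, h⟩
      obtain ⟨m', hm', h'⟩ := (hA _).1 h
      refine ⟨m' * m, by positivity, (mem_closure_insert_iff _ _ _).2 ⟨m' * t, ?_⟩⟩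
      rwa [smul_sub, smul_smul, smul_smul] at h'
    · rintro ⟨m, hm, h⟩
      obtain ⟨t, ht⟩ := (mem_closure_insert_iff _ _ _).1 h
      exact ⟨m, t, hm, (hA _).2 ⟨1, one_pos, by simpa using ht⟩⟩

/-- Farkas' lemma over the integers. -/
theorem exists_nsmul_mem_closure (L : Finset (Module.Dual ℤ N)) (m : Module.Dual ℤ N) :
    (∃ k : ℕ, 0 < k ∧ k • m ∈ AddSubmonoid.closure (L : Set (Module.Dual ℤ N))) ↔
      ∀ y, (∀ u ∈ L, 0 ≤ u y) → 0 ≤ m y := by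
  constructor
  · rintro ⟨k, hk, h⟩ y hy
    have h1 : 0 ≤ (k • m) y := by
      generalize k • m = w at h ⊢
      induction h using AddSubmonoid.closure_induction with
      | mem u hu => exact hy u hu
      | zero => simp
      | add u v _ _ hu hv => simpa using add_nonneg hu hv
    rw [LinearMap.smul_apply, nsmul_eq_mul] at h1
    exact nonneg_of_mul_nonneg_right h1 (by exact_mod_cast hk)
  · intro h
    -- The inequalities describing the cone generated by `L` live on the dual lattice; by
    -- reflexivity they are evaluations at lattice points.
    obtain ⟨A, hA⟩ := exists_dual_description L
    refine (hA m).1 fun a ha => ?_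
    obtain ⟨y, rfl⟩ := (Module.evalEquiv ℤ N).surjective a
    refine h y fun u hu => ?_
    exact (hA u).2 ⟨1, one_pos, by simpa using AddSubmonoid.subset_closure hu⟩ _ ha

end FourierMotzkin

/-! ### Gordan's lemma and Stanley decompositions -/

section Stanley

variable {M ι : Type*} [AddCommGroup M]

/-- The translate by `w` of the monoid generated by the `u i`, `i ∈ B`. -/
def orthant (u : ι → M) (w : M) (B : Finset ι) : Set M :=
  {m | ∃ a : ι → ℕ, m = w + ∑ i ∈ B, a i • u i}

/-- The lattice points of the rational cone spanned by the `u i` form a finitely generated module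
over the monoid generated by the `u i`. -/
theorem exists_finite_generators [Module.Free ℤ M] [Module.Finite ℤ M] [Fintype ι] (u : ι → M) :
    ∃ G : Finset M, ∀ m, (∃ k : ℕ, 0 < k ∧ ∃ c : ι → ℕ, k • m = ∑ i, c i • u i) ↔
      ∃ g ∈ G, m ∈ orthant u g Finset.univ := by
  let b := Module.Free.chooseBasis ℤ M
  -- These are the lattice points of the half-open parallelepiped on the `u i`. Their coordinates
  -- are bounded, and division with remainder by `k` moves any point of the cone into `P`.
  let P : Set M := {g | ∃ k : ℕ, 0 < k ∧ ∃ r : ι → ℕ, (∀ i, r i < k) ∧ k • g = ∑ i, r i • u i}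
  have hP : P.Finite := by
    have h1 : (Set.univ.pi fun j => Set.Icc (-∑ i, |b.repr (u i) j|) (∑ i, |b.repr (u i) j|)).Finite :=
      Set.Finite.pi fun j => Set.finite_Icc _ _
    refine (h1.preimage (f := b.equivFun) b.equivFun.injective.injOn).subset ?_
    rintro g ⟨k, hk, r, hr, hg⟩ j -
    have hk' : (0 : ℤ) < k := by exact_mod_cast hk
    have h2 : (k : ℤ) * b.repr g j = ∑ i, r i * b.repr (u i) j := by
      have := congrArg (fun x => b.repr x j) hg
      simpa [Finsupp.finsetSum_apply] using this
    rw [Module.Basis.equivFun_apply, Set.mem_Icc, ← abs_le]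
    refine le_of_mul_le_mul_left ?_ hk'
    rw [← abs_of_pos hk', ← abs_mul, h2, abs_of_pos hk', Finset.mul_sum]
    refine (Finset.abs_sum_le_sum_abs _ _).trans (Finset.sum_le_sum fun i _ => ?_)
    rw [abs_mul, Nat.abs_cast]
    exact mul_le_mul_of_nonneg_right (by exact_mod_cast (hr i).le) (abs_nonneg _)
  refine ⟨hP.toFinset, fun m => ⟨?_, ?_⟩⟩
  · rintro ⟨k, hk, c, hc⟩
    refine ⟨m - ∑ i, (c i / k) • u i, hP.mem_toFinset.2 ⟨k, hk, fun i => c i % k,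
      fun i => Nat.mod_lt _ hk, ?_⟩, fun i => c i / k, by abel⟩
    rw [smul_sub, hc, Finset.smul_sum, ← Finset.sum_sub_distrib]
    refine Finset.sum_congr rfl fun i _ => ?_
    rw [smul_smul, sub_eq_iff_eq_add, ← add_smul, Nat.mod_add_div]
  · rintro ⟨g, hg, a, rfl⟩
    obtain ⟨k, hk, r, -, hr⟩ := hP.mem_toFinset.1 hg
    refine ⟨k, hk, fun i => r i + k * a i, ?_⟩
    rw [smul_add, hr, Finset.smul_sum, ← Finset.sum_add_distrib]
    exact Finset.sum_congr rfl fun i _ => by rw [add_smul, mul_smul]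

/-- A set of exponents that is closed downwards is determined by its exponents below some bound. -/
theorem exists_bound_of_lowerSet [Finite ι] {D : Set (ι → ℕ)} (hD : IsLowerSet D) :
    ∃ n : ℕ, ∀ a, a ∈ D ↔ (fun i => min (a i) n) ∈ D := by
  have := Fintype.ofFinite ι
  -- Dickson's lemma: there are finitely many minimal excluded exponents. Beyond their largest
  -- coordinate, truncation does not affect membership.
  have hfin : {x | Minimal (· ∉ D) x}.Finite :=
    WellQuasiOrderedLE.finite_of_isAntichain (setOfPred_minimal_antichain _)
  refine ⟨hfin.toFinset.sup fun x => Finset.univ.sup x, fun a => ⟨fun h => ?_, fun h => ?_⟩⟩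
  · exact hD (fun i => min_le_left _ _) h
  · by_contra ha
    obtain ⟨c, hc, hmin⟩ := exists_minimal_le_of_wellFoundedLT (· ∉ D) a ha
    refine hmin.prop (hD (fun i => le_min (hc i) ?_) h)
    exact (Finset.le_sup (f := c) (Finset.mem_univ i)).trans
      (Finset.le_sup (f := fun x : ι → ℕ => Finset.univ.sup x) (hfin.mem_toFinset.2 hmin))

/-- A finitely generated module over the monoid generated by the `u i` is a finite disjoint union
of translates of monoids freely generated by some of the `u i`. -/
theorem exists_stanley_decomposition [Fintype ι] (u : ι → M) (G : Finset M) :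
    ∃ (J : Type) (_ : Fintype J) (w : J → M) (B : J → Finset ι),
      (∀ j, LinearIndepOn ℤ u (B j : Set ι)) ∧
      ∀ m : M, ((∃ g ∈ G, m ∈ orthant u g Finset.univ) → ∃! j, m ∈ orthant u (w j) (B j)) ∧
        ∀ j, m ∈ orthant u (w j) (B j) → ∃ g ∈ G, m ∈ orthant u g Finset.univ := by
  classical
  let _ : LinearOrder ι := LinearOrder.lift' (Fintype.equivFin ι) (Fintype.equivFin ι).injective
  let G' : Fin G.card → M := fun i => G.equivFin.symm i
  let val : Fin G.card × (ι → ℕ) → M := fun x => G' x.1 + ∑ i, x.2 i • u i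
  let key : Fin G.card × (ι → ℕ) → Fin G.card ×ₗ Lex (ι → ℕ) := fun x => toLex (x.1, toLex x.2)
  have hkey : Function.Injective key := fun x y h => by
    have h1 := toLex.injective h
    exact Prod.ext (congrArg Prod.fst h1) (toLex.injective (congrArg Prod.snd h1))
  -- As with standard monomials, each element of the module keeps only its lexicographically
  -- smallest presentation.
  let D : Set (Fin G.card × (ι → ℕ)) := {x | ∀ y, val y = val x → key x ≤ key y}
  have hDuniq : ∀ x ∈ D, ∀ y ∈ D, val x = val y → x = y := fun x hx y hy h =>
    hkey (le_antisymm (hx y h.symm) (hy x h))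
  have hDex : ∀ x, ∃ y ∈ D, val y = val x := by
    intro x
    obtain ⟨k, -, ⟨y, rfl, hy⟩, hmin⟩ := exists_minimal_le_of_wellFoundedLT
      (fun k => ∃ y, key y = k ∧ val y = val x) (key x) ⟨x, rfl, rfl⟩
    refine ⟨y, fun z hz => ?_, hy⟩
    by_contra hlt
    exact hlt (hmin ⟨z, rfl, hz.trans hy⟩ (not_le.1 hlt).le)
  -- The order is compatible with adding exponents: a smaller presentation for a smaller exponent
  -- would yield one for the larger exponent.
  have hDlow : ∀ g, IsLowerSet {a | (g, a) ∈ D} := by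
    intro g a b hba ha y hy
    have hadd : ∀ (g : Fin G.card) (a b : ι → ℕ),
        val (g, a + b) = val (g, a) + ∑ i, b i • u i := by
      intro g a b
      simp [val, add_smul, Finset.sum_add_distrib, add_assoc]
    have hab : b + (a - b) = a := by
      ext i
      have : b i ≤ a i := hba i
      simp only [Pi.add_apply, Pi.sub_apply]
      omega
    have h1 := ha (y.1, y.2 + (a - b)) (by
      rw [hadd, show val (y.1, y.2) = val (g, b) from hy, ← hadd, hab])
    rw [Prod.Lex.toLex_le_toLex] at h1 ⊢
    refine h1.imp id (And.imp id fun h => ?_)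
    have h2 : toLex b + toLex (a - b) ≤ toLex y.2 + toLex (a - b) := by
      rw [← toLex_add, ← toLex_add, hab]
      exact h
    exact le_of_add_le_add_right h2
  choose n hn using fun g => exists_bound_of_lowerSet (hDlow g)
  simp only [Set.mem_ofPred_eq] at hn
  -- A piece is a truncated exponent in `D`; its free directions `B` are those where the exponent
  -- has reached the truncation bound.
  let J : Type := {j : Σ g : Fin G.card, (Fin (Fintype.card ι) → Fin (n g + 1)) //
    (j.1, fun i => (j.2 (Fintype.equivFin ι i) : ℕ)) ∈ D}
  let c : J → ι → ℕ := fun j i => j.1.2 (Fintype.equivFin ι i)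
  have hc : ∀ j i, c j i ≤ n j.1.1 := fun j i => Nat.lt_succ_iff.1 (j.1.2 _).2
  let B : J → Finset ι := fun j => Finset.univ.filter fun i => c j i = n j.1.1
  have hsum : ∀ (j : J) (a : ι → ℕ), val (j.1.1, c j) + ∑ i ∈ B j, a i • u i =
      val (j.1.1, fun i => c j i + if i ∈ B j then a i else 0) := by
    intro j a
    simp [val, add_smul, Finset.sum_add_distrib, add_assoc, ite_smul, Finset.sum_ite_mem]
  have hmin : ∀ (j : J) (a : ι → ℕ),
      (fun i => min (c j i + if i ∈ B j then a i else 0) (n j.1.1)) = c j := by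
    intro j a
    ext i
    have h1 := hc j i
    by_cases hi : c j i = n j.1.1
    · simp [hi]
    · simp [B, hi, h1]
  have hmem : ∀ (j : J) (a : ι → ℕ), (j.1.1, fun i => c j i + if i ∈ B j then a i else 0) ∈ D := by
    intro j a
    rw [hn, hmin]
    exact j.2
  refine ⟨J, inferInstance, fun j => val (j.1.1, c j), B, fun j => ?_, fun m => ⟨?_, ?_⟩⟩
  · rw [linearIndepOn_finset_iff]
    intro f hf i hi
    -- Splitting a relation into its positive and negative parts gives two exponents in `D` with the
    -- same value, so they are equal.
    have h1 := hDuniq _ (hmem j fun i => (f i).toNat) _ (hmem j fun i => (-f i).toNat) (by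
      rw [← hsum, ← hsum, add_right_inj, ← sub_eq_zero, ← Finset.sum_sub_distrib, ← hf]
      refine Finset.sum_congr rfl fun i _ => ?_
      rw [← natCast_zsmul, ← natCast_zsmul, ← sub_smul, Int.toNat_sub_toNat_neg])
    have h2 := congrFun (congrArg Prod.snd h1) i
    simp only [hi, if_true] at h2
    omega
  · rintro ⟨g, hg, a, rfl⟩
    obtain ⟨⟨g', a'⟩, hD, hval⟩ := hDex (G.equivFin ⟨g, hg⟩, a)
    have hval' : g + ∑ i, a i • u i = val (g', a') := by
      rw [hval]
      simp [val, G']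
    rw [hval']
    have hcD := (hn g' a').1 hD
    let j : J := ⟨⟨g', fun i => ⟨min (a' ((Fintype.equivFin ι).symm i)) (n g'), by omega⟩⟩, by
      simpa using hcD⟩
    have hcj : c j = fun i => min (a' i) (n g') := by
      ext i
      simp [c, j]
    have hj1 : j.1.1 = g' := rfl
    refine ⟨j, ⟨fun i => a' i - n g', ?_⟩, ?_⟩
    · rw [hsum]
      congr 1
      refine Prod.ext rfl (funext fun i => ?_)
      simp only [B, Finset.mem_filter, Finset.mem_univ, true_and, hcj, hj1]
      split_ifs with h <;> omega
    · rintro j' ⟨a'', h⟩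
      beta_reduce at h
      rw [hsum] at h
      have h1 := hDuniq _ hD _ (hmem j' a'') h
      have h2 := hmin j' a''
      obtain ⟨⟨g2, f2⟩, hj'⟩ := j'
      obtain rfl : g' = g2 := congrArg Prod.fst h1
      have h3 : a' = _ := congrArg Prod.snd h1
      apply Subtype.ext
      refine Sigma.ext rfl (heq_of_eq (funext fun i => Fin.ext ?_))
      have h4 := congrFun h2 ((Fintype.equivFin ι).symm i)
      have h5 := congrFun h3 ((Fintype.equivFin ι).symm i)
      simp only [c, Equiv.apply_symm_apply] at h4 h5
      simp only [j]
      rw [← h4, h5]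
  · rintro j ⟨a, rfl⟩
    refine ⟨G' j.1.1, (G.equivFin.symm j.1.1).2, fun i => c j i + if i ∈ B j then a i else 0, ?_⟩
    beta_reduce
    rw [hsum]

end Stanley

/-! ### Generating functions of free orthants -/

section Orthant

variable {N ι : Type*} [AddCommGroup N]

/-- The series telescopes in the direction `u i`. Independence ensures that the translated orthant
misses the face being left over. -/
theorem act_one_sub_orthant_insert [DecidableEq ι] {u : ι → DualLattice N} (w : DualLattice N)
    {i : ι} {B : Finset ι} (hi : i ∉ B) (hB : LinearIndepOn ℤ u (insert i B : Finset ι)) :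
    act N (1 - AddMonoidAlgebra.single (u i) 1) ((orthant u w (insert i B)).indicator 1) =
      (orthant u w B).indicator 1 := by
  classical
  rw [linearIndepOn_finset_iff] at hB
  ext m
  have hs : ∀ (a : ι → ℕ) (b : ℕ), ∑ j ∈ insert i B, (if j = i then b else a j) • u j =
      b • u i + ∑ j ∈ B, a j • u j := by
    intro a b
    rw [Finset.sum_insert hi, if_pos rfl,
      Finset.sum_congr rfl fun j hj => by rw [if_neg (by rintro rfl; exact hi hj)]]
  have h1 : m ∈ orthant u w B → m ∈ orthant u w (insert i B) := by
    rintro ⟨a, rfl⟩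
    exact ⟨fun j => if j = i then 0 else a j, by rw [hs, zero_smul, zero_add]⟩
  have h2 : m - u i ∈ orthant u w (insert i B) → m ∈ orthant u w (insert i B) := by
    rintro ⟨a, ha⟩
    refine ⟨fun j => if j = i then a i + 1 else a j, ?_⟩
    rw [sub_eq_iff_eq_add.1 ha, hs, Finset.sum_insert hi, add_smul, one_smul]
    abel
  have h3 : m ∈ orthant u w (insert i B) → m ∉ orthant u w B →
      m - u i ∈ orthant u w (insert i B) := by
    rintro ⟨a, rfl⟩ h
    have hai : a i ≠ 0 := by
      intro h0
      exact h ⟨a, by rw [Finset.sum_insert hi, h0, zero_smul, zero_add]⟩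
    refine ⟨fun j => if j = i then a i - 1 else a j, ?_⟩
    rw [hs, Finset.sum_insert hi]
    obtain ⟨k, hk⟩ := Nat.exists_eq_succ_of_ne_zero hai
    rw [hk, Nat.succ_sub_one, Nat.succ_eq_add_one, add_smul, one_smul]
    abel
  have h4 : m ∈ orthant u w B → m - u i ∉ orthant u w (insert i B) := by
    rintro ⟨a, rfl⟩ ⟨a', h'⟩
    have h5 := hB (fun j => if j = i then (a' j : ℤ) + 1 else (a' j : ℤ) - a j) (by
      rw [Finset.sum_insert hi, if_pos rfl,
        Finset.sum_congr rfl fun j hj => by rw [if_neg (by rintro rfl; exact hi hj)]]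
      rw [Finset.sum_insert hi] at h'
      simp only [sub_smul, add_smul, one_smul, natCast_zsmul, Finset.sum_sub_distrib]
      rw [sub_eq_iff_eq_add, add_assoc, add_right_inj] at h'
      rw [h']
      abel) i (Finset.mem_insert_self _ _)
    simp only [if_true] at h5
    omega
  rw [map_sub, map_one, LinearMap.sub_apply, Module.End.one_apply, Pi.sub_apply, act_single]
  simp only [Set.indicator_apply, Pi.one_apply]
  by_cases hm : m ∈ orthant u w B
  · simp [hm, h1 hm, h4 hm]
  · by_cases hm' : m ∈ orthant u w (insert i B)
    · simp [hm, hm', h3 hm' hm]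
    · simp [hm, hm', mt h2 hm']

theorem act_prod_orthant {u : ι → DualLattice N} (w : DualLattice N) {B : Finset ι}
    (hB : LinearIndepOn ℤ u (B : Set ι)) :
    act N (∏ i ∈ B, (1 - AddMonoidAlgebra.single (u i) 1)) ((orthant u w B).indicator 1) =
      fun m => (AddMonoidAlgebra.single w 1 : Laurent N).coeff m := by
  classical
  induction B using Finset.induction_on with
  | empty =>
    ext m
    by_cases h : m = w
    · simp [orthant, h]
    · simp [orthant, h]
  | insert i B hi ih =>
    rw [Finset.prod_insert hi, mul_comm, map_mul, Module.End.mul_apply,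
      act_one_sub_orthant_insert w hi hB, ih (hB.mono (by simp))]

theorem act_prod_eq_of_decomposition [Fintype ι] [DecidableEq ι] {u : ι → DualLattice N}
    {J : Type*} [Fintype J] {Q : Set (DualLattice N)} {w : J → DualLattice N} {B : J → Finset ι}
    (hB : ∀ j, LinearIndepOn ℤ u (B j : Set ι))
    (hQ : ∀ m, (m ∈ Q → ∃! j, m ∈ orthant u (w j) (B j)) ∧
      ∀ j, m ∈ orthant u (w j) (B j) → m ∈ Q) :
    act N (∏ i, (1 - AddMonoidAlgebra.single (u i) 1)) (Q.indicator 1) =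
      fun m => (∑ j, (∏ i ∈ (B j)ᶜ, (1 - AddMonoidAlgebra.single (u i) 1)) *
        AddMonoidAlgebra.single (w j) 1 : Laurent N).coeff m := by
  classical
  have h1 : (Q.indicator 1 : DualLattice N → ℤ) =
      ∑ j, (orthant u (w j) (B j)).indicator 1 := by
    ext m
    rw [Finset.sum_apply]
    by_cases hm : m ∈ Q
    · obtain ⟨j, hj, huniq⟩ := (hQ m).1 hm
      rw [Finset.sum_eq_single j, Set.indicator_of_mem hm, Set.indicator_of_mem hj]
      · intro j' _ hj'
        rw [Set.indicator_of_notMem fun h => hj' (huniq j' h)]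
      · simp
    · rw [Set.indicator_of_notMem hm, Finset.sum_eq_zero]
      intro j _
      rw [Set.indicator_of_notMem fun h => hm ((hQ m).2 j h)]
  rw [h1, map_sum]
  have h2 : ∀ j, act N (∏ i, (1 - AddMonoidAlgebra.single (u i) 1))
      ((orthant u (w j) (B j)).indicator 1) = fun m =>
      ((∏ i ∈ (B j)ᶜ, (1 - AddMonoidAlgebra.single (u i) 1)) *
        AddMonoidAlgebra.single (w j) 1 : Laurent N).coeff m := by
    intro j
    -- The factors in `B j` reduce the orthant to its vertex; the others remain in the numerator.
    rw [← Finset.prod_compl_mul_prod (B j), map_mul, Module.End.mul_apply,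
      act_prod_orthant _ (hB j), act_coeff]
  ext m
  simp only [h2, Finset.sum_apply, AddMonoidAlgebra.coeff_sum, Finsupp.finsetSum_apply]

end Orthant

/-! ### Existence of a piece of full rank -/

section Decomposition

variable {N ι : Type*} [AddCommGroup N] [Module.Free ℤ N] [Module.Finite ℤ N]

theorem finrank_dualLattice : Module.finrank ℤ (DualLattice N) = Module.finrank ℤ N :=
  (Module.Free.chooseBasis ℤ N).toDualEquiv.finrank_eq.symm

theorem card_le_of_linearIndepOn {u : ι → DualLattice N} {B : Finset ι}
    (hB : LinearIndepOn ℤ u (B : Set ι)) : B.card ≤ Module.finrank ℤ N := by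
  rw [← finrank_dualLattice]
  simpa using LinearIndependent.fintype_card_le_finrank hB

omit [Module.Free ℤ N] [Module.Finite ℤ N] in
theorem exists_ne_zero_of_card_lt (u : ι → DualLattice N) (B : Finset ι)
    (hB : B.card < Module.finrank ℤ N) : ∃ y : N, y ≠ 0 ∧ ∀ i ∈ B, u i y = 0 := by
  by_contra! h
  have hinj : Function.Injective (LinearMap.pi fun i : B => u i) := by
    rw [injective_iff_map_eq_zero]
    intro y hy
    by_contra hy0
    obtain ⟨i, hi, hne⟩ := h y hy0
    exact hne (congrFun hy ⟨i, hi⟩)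
  have := LinearMap.finrank_le_finrank_of_injective hinj
  simp at this
  omega

/-- The points `∑ t ^ (i + 1) • u i` run along a curve, and infinitely many lie in one piece. If
that piece had deficient rank, some `y ≠ 0` would kill its directions and be constant at those
points; comparing coefficients in `t` would give `u i y = 0` for all `i`. -/
theorem exists_card_eq_of_decomposition [Fintype ι] {u : ι → DualLattice N}
    (hu : ∀ y, (∀ i, u i y = 0) → y = 0)
    {J : Type*} [Finite J] {w : J → DualLattice N} {B : J → Finset ι}
    (hB : ∀ j, LinearIndepOn ℤ u (B j : Set ι))
    (hQ : ∀ a : ι → ℕ, ∃ j, ∑ i, a i • u i ∈ orthant u (w j) (B j)) :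
    ∃ j, (B j).card = Module.finrank ℤ N := by
  by_contra! hne
  have hlt : ∀ j, (B j).card < Module.finrank ℤ N := fun j =>
    lt_of_le_of_ne (card_le_of_linearIndepOn (hB j)) (hne j)
  let σ := Fintype.equivFin ι
  choose f hf using fun t : ℕ => hQ fun i => t ^ ((σ i : ℕ) + 1)
  obtain ⟨j, hj⟩ := Finite.exists_infinite_fiber f
  obtain ⟨y, hy0, hy⟩ := exists_ne_zero_of_card_lt u (B j) (hlt j)
  let p : Polynomial ℤ := ∑ i, Polynomial.C (u i y) * Polynomial.X ^ ((σ i : ℕ) + 1) -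
    Polynomial.C (w j y)
  have hp : p = 0 := by
    refine Polynomial.eq_zero_of_infinite_isRoot p ?_
    refine ((Set.infinite_coe_iff.1 hj).image (Nat.cast_injective (R := ℤ)).injOn).mono ?_
    rintro _ ⟨t, ht, rfl⟩
    obtain ⟨a, ha⟩ := hf t
    rw [show f t = j from ht] at ha
    have h1 := congrArg (fun m : DualLattice N => m y) ha
    simp only [LinearMap.add_apply, LinearMap.sum_apply, LinearMap.smul_apply] at h1
    rw [Finset.sum_eq_zero (s := B j) fun i hi => by rw [hy i hi, smul_zero], add_zero] at h1
    change Polynomial.eval _ p = 0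
    simp only [p, Polynomial.eval_sub, Polynomial.eval_finsetSum, Polynomial.eval_mul,
      Polynomial.eval_C, Polynomial.eval_pow, Polynomial.eval_X, ← h1]
    rw [sub_eq_zero]
    exact Finset.sum_congr rfl fun i _ => by simp [mul_comm]
  refine hy0 (hu y fun i => ?_)
  have h2 := congrArg (fun q => Polynomial.coeff q ((σ i : ℕ) + 1)) hp
  simp only [p, Polynomial.coeff_sub, Polynomial.finsetSum_coeff, Polynomial.coeff_C_mul_X_pow,
    Polynomial.coeff_C_succ, Polynomial.coeff_zero, sub_zero, add_left_inj] at h2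
  rw [Finset.sum_eq_single i] at h2
  · simpa using h2
  · intro i' _ hi'
    rw [if_neg]
    intro h
    exact hi' (σ.injective (Fin.ext h)).symm
  · simp

end Decomposition

/-! ### The part of a cone: poles, nonvanishing, additivity -/

section Part

variable {N : Type*} [AddCommGroup N]

/-- The lattice points `m` that are nonnegative on the cone defined by the inequalities `0 ≤ u`,
`u ∈ L`. -/
def dualSet (L : Finset (DualLattice N)) : Set (DualLattice N) :=
  {m | ∀ y : N, (∀ u ∈ L, 0 ≤ u y) → 0 ≤ m y}

variable [Module.Free ℤ N] [Module.Finite ℤ N]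

/-- By Farkas, a point of the dual set has a positive multiple in the monoid generated by `L`, so
the decomposition can be taken with directions in `L`. -/
theorem exists_dualSet_decomposition (L : Finset (DualLattice N)) :
    ∃ (J : Type) (_ : Fintype J) (w : J → DualLattice N) (B : J → Finset L),
      (∀ j, LinearIndepOn ℤ (fun u : L => (u : DualLattice N)) (B j : Set L)) ∧
      ∀ m, (m ∈ dualSet L → ∃! j, m ∈ orthant (fun u : L => (u : DualLattice N)) (w j) (B j)) ∧
        ∀ j, m ∈ orthant (fun u : L => (u : DualLattice N)) (w j) (B j) → m ∈ dualSet L := by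
  obtain ⟨G, hG⟩ := exists_finite_generators (fun u : L => (u : DualLattice N))
  obtain ⟨J, hJ, w, B, hB, h⟩ := exists_stanley_decomposition (fun u : L => (u : DualLattice N)) G
  have hmem : ∀ m, m ∈ dualSet L ↔ ∃ g ∈ G, m ∈ orthant (fun u : L => (u : DualLattice N)) g
      Finset.univ := by
    intro m
    rw [← hG, dualSet, Set.mem_ofPred_eq, ← exists_nsmul_mem_closure]
    refine exists_congr fun k => and_congr_right fun _ => ?_
    rw [AddSubmonoid.mem_closure_finset]
    constructor
    · rintro ⟨f, -, hf⟩
      exact ⟨fun u => f u, by rw [← hf, ← Finset.sum_coe_sort]⟩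
    · rintro ⟨c, hc⟩
      classical
      refine ⟨fun u => if h : u ∈ L then c ⟨u, h⟩ else 0, ?_, ?_⟩
      · intro u hu
        by_contra h
        have h' : u ∉ L := h
        simp [h'] at hu
      · rw [hc, ← Finset.sum_coe_sort]
        simp
  simp only [← hmem] at h
  exact ⟨J, hJ, w, B, hB, h⟩

omit [Module.Free ℤ N] in
theorem gradedExpand_prod_one_sub {ι : Type*} (u : ι → DualLattice N) (B : Finset ι) :
    PowerSeries.X ^ B.card ∣ gradedExpand N (∏ i ∈ B, (1 - AddMonoidAlgebra.single (u i) 1)) ∧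
      PowerSeries.coeff B.card (gradedExpand N (∏ i ∈ B, (1 - AddMonoidAlgebra.single (u i) 1))) =
        ∏ i ∈ B, -SymmetricAlgebra.ι ℤ (DualLattice N) (u i) := by
  have h := X_pow_dvd_prod_and_coeff B
    (fun i => gradedExpand N (1 - AddMonoidAlgebra.single (u i) 1))
    (fun i _ => X_dvd_gradedExpand_one_sub (u i))
  simpa only [← map_prod, coeff_one_gradedExpand_one_sub] using h

/-- The common denominator of the pieces is `∏ (1 - x^u)` over `L`, with leading form `∏ (-u)`; the
numerator terms have order at least `|L| - n`. The last clause needs a piece of full rank, and an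
interior point at which no cancellation can occur. -/
theorem exists_hasPart (L : Finset (DualLattice N)) (hL : 0 ∉ L) :
    ∃ (e : RatFunc N) (p : Poly N), HasPart ((dualSet L).indicator 1) e ∧
      p ∈ homogeneous N (L.card - Module.finrank ℤ N) ∧
      e * algebraMap (Poly N) (RatFunc N) (∏ u ∈ L, SymmetricAlgebra.ι ℤ (DualLattice N) u) =
        algebraMap (Poly N) (RatFunc N) p ∧
      ((∀ y : N, (∀ u ∈ L, u y = 0) → y = 0) → (∃ y : N, ∀ u ∈ L, 0 < u y) → e ≠ 0) := by
  classical
  obtain ⟨J, _, w, B, hB, hQ⟩ := exists_dualSet_decomposition L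
  have hact := act_prod_eq_of_decomposition hB hQ
  set h : Laurent N := ∏ i : L, (1 - AddMonoidAlgebra.single (i : DualLattice N) 1) with hh
  set g : Laurent N := ∑ j, (∏ i ∈ (B j)ᶜ, (1 - AddMonoidAlgebra.single (i : DualLattice N) 1)) *
    AddMonoidAlgebra.single (w j) 1 with hg
  have hdh := gradedExpand_prod_one_sub (fun i : L => (i : DualLattice N)) Finset.univ
  rw [← hh, Finset.card_univ, Fintype.card_coe] at hdh
  obtain ⟨hdh, hch⟩ := hdh
  have hle : ∀ j, (B j).card ≤ Module.finrank ℤ N := fun j => card_le_of_linearIndepOn (hB j)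
  have hcard : ∀ j, (B j)ᶜ.card = L.card - (B j).card := fun j => by
    rw [Finset.card_compl, Fintype.card_coe]
  have hBL : ∀ j, (B j).card ≤ L.card := fun j => by
    simpa using Finset.card_le_univ (B j)
  have hterm := fun j => gradedExpand_prod_one_sub (fun i : L => (i : DualLattice N)) (B j)ᶜ
  have hdj : ∀ j, PowerSeries.X ^ (L.card - (B j).card) ∣ gradedExpand N
      ((∏ i ∈ (B j)ᶜ, (1 - AddMonoidAlgebra.single (i : DualLattice N) 1)) *
        AddMonoidAlgebra.single (w j) 1) := fun j => by
    rw [map_mul, ← hcard]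
    exact Dvd.dvd.mul_right (hterm j).1 _
  have hdj' : ∀ j, PowerSeries.X ^ (Module.finrank ℤ N + (L.card - (B j).card)) ∣
      PowerSeries.X ^ Module.finrank ℤ N * gradedExpand N
      ((∏ i ∈ (B j)ᶜ, (1 - AddMonoidAlgebra.single (i : DualLattice N) 1)) *
        AddMonoidAlgebra.single (w j) 1) := fun j => by
    rw [pow_add]
    exact mul_dvd_mul_left _ (hdj j)
  -- Pieces of rank below `n` have poles of smaller order and do not reach this degree.
  have hcoeff : ∀ j, PowerSeries.coeff L.card (PowerSeries.X ^ Module.finrank ℤ N * gradedExpand N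
      ((∏ i ∈ (B j)ᶜ, (1 - AddMonoidAlgebra.single (i : DualLattice N) 1)) *
        AddMonoidAlgebra.single (w j) 1)) =
      if (B j).card = Module.finrank ℤ N then
        ∏ i ∈ (B j)ᶜ, -SymmetricAlgebra.ι ℤ (DualLattice N) i else 0 := by
    intro j
    split_ifs with hj
    · rw [show L.card = (L.card - (B j).card) + Module.finrank ℤ N by have := hBL j; omega,
        PowerSeries.coeff_X_pow_mul, map_mul, ← hcard]
      have := coeff_add_mul_of_X_pow_dvd (b := 0) (hterm j).1
        (by simp : PowerSeries.X ^ 0 ∣ gradedExpand N (AddMonoidAlgebra.single (w j) 1))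
      rw [add_zero, coeff_zero_gradedExpand_single, mul_one] at this
      rw [this, (hterm j).2]
    · refine PowerSeries.X_pow_dvd_iff.1 (hdj' j) _ ?_
      have := hle j
      have := hBL j
      omega
  have hchne : PowerSeries.coeff L.card (gradedExpand N h) ≠ 0 := by
    rw [hch]
    refine Finset.prod_ne_zero_iff.2 fun i _ => neg_ne_zero.2 ?_
    rw [map_ne_zero_iff _ ι_injective]
    intro h0
    exact hL (h0 ▸ i.2)
  have hchne' : algebraMap (Poly N) (RatFunc N) (PowerSeries.coeff L.card (gradedExpand N h)) ≠ 0 :=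
    (map_ne_zero_iff _ (IsFractionRing.injective _ _)).2 hchne
  set c := PowerSeries.coeff L.card (PowerSeries.X ^ Module.finrank ℤ N * gradedExpand N g) with hc
  have hcmem : c ∈ homogeneous N (L.card - Module.finrank ℤ N) := by
    rw [hc, PowerSeries.coeff_X_pow_mul']
    split_ifs with hn
    · rw [← Nat.cast_sub hn]
      exact coeff_gradedSeries_mem _ _
    · exact zero_mem _
  refine ⟨algebraMap _ _ c / algebraMap _ _ (PowerSeries.coeff L.card (gradedExpand N h)),
    (-1) ^ L.card * c, ⟨g, h, L.card, hact, ?_, hdh, hchne, (div_mul_cancel₀ _ hchne').symm⟩, ?_, ?_, ?_⟩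
  · rw [hg, map_sum, Finset.mul_sum]
    refine Finset.dvd_sum fun j _ => (pow_dvd_pow _ ?_).trans (hdj' j)
    have := hle j
    omega
  · rcases neg_one_pow_eq_or (Poly N) L.card with h1 | h1
    · rwa [h1, one_mul]
    · rw [h1, neg_one_mul]
      exact neg_mem hcmem
  · have h1 : ∏ u ∈ L, SymmetricAlgebra.ι ℤ (DualLattice N) u =
        (-1) ^ L.card * PowerSeries.coeff L.card (gradedExpand N h) := by
      rw [hch, Finset.prod_neg, Finset.card_univ, Fintype.card_coe, ← mul_assoc, ← mul_pow]
      simp [Finset.prod_attach L fun u => SymmetricAlgebra.ι ℤ (DualLattice N) u]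
    rw [h1, map_mul, mul_left_comm, div_mul_cancel₀ _ hchne', map_mul]
  · rintro hspan ⟨y, hy⟩
    obtain ⟨j0, hj0⟩ := exists_card_eq_of_decomposition (fun y hy0 => hspan y fun u hu =>
      hy0 ⟨u, hu⟩) hB (fun a => by
        refine ((hQ _).1 fun y hy => ?_).exists
        rw [LinearMap.sum_apply]
        exact Finset.sum_nonneg fun i _ => by simpa using mul_nonneg (by simp) (hy i i.2))
    refine div_ne_zero ((map_ne_zero_iff _ (IsFractionRing.injective _ _)).2 ?_) hchne'
    intro hc0
    -- At `y` a full-rank term is a product of `|L| - n` negative numbers, so this sign makes all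
    -- such terms positive.
    have hev := congrArg (fun p => (-1) ^ (L.card - Module.finrank ℤ N) * evalInt y p) hc0
    rw [hc, hg, map_sum, Finset.mul_sum, map_sum] at hev
    simp only [hcoeff, map_sum, map_zero, mul_zero, Finset.mul_sum] at hev
    have hpos : ∀ j, (B j).card = Module.finrank ℤ N →
        0 < (-1) ^ (L.card - Module.finrank ℤ N) * evalInt y
          (∏ i ∈ (B j)ᶜ, -SymmetricAlgebra.ι ℤ (DualLattice N) i) := by
      intro j hj
      rw [Finset.prod_neg, map_mul, map_pow, map_neg, map_one, hcard, hj, ← mul_assoc, ← mul_pow,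
        map_prod]
      simp only [mul_neg, mul_one, neg_neg, one_pow, one_mul, evalInt_ι]
      exact Finset.prod_pos fun i _ => hy i i.2
    refine absurd hev (ne_of_gt (Finset.sum_pos' (fun j _ => ?_) ⟨j0, Finset.mem_univ _, ?_⟩))
    · split_ifs with hj
      · exact (hpos j hj).le
      · simp
    · rw [if_pos hj0]
      exact hpos j0 hj0

open scoped Classical in
/-- The part of degree `-rank N` of the generating function of `dualSet L`. -/
def part (L : Finset (DualLattice N)) : RatFunc N :=
  if h : ∃ e, HasPart ((dualSet L).indicator 1) e then h.choose else 0

omit [Module.Free ℤ N] in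
theorem part_eq {L : Finset (DualLattice N)} {e : RatFunc N}
    (h : HasPart ((dualSet L).indicator 1) e) : part L = e := by
  have h' : ∃ e, HasPart ((dualSet L).indicator 1) e := ⟨e, h⟩
  rw [part, dif_pos h']
  exact h'.choose_spec.unique h

theorem hasPart_part {L : Finset (DualLattice N)} (hL : 0 ∉ L) :
    HasPart ((dualSet L).indicator 1) (part L) := by
  obtain ⟨e, -, he, -⟩ := exists_hasPart L hL
  rwa [part_eq he]

theorem exists_part_mul_prod {L : Finset (DualLattice N)} (hL : 0 ∉ L) :
    ∃ p ∈ homogeneous N (L.card - Module.finrank ℤ N),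
      part L * algebraMap (Poly N) (RatFunc N) (∏ u ∈ L, SymmetricAlgebra.ι ℤ (DualLattice N) u) =
        algebraMap (Poly N) (RatFunc N) p := by
  obtain ⟨e, p, he, hp, hep, -⟩ := exists_hasPart L hL
  rw [part_eq he]
  exact ⟨p, hp, hep⟩

omit [Module.Free ℤ N] [Module.Finite ℤ N] in
theorem sub_mem_dualSet_iff {L : Finset (DualLattice N)} {u : DualLattice N}
    (hu : ∀ y, (∀ v ∈ L, 0 ≤ v y) → u y = 0) (w : DualLattice N) :
    w - u ∈ dualSet L ↔ w ∈ dualSet L := by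
  refine forall_congr' fun y => forall_congr' fun hy => ?_
  rw [LinearMap.sub_apply, hu y hy, sub_zero]

omit [Module.Free ℤ N] in
theorem hasPart_dualSet_zero {L : Finset (DualLattice N)} {u : DualLattice N} (hu0 : u ≠ 0)
    (hu : ∀ y, (∀ v ∈ L, 0 ≤ v y) → u y = 0) : HasPart ((dualSet L).indicator 1) 0 := by
  classical
  refine HasPart.of_invariant hu0 fun w => ?_
  simp only [Set.indicator_apply, sub_mem_dualSet_iff hu, Pi.one_apply]

omit [Module.Finite ℤ N] [Module.Free ℤ N] in
/-- Either the cone defined by `L` has an interior point, or some inequality in `L` is an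
equality on it. -/
theorem exists_interior_or_exists_eq_zero (L : Finset (DualLattice N)) :
    (∃ y : N, ∀ u ∈ L, 0 < u y) ∨ ∃ u ∈ L, ∀ y, (∀ v ∈ L, 0 ≤ v y) → u y = 0 := by
  by_contra! h
  obtain ⟨h1, h2⟩ := h
  choose! y hy hne using h2
  -- If every inequality is strict somewhere on the cone, the sum of the witnesses satisfies all of
  -- them strictly.
  obtain ⟨u, hu, hle⟩ := h1 (∑ u ∈ L, y u)
  rw [map_sum] at hle
  have h3 : 0 < u (y u) := lt_of_le_of_ne (hy u hu u hu) (hne u hu).symm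
  have h4 := Finset.single_le_sum (f := fun v => u (y v)) (fun v hv => hy v hv u hu) hu
  linarith

omit [Module.Free ℤ N] in
theorem part_eq_zero_of_not_exists {L : Finset (DualLattice N)} (hL : 0 ∉ L)
    (h : ¬ ∃ y : N, ∀ u ∈ L, 0 < u y) : part L = 0 := by
  obtain ⟨u, hu, h'⟩ := (exists_interior_or_exists_eq_zero L).resolve_left h
  exact part_eq (hasPart_dualSet_zero (fun h0 => hL (h0 ▸ hu)) h')

/-- With an interior point the part is nonzero, hence the lowest term. Otherwise an element of `L`
vanishes on the cone, translation by it preserves the dual points, and both sides are zero. -/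
theorem principalPart_hilb_eq_part {σ : PointedCone ℝ (RealSpace N)} {L : Finset (DualLattice N)}
    (hL : 0 ∉ L) (hspan : ∀ y : N, (∀ u ∈ L, u y = 0) → y = 0) (hσ : dualPoints σ = dualSet L) :
    principalPart (hilb σ) = part L := by
  by_cases h : ∃ y : N, ∀ u ∈ L, 0 < u y
  · obtain ⟨e, -, he, -, -, hne⟩ := exists_hasPart L hL
    rw [part_eq he]
    rw [← hσ] at he
    exact he.principalPart_hilb (hne hspan h)
  · rw [part_eq_zero_of_not_exists hL h]
    obtain ⟨u, hu, h'⟩ := (exists_interior_or_exists_eq_zero L).resolve_left h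
    refine principalPart_hilb_of_invariant (u := u) (fun h0 => hL (h0 ▸ hu)) fun w => ?_
    rw [hσ]
    exact sub_mem_dualSet_iff h' w

/-- Cutting a cone with a hyperplane. -/
theorem part_insert_add_part_insert_neg [DecidableEq (DualLattice N)] {L : Finset (DualLattice N)}
    (hL : 0 ∉ L) {u : DualLattice N} (hu : u ≠ 0) :
    part (insert u L) + part (insert (-u) L) = part L := by
  -- Polarity is a valuation: the duals of the two halves have as intersection the dual of the cone,
  -- and as union the dual of the slice `u = 0`.
  have h1 : (dualSet (insert u L)).indicator (1 : DualLattice N → ℤ) +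
      (dualSet (insert (-u) L)).indicator 1 =
      (dualSet L).indicator 1 + (dualSet (insert u (insert (-u) L))).indicator 1 := by
    classical
    ext m
    have ha : m ∈ dualSet L → m ∈ dualSet (insert u L) := fun h y hy =>
      h y fun v hv => hy v (by simp [hv])
    have hb : m ∈ dualSet L → m ∈ dualSet (insert (-u) L) := fun h y hy =>
      h y fun v hv => hy v (by simp [hv])
    have hc : m ∈ dualSet (insert u L) → m ∈ dualSet (insert u (insert (-u) L)) := fun h y hy =>
      h y fun v hv => hy v (by simp only [Finset.mem_insert] at hv ⊢; tauto)
    have hd : m ∈ dualSet (insert (-u) L) → m ∈ dualSet (insert u (insert (-u) L)) := fun h y hy =>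
      h y fun v hv => hy v (by simp only [Finset.mem_insert] at hv ⊢; tauto)
    have he : m ∈ dualSet (insert u L) → m ∈ dualSet (insert (-u) L) → m ∈ dualSet L := by
      intro h1 h2 y hy
      rcases le_total 0 (u y) with h | h
      · exact h1 y fun v hv => by
          rcases Finset.mem_insert.1 hv with rfl | hv
          exacts [h, hy v hv]
      · exact h2 y fun v hv => by
          rcases Finset.mem_insert.1 hv with rfl | hv
          exacts [by simpa using h, hy v hv]
    have hf : m ∈ dualSet (insert u (insert (-u) L)) →
        m ∈ dualSet (insert u L) ∨ m ∈ dualSet (insert (-u) L) := by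
      intro h
      by_contra! hn
      obtain ⟨hn1, hn2⟩ := hn
      simp only [dualSet, Set.mem_ofPred_eq, not_forall, not_le, Finset.forall_mem_insert] at hn1 hn2
      obtain ⟨a, ⟨hau, haL⟩, ham⟩ := hn1
      obtain ⟨b, ⟨hbu, hbL⟩, hbm⟩ := hn2
      rw [LinearMap.neg_apply] at hbu
      -- A positive combination of witnesses from the two half-spaces lies on `u = 0`, where `m`
      -- cannot be negative.
      have hsum : 0 ≤ m ((-u b) • a + u a • b) := by
        refine h _ ?_
        simp only [Finset.forall_mem_insert, map_add, map_smul, smul_eq_mul, LinearMap.neg_apply]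
        refine ⟨by linarith, by linarith, fun v hv => ?_⟩
        exact add_nonneg (mul_nonneg hbu (haL v hv)) (mul_nonneg hau (hbL v hv))
      rw [map_add, map_smul, map_smul, smul_eq_mul, smul_eq_mul] at hsum
      rcases hau.eq_or_lt with h0 | h0
      · refine not_le.2 ham (h a ?_)
        simp only [Finset.forall_mem_insert, LinearMap.neg_apply]
        exact ⟨by omega, by omega, haL⟩
      · nlinarith
    simp only [Pi.add_apply, Set.indicator_apply, Pi.one_apply]
    by_cases h1 : m ∈ dualSet (insert u L) <;> by_cases h2 : m ∈ dualSet (insert (-u) L)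
    · simp [h1, h2, he h1 h2, hc h1]
    · simp [h1, h2, hc h1, mt hb h2]
    · simp [h1, h2, hd h2, mt ha h1]
    · simp [h1, h2, mt ha h1, mt hf (not_or.2 ⟨h1, h2⟩)]
  have h2 : HasPart ((dualSet (insert u (insert (-u) L))).indicator 1) (0 : RatFunc N) := by
    refine hasPart_dualSet_zero hu ?_
    intro y hy
    simp only [Finset.forall_mem_insert, LinearMap.neg_apply] at hy
    omega
  have h3 := (hasPart_part (L := insert u L) (by simp [hL, hu.symm])).add
    (hasPart_part (L := insert (-u) L) (by simp [hL, hu]))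
  rw [h1] at h3
  rw [h3.unique ((hasPart_part hL).add h2), add_zero]

end Part

/-! ### Polynomials vanishing on lattice points of a cone -/

section Vanishing

variable {N : Type*} [AddCommGroup N]

/-- The restriction of a polynomial to the line `a + t b`, as a polynomial in `t`. -/
def evalLine (a b : N) : Poly N →ₐ[ℤ] Polynomial ℤ :=
  SymmetricAlgebra.lift
    ((Polynomial.monomial 0).comp (LinearMap.applyₗ a) +
      (Polynomial.monomial 1).comp (LinearMap.applyₗ b))

theorem eval_evalLine (a b : N) (t : ℤ) (p : Poly N) :
    (evalLine a b p).eval t = evalInt (a + t • b) p := by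
  have h : (Polynomial.aeval t).comp (evalLine a b) = evalInt (a + t • b) := by
    refine SymmetricAlgebra.algHom_ext (LinearMap.ext fun u => ?_)
    simp [evalLine, mul_comm]
  rw [← h, AlgHom.comp_apply, Polynomial.coe_aeval_eq_eval]

/-- Along the line `a + t b` the polynomial vanishes for all natural `t`, hence also at `t = -1`. -/
theorem evalInt_sub_eq_zero {W : AddSubmonoid N} {p : Poly N} (hW : ∀ w ∈ W, evalInt w p = 0)
    {a b : N} (ha : a ∈ W) (hb : b ∈ W) : evalInt (a - b) p = 0 := by
  have h : evalLine a b p = 0 := by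
    refine Polynomial.eq_zero_of_infinite_isRoot _ ?_
    refine (Set.infinite_range_of_injective (Nat.cast_injective (R := ℤ))).mono ?_
    rintro _ ⟨t, rfl⟩
    change Polynomial.eval _ _ = 0
    rw [eval_evalLine, natCast_zsmul]
    exact hW _ (add_mem ha (nsmul_mem hb t))
  have h1 := eval_evalLine a b (-1) p
  rw [h, Polynomial.eval_zero, neg_one_smul, ← sub_eq_add_neg] at h1
  exact h1.symm

/-- Along the line through `h` the polynomial vanishes at all natural multiples of `k`, hence
identically, in particular at `t = 1`. -/
theorem evalInt_eq_zero_of_nsmul_mem {W : AddSubmonoid N} {p : Poly N}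
    (hW : ∀ w ∈ W, evalInt w p = 0) {h : N} {k : ℕ} (hk : 0 < k) {a b : N} (ha : a ∈ W) (hb : b ∈ W)
    (hab : k • h = a - b) : evalInt h p = 0 := by
  have h0 : evalLine 0 h p = 0 := by
    refine Polynomial.eq_zero_of_infinite_isRoot _ ?_
    refine (Set.infinite_range_of_injective (f := fun t : ℕ => ((t * k : ℕ) : ℤ)) ?_).mono ?_
    · intro s t hst
      simpa [hk.ne'] using hst
    rintro _ ⟨t, rfl⟩
    change Polynomial.eval _ _ = 0
    rw [eval_evalLine, zero_add, natCast_zsmul, mul_smul, hab, smul_sub]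
    exact evalInt_sub_eq_zero hW (nsmul_mem ha t) (nsmul_mem hb t)
  have h1 := eval_evalLine 0 h 1 p
  rw [h0, Polynomial.eval_zero, zero_add, one_smul] at h1
  exact h1.symm

theorem eq_zero_of_evalInt [Module.Free ℤ N] [Module.Finite ℤ N] {p : Poly N}
    (h : ∀ x : N, evalInt x p = 0) : p = 0 := by
  rw [← map_eq_zero_iff _ (SymmetricAlgebra.equivMvPolynomial (dualBasis N)).injective]
  refine MvPolynomial.funext fun a => ?_
  obtain ⟨x, hx⟩ := (Module.evalEquiv ℤ N).surjective ((dualBasis N).constr ℤ a)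
  have hx' : ∀ i, dualBasis N i x = a i := fun i => by
    simpa using LinearMap.congr_fun hx (dualBasis N i)
  have h1 : (MvPolynomial.aeval a).comp
      (SymmetricAlgebra.equivMvPolynomial (dualBasis N)).toAlgHom = evalInt x := by
    refine SymmetricAlgebra.algHom_ext ((dualBasis N).ext fun i => ?_)
    simp [hx']
  rw [map_zero, ← h x, ← h1]
  rfl

end Vanishing

/-! ### Primitive linear forms as primes -/

section Primitive

variable {N : Type*} [AddCommGroup N]

/-- The pullback of polynomials along the projection `y ↦ y - u(y) e` of `N` to the kernel
of `u`, where `u(e) = 1`. -/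
def restrictKer (u : DualLattice N) (e : N) : Poly N →ₐ[ℤ] Poly N :=
  SymmetricAlgebra.lift (SymmetricAlgebra.ι ℤ (DualLattice N) ∘ₗ
    (LinearMap.id - (LinearMap.applyₗ e).smulRight u))

theorem restrictKer_ι (u : DualLattice N) (e : N) (m : DualLattice N) :
    restrictKer u e (SymmetricAlgebra.ι ℤ (DualLattice N) m) =
      SymmetricAlgebra.ι ℤ (DualLattice N) (m - m e • u) := by
  simp [restrictKer]

theorem evalInt_restrictKer (u : DualLattice N) (e y : N) (p : Poly N) :
    evalInt y (restrictKer u e p) = evalInt (y - u y • e) p := by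
  have h : (evalInt y).comp (restrictKer u e) = evalInt (y - u y • e) := by
    refine SymmetricAlgebra.algHom_ext (LinearMap.ext fun m => ?_)
    change evalInt y (restrictKer u e (SymmetricAlgebra.ι ℤ (DualLattice N) m)) =
      evalInt _ (SymmetricAlgebra.ι ℤ (DualLattice N) m)
    rw [restrictKer_ι, evalInt_ι, evalInt_ι]
    simp [mul_comm]
  rw [← h, AlgHom.comp_apply]

/-- Modulo `u` the substitution `restrictKer` is the identity, as it changes each linear form by a
multiple of `u`; and it kills `u` since `u e = 1`. -/
theorem ι_dvd_iff {u : DualLattice N} {e : N} (he : u e = 1) (p : Poly N) :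
    SymmetricAlgebra.ι ℤ (DualLattice N) u ∣ p ↔ restrictKer u e p = 0 := by
  have h : (Ideal.Quotient.mkₐ ℤ (Ideal.span {SymmetricAlgebra.ι ℤ (DualLattice N) u})).comp
      (restrictKer u e) =
      Ideal.Quotient.mkₐ ℤ (Ideal.span {SymmetricAlgebra.ι ℤ (DualLattice N) u}) := by
    refine SymmetricAlgebra.algHom_ext (LinearMap.ext fun m => ?_)
    change Ideal.Quotient.mk _ (restrictKer u e (SymmetricAlgebra.ι ℤ (DualLattice N) m)) =
      Ideal.Quotient.mk _ (SymmetricAlgebra.ι ℤ (DualLattice N) m)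
    rw [restrictKer_ι, Ideal.Quotient.eq, Ideal.mem_span_singleton, map_sub, sub_sub_cancel_left, map_smul,
      zsmul_eq_mul]
    exact (Dvd.intro_left _ rfl).neg_right
  constructor
  · rintro ⟨q, rfl⟩
    rw [map_mul, restrictKer_ι, he, one_smul, sub_self, map_zero, zero_mul]
  · intro h0
    have h1 := DFunLike.congr_fun h p
    rw [AlgHom.comp_apply, h0, map_zero, eq_comm, Ideal.Quotient.mkₐ_eq_mk,
      Ideal.Quotient.eq_zero_iff_mem, Ideal.mem_span_singleton] at h1
    exact h1

/-- The form generates the kernel of an endomorphism of a domain. -/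
theorem prime_ι [Module.Finite ℤ N] {u : DualLattice N} {e : N} (he : u e = 1) :
    Prime (SymmetricAlgebra.ι ℤ (DualLattice N) u) := by
  refine ⟨?_, ?_, fun a b hab => ?_⟩
  · rw [map_ne_zero_iff _ ι_injective]
    rintro rfl
    simp at he
  · intro h
    have := (ι_dvd_iff he 1).1 h.dvd
    rw [map_one] at this
    exact one_ne_zero this
  · rw [ι_dvd_iff he, map_mul, mul_eq_zero] at hab
    rwa [ι_dvd_iff he, ι_dvd_iff he]

theorem not_ι_dvd_ι {u v : DualLattice N} (hu : ∃ e, u e = 1) (hv : ∃ e, v e = 1) (h1 : u ≠ v)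
    (h2 : u ≠ -v) : ¬ SymmetricAlgebra.ι ℤ (DualLattice N) u ∣ SymmetricAlgebra.ι ℤ (DualLattice N) v := by
  obtain ⟨e, he⟩ := hu
  obtain ⟨e', he'⟩ := hv
  rw [ι_dvd_iff he, restrictKer_ι, map_eq_zero_iff _ ι_injective, sub_eq_zero]
  intro h
  have h3 := LinearMap.congr_fun h e'
  rw [he', LinearMap.smul_apply, smul_eq_mul, eq_comm, Int.mul_eq_one_iff_eq_one_or_neg_one] at h3
  rcases h3 with ⟨h3, -⟩ | ⟨h3, -⟩
  · rw [h3, one_smul] at h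
    exact h1 h.symm
  · rw [h3, neg_one_smul] at h
    exact h2 (by rw [h, neg_neg])

theorem ι_dvd_of_evalInt [Module.Free ℤ N] [Module.Finite ℤ N] {u : DualLattice N}
    (hu : ∃ e, u e = 1) {p : Poly N} (h : ∀ y, u y = 0 → evalInt y p = 0) :
    SymmetricAlgebra.ι ℤ (DualLattice N) u ∣ p := by
  obtain ⟨e, he⟩ := hu
  rw [ι_dvd_iff he]
  refine eq_zero_of_evalInt fun y => ?_
  rw [evalInt_restrictKer]
  refine h _ ?_
  rw [map_sub, map_smul, he, smul_eq_mul, mul_one, sub_self]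

theorem prod_ι_dvd [Module.Finite ℤ N] {A : Finset (DualLattice N)}
    (hA : ∀ u ∈ A, ∃ e, u e = 1) (hA' : ∀ u ∈ A, ∀ v ∈ A, u ≠ -v) {p : Poly N}
    (h : ∀ u ∈ A, SymmetricAlgebra.ι ℤ (DualLattice N) u ∣ p) :
    ∏ u ∈ A, SymmetricAlgebra.ι ℤ (DualLattice N) u ∣ p := by
  classical
  induction A using Finset.induction_on with
  | empty => simp
  | insert u A hu ih =>
    obtain ⟨q, rfl⟩ := ih (fun v hv => hA v (by simp [hv]))
      (fun v hv w hw => hA' v (by simp [hv]) w (by simp [hw])) (fun v hv => h v (by simp [hv]))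
    obtain ⟨e, he⟩ := hA u (by simp)
    rw [Finset.prod_insert hu, mul_comm (SymmetricAlgebra.ι ℤ (DualLattice N) u)]
    refine mul_dvd_mul_left _ (((prime_ι he).dvd_or_dvd (h u (by simp))).resolve_left fun h1 => ?_)
    obtain ⟨v, hv, h2⟩ := (prime_ι he).exists_mem_finset_dvd h1
    refine not_ι_dvd_ι ⟨e, he⟩ (hA v (by simp [hv])) ?_ (hA' u (by simp) v (by simp [hv])) h2
    rintro rfl
    exact hu hv

end Primitive

/-! ### Grading, and rational functions without poles -/

section Homogeneous

variable {N : Type*} [AddCommGroup N]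

/-- The homomorphism `u ↦ u X` whose component of degree `d` is the form of degree `d`. -/
def gradeHom (N : Type*) [AddCommGroup N] : Poly N →ₐ[ℤ] Polynomial (Poly N) :=
  SymmetricAlgebra.lift (((Polynomial.monomial 1).restrictScalars ℤ).comp
    (SymmetricAlgebra.ι ℤ (DualLattice N)))

theorem gradeHom_ι (u : DualLattice N) : gradeHom N (SymmetricAlgebra.ι ℤ (DualLattice N) u) =
    Polynomial.monomial 1 (SymmetricAlgebra.ι ℤ (DualLattice N) u) := by
  simp [gradeHom]

theorem homogeneous_natCast (d : ℕ) : homogeneous N d =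
    LinearMap.range (SymmetricAlgebra.ι ℤ (DualLattice N)) ^ d := by
  simp [homogeneous]

theorem gradeHom_of_mem {d : ℕ} {p : Poly N} (hp : p ∈ homogeneous N d) :
    gradeHom N p = Polynomial.monomial d p := by
  rw [homogeneous_natCast] at hp
  induction hp using Submodule.pow_induction_on_left' with
  | algebraMap r => simp
  | add x y i _ _ hx hy => rw [map_add, hx, hy, map_add]
  | mem_mul m hm i x _ hx =>
    obtain ⟨u, rfl⟩ := hm
    rw [map_mul, hx, gradeHom_ι, Polynomial.monomial_mul_monomial, add_comm]

theorem mul_mem_homogeneous {a b : ℤ} {p q : Poly N} (hp : p ∈ homogeneous N a)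
    (hq : q ∈ homogeneous N b) : p * q ∈ homogeneous N (a + b) := by
  by_cases ha : 0 ≤ a
  · by_cases hb : 0 ≤ b
    · lift a to ℕ using ha
      lift b to ℕ using hb
      rw [← Nat.cast_add, homogeneous_natCast, pow_add]
      rw [homogeneous_natCast] at hp hq
      exact Submodule.mul_mem_mul hp hq
    · rw [homogeneous, if_neg hb, Submodule.mem_bot] at hq
      rw [hq, mul_zero]
      exact zero_mem _
  · rw [homogeneous, if_neg ha, Submodule.mem_bot] at hp
    rw [hp, zero_mul]
    exact zero_mem _

theorem coeff_gradeHom_mem (p : Poly N) (d : ℕ) :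
    (gradeHom N p).coeff d ∈ homogeneous N d := by
  induction p using SymmetricAlgebra.induction generalizing d with
  | algebraMap r =>
    rw [AlgHom.commutes, Polynomial.algebraMap_apply, Polynomial.coeff_C]
    split_ifs with h
    · rw [h, homogeneous_natCast, pow_zero]
      exact Submodule.algebraMap_mem r
    · exact zero_mem _
  | ι u =>
    rw [gradeHom_ι, Polynomial.coeff_monomial]
    split_ifs with h
    · rw [← h, homogeneous_natCast, pow_one]
      exact ⟨u, rfl⟩
    · exact zero_mem _
  | mul a b ha hb =>
    rw [map_mul, Polynomial.coeff_mul]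
    refine Submodule.sum_mem _ fun x hx => ?_
    rw [← Finset.HasAntidiagonal.mem_antidiagonal.1 hx, Nat.cast_add]
    exact mul_mem_homogeneous (ha _) (hb _)
  | add a b ha hb =>
    rw [map_add, Polynomial.coeff_add]
    exact add_mem (ha d) (hb d)

theorem prod_ι_mem_homogeneous (A : Finset (DualLattice N)) :
    ∏ u ∈ A, SymmetricAlgebra.ι ℤ (DualLattice N) u ∈ homogeneous N A.card := by
  rw [homogeneous_natCast]
  simpa using prod_pow_mem_pow_sum (LinearMap.range (SymmetricAlgebra.ι ℤ (DualLattice N))) A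
    (SymmetricAlgebra.ι ℤ (DualLattice N)) (fun _ => 1) fun u _ => ⟨u, rfl⟩

/-- Under `gradeHom`, cancelling the nonzero form leaves `X ^ |A|` times the grading of `q` equal to
a single monomial. -/
theorem mem_homogeneous_of_mul_prod_mem [Module.Finite ℤ N] {A : Finset (DualLattice N)}
    (hA : 0 ∉ A) {q : Poly N} {a : ℤ}
    (h : (∏ u ∈ A, SymmetricAlgebra.ι ℤ (DualLattice N) u) * q ∈ homogeneous N (A.card + a)) :
    q ∈ homogeneous N a := by
  have hne : ∏ u ∈ A, SymmetricAlgebra.ι ℤ (DualLattice N) u ≠ 0 :=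
    Finset.prod_ne_zero_iff.2 fun u hu => by
      rw [map_ne_zero_iff _ ι_injective]
      rintro rfl
      exact hA hu
  have hA1 := gradeHom_of_mem (prod_ι_mem_homogeneous A)
  set P := ∏ u ∈ A, SymmetricAlgebra.ι ℤ (DualLattice N) u
  by_cases hd : 0 ≤ A.card + a
  · obtain ⟨d, hd⟩ := Int.eq_ofNat_of_zero_le hd
    rw [hd] at h
    have h1 := gradeHom_of_mem h
    rw [map_mul, hA1] at h1
    have h2 : Polynomial.X ^ A.card * gradeHom N q = Polynomial.monomial d q := by
      apply mul_left_cancel₀ (Polynomial.C_ne_zero.2 hne)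
      rw [← mul_assoc, Polynomial.C_mul_X_pow_eq_monomial, h1, Polynomial.C_mul_monomial]
    have h3 := congrArg (fun f => Polynomial.coeff f d) h2
    simp only [Polynomial.coeff_monomial, if_true, Polynomial.coeff_X_pow_mul'] at h3
    rw [← h3]
    split_ifs with hle
    · rw [show a = ((d - A.card : ℕ) : ℤ) by omega]
      exact coeff_gradeHom_mem _ _
    · exact zero_mem _
  · rw [homogeneous, if_neg hd, Submodule.mem_bot] at h
    rw [(mul_eq_zero.1 h).resolve_left hne]
    exact zero_mem _

/-- A rational function without poles is a polynomial. -/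
theorem exists_mem_homogeneous_of_forall_erase [Module.Finite ℤ N] [DecidableEq (DualLattice N)]
    {A : Finset (DualLattice N)}
    (hA : ∀ u ∈ A, ∃ e, u e = 1) (hA' : ∀ u ∈ A, ∀ v ∈ A, u ≠ -v) {c : RatFunc N} {a : ℤ}
    (h : ∃ p ∈ homogeneous N (A.card + a),
      c * algebraMap (Poly N) (RatFunc N) (∏ u ∈ A, SymmetricAlgebra.ι ℤ (DualLattice N) u) =
        algebraMap (Poly N) (RatFunc N) p)
    (herase : ∀ u ∈ A, ∃ p,
      c * algebraMap (Poly N) (RatFunc N) (∏ v ∈ A.erase u, SymmetricAlgebra.ι ℤ (DualLattice N) v) =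
        algebraMap (Poly N) (RatFunc N) p) :
    ∃ p ∈ homogeneous N a, c = algebraMap (Poly N) (RatFunc N) p := by
  have hA0 : 0 ∉ A := fun h0 => by
    obtain ⟨e, he⟩ := hA 0 h0
    simp at he
  obtain ⟨p, hp, hcp⟩ := h
  obtain ⟨q, rfl⟩ := prod_ι_dvd hA hA' (p := p) fun u hu => by
    obtain ⟨q, hq⟩ := herase u hu
    refine ⟨q, IsFractionRing.injective (Poly N) (RatFunc N) ?_⟩
    rw [← hcp, ← Finset.mul_prod_erase A _ hu, map_mul, map_mul, mul_left_comm, hq]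
  refine ⟨q, mem_homogeneous_of_mul_prod_mem hA0 hp, ?_⟩
  have hne : algebraMap (Poly N) (RatFunc N) (∏ u ∈ A, SymmetricAlgebra.ι ℤ (DualLattice N) u) ≠ 0 := by
    refine (map_ne_zero_iff _ (IsFractionRing.injective _ _)).2 (Finset.prod_ne_zero_iff.2 ?_)
    intro u hu
    rw [map_ne_zero_iff _ ι_injective]
    rintro rfl
    exact hA0 hu
  apply mul_right_cancel₀ hne
  rw [hcp, map_mul, mul_comm]

end Homogeneous

/-! ### Chambers of a hyperplane arrangement, as sign choices -/

section Signs

variable {K : Type*} [AddCommGroup K]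

theorem ne_neg_self_of_primitive {u : DualLattice K} (hu : ∃ e, u e = 1) : u ≠ -u := by
  obtain ⟨e, he⟩ := hu
  intro h
  have := LinearMap.congr_fun h e
  rw [LinearMap.neg_apply, he] at this
  omega

theorem zero_notMem_of_primitive {A : Finset (DualLattice K)} (hA : ∀ u ∈ A, ∃ e, u e = 1) :
    0 ∉ A := fun h => by
  obtain ⟨e, he⟩ := hA 0 h
  simp at he

/-- A choice of one vector in each pair `u, -u`. -/
theorem exists_representatives_up_to_sign (L : Finset (DualLattice K))
    (hL : ∀ u ∈ L, ∃ e, u e = 1) :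
    ∃ A ⊆ L, (∀ u ∈ L, u ∈ A ∨ -u ∈ A) ∧ ∀ u ∈ A, ∀ v ∈ A, u ≠ -v := by
  classical
  induction L using Finset.induction_on with
  | empty => exact ⟨∅, by simp⟩
  | insert u L _ ih =>
    obtain ⟨A, hAL, hA, hA'⟩ := ih fun v hv => hL v (by simp [hv])
    by_cases hu : -u ∈ A
    · refine ⟨A, hAL.trans (Finset.subset_insert _ _), fun v hv => ?_, hA'⟩
      rcases Finset.mem_insert.1 hv with rfl | hv
      exacts [Or.inr hu, hA v hv]
    · refine ⟨insert u A, Finset.insert_subset_insert _ hAL, fun v hv => ?_, ?_⟩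
      · rcases Finset.mem_insert.1 hv with rfl | hv
        · simp
        · exact (hA v hv).imp (fun h => by simp [h]) (fun h => by simp [h])
      · intro v hv w hw
        rcases Finset.mem_insert.1 hv with hv' | hv' <;>
          rcases Finset.mem_insert.1 hw with hw' | hw'
        · rw [hv', hw']
          exact ne_neg_self_of_primitive (hL _ (by simp))
        · intro h
          exact hu (by rwa [← hv', h, neg_neg])
        · intro h
          exact hu (by rwa [← hw', ← h])
        · exact hA' v hv' w hw'

open scoped Classical in
/-- The vectors of `A`, with the sign of those outside `s` reversed. -/
def signed (A s : Finset (DualLattice K)) : Finset (DualLattice K) :=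
  A.image fun u => if u ∈ s then u else -u

theorem mem_signed {A s : Finset (DualLattice K)} {v : DualLattice K} :
    v ∈ signed A s ↔ (v ∈ A ∧ v ∈ s) ∨ (-v ∈ A ∧ -v ∉ s) := by
  simp only [signed, Finset.mem_image]
  constructor
  · rintro ⟨u, hu, rfl⟩
    split_ifs with h
    · exact Or.inl ⟨hu, h⟩
    · exact Or.inr (by simpa using ⟨hu, h⟩)
  · rintro (⟨h1, h2⟩ | ⟨h1, h2⟩)
    · exact ⟨v, h1, if_pos h2⟩
    · exact ⟨-v, h1, by rw [if_neg h2, neg_neg]⟩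

theorem mem_signed_or_neg_mem_signed {A : Finset (DualLattice K)} (s : Finset (DualLattice K))
    {v : DualLattice K} (hv : v ∈ A ∨ -v ∈ A) : v ∈ signed A s ∨ -v ∈ signed A s := by
  simp only [mem_signed, neg_neg]
  tauto

theorem primitive_of_mem_signed {A s : Finset (DualLattice K)} (hA : ∀ u ∈ A, ∃ e, u e = 1)
    {v : DualLattice K} (hv : v ∈ signed A s) : ∃ e, v e = 1 := by
  rcases mem_signed.1 hv with h | h
  · exact hA v h.1
  · obtain ⟨e, he⟩ := hA _ h.1
    exact ⟨-e, by simpa using he⟩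

theorem signed_insert_of_notMem [DecidableEq (DualLattice K)] {A s : Finset (DualLattice K)}
    {u : DualLattice K} (hu : u ∉ s) : signed (insert u A) s = insert (-u) (signed A s) := by
  ext v
  simp only [mem_signed, Finset.mem_insert]
  by_cases h1 : v = -u
  · simp [h1, hu]
  by_cases h2 : v = u
  · subst h2
    simp [h1, hu, neg_eq_iff_eq_neg]
  · simp [h1, h2, neg_eq_iff_eq_neg]

theorem signed_insert_insert [DecidableEq (DualLattice K)] {A s : Finset (DualLattice K)}
    {u : DualLattice K} (hu : u ∉ A) :
    signed (insert u A) (insert u s) = insert u (signed A s) := by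
  ext v
  simp only [mem_signed, Finset.mem_insert]
  by_cases h1 : v = u
  · simp [h1]
  by_cases h2 : -v = u
  · subst h2
    simp [h1, hu]
  · simp [h1, h2]

theorem prod_signed {A s : Finset (DualLattice K)} (hA : ∀ u ∈ A, ∀ v ∈ A, u ≠ -v) :
    ∏ u ∈ signed A s, SymmetricAlgebra.ι ℤ (DualLattice K) u =
        ∏ u ∈ A, SymmetricAlgebra.ι ℤ (DualLattice K) u ∨
      ∏ u ∈ signed A s, SymmetricAlgebra.ι ℤ (DualLattice K) u =
        -∏ u ∈ A, SymmetricAlgebra.ι ℤ (DualLattice K) u := by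
  classical
  induction A using Finset.induction_on with
  | empty => simp [signed]
  | insert u A hu ih =>
    have ih := ih fun v hv w hw => hA v (by simp [hv]) w (by simp [hw])
    rw [Finset.prod_insert hu]
    have h1 : u ∉ signed A s := by
      rw [mem_signed]
      rintro (h | h)
      · exact hu h.1
      · exact hA u (by simp) _ (Finset.mem_insert_of_mem h.1) (by simp)
    have h2 : -u ∉ signed A s := by
      rw [mem_signed, neg_neg]
      rintro (h | h)
      · exact hA _ (Finset.mem_insert_of_mem h.1) u (by simp) rfl
      · exact hu h.1
    have h3 : signed (insert u A) s = insert (if u ∈ s then u else -u) (signed A s) := by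
      rw [signed, Finset.image_insert]
      congr
    rw [h3]
    split_ifs with h
    · rw [Finset.prod_insert h1]
      rcases ih with ih | ih <;> simp [ih]
    · rw [Finset.prod_insert h2, map_neg]
      rcases ih with ih | ih <;> simp [ih]

theorem card_signed {A s : Finset (DualLattice K)} (hA : ∀ u ∈ A, ∀ v ∈ A, u ≠ -v) :
    (signed A s).card = A.card := by
  classical
  refine Finset.card_image_of_injOn fun u hu v hv h => ?_
  beta_reduce at h
  split_ifs at h
  · exact h
  · exact absurd h (hA u hu v hv)
  · exact absurd h.symm (hA v hv u hu)
  · exact neg_injective h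

variable [Module.Free ℤ K] [Module.Finite ℤ K]

theorem exists_part_signed_mul_prod {A s : Finset (DualLattice K)} (hA : ∀ u ∈ A, ∃ e, u e = 1)
    (hA' : ∀ u ∈ A, ∀ v ∈ A, u ≠ -v) :
    ∃ p ∈ homogeneous K (A.card - Module.finrank ℤ K), part (signed A s) *
        algebraMap (Poly K) (RatFunc K) (∏ u ∈ A, SymmetricAlgebra.ι ℤ (DualLattice K) u) =
      algebraMap (Poly K) (RatFunc K) p := by
  obtain ⟨p, hp, h⟩ := exists_part_mul_prod
    (zero_notMem_of_primitive fun v hv => primitive_of_mem_signed (s := s) hA hv)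
  rw [card_signed hA'] at hp
  rcases prod_signed (s := s) hA' with h1 | h1
  · exact ⟨p, hp, by rw [← h1, h]⟩
  · exact ⟨-p, neg_mem hp, by rw [map_neg, ← h, h1, map_neg, mul_neg, neg_neg]⟩

/-- Cutting a cone with the hyperplanes of an arrangement. -/
theorem part_eq_sum_signed [DecidableEq (DualLattice K)] {L A : Finset (DualLattice K)}
    (hL : 0 ∉ L) (hA : ∀ u ∈ A, ∃ e, u e = 1) :
    part L = ∑ s ∈ A.powerset, part (L ∪ signed A s) := by
  induction A using Finset.induction_on with
  | empty => simp [signed]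
  | insert u A hu ih =>
    have hA1 : ∀ v ∈ A, ∃ e, v e = 1 := fun v hv => hA v (by simp [hv])
    have hu0 : u ≠ 0 := by
      rintro rfl
      exact zero_notMem_of_primitive hA (by simp)
    rw [ih hA1, Finset.sum_powerset_insert hu, ← Finset.sum_add_distrib]
    refine Finset.sum_congr rfl fun s hs => ?_
    rw [signed_insert_of_notMem fun h => hu (Finset.mem_powerset.1 hs h), signed_insert_insert hu,
      Finset.union_insert, Finset.union_insert, add_comm, part_insert_add_part_insert_neg _ hu0]
    rw [Finset.mem_union]
    rintro (h | h)
    · exact hL h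
    · exact zero_notMem_of_primitive (fun v hv => primitive_of_mem_signed hA1 hv) h

omit [Module.Free ℤ K] in
-- If `v ∈ L` has the wrong sign, both `v` and `-v` occur in the union, so that cone has no
-- interior.
theorem part_union_signed [DecidableEq (DualLattice K)] {L A s : Finset (DualLattice K)}
    (hL : ∀ u ∈ L, ∃ e, u e = 1) (hLA : ∀ u ∈ L, u ∈ A ∨ -u ∈ A) (hA : ∀ u ∈ A, ∃ e, u e = 1) :
    part (L ∪ signed A s) = if L ⊆ signed A s then part (signed A s) else 0 := by
  split_ifs with h
  · rw [Finset.union_eq_right.2 h]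
  · obtain ⟨v, hv, hvs⟩ := Finset.not_subset.1 h
    have h1 := (mem_signed_or_neg_mem_signed s (hLA v hv)).resolve_left hvs
    refine part_eq_zero_of_not_exists (zero_notMem_of_primitive fun u hu => ?_) ?_
    · rcases Finset.mem_union.1 hu with hu | hu
      exacts [hL u hu, primitive_of_mem_signed hA hu]
    · rintro ⟨y, hy⟩
      have h2 := hy v (Finset.mem_union_left _ hv)
      have h3 := hy (-v) (Finset.mem_union_right _ h1)
      rw [LinearMap.neg_apply] at h3
      omega

end Signs

/-! ### Functions on the quotient as functions on `N` -/

section Inclusion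

variable {N : Type*} [AddCommGroup N] [Module.Finite ℤ N] (τ : PointedCone ℝ (RealSpace N))

omit [Module.Finite ℤ N] in
theorem dualIncl_injective : Function.Injective (dualIncl τ) := by
  intro u v h
  ext y
  obtain ⟨x, rfl⟩ := quotMap_surjective τ y
  exact LinearMap.congr_fun h x

omit [Module.Finite ℤ N] in
theorem polyIncl_ι (u : DualLattice (QuotLattice τ)) :
    polyIncl τ (SymmetricAlgebra.ι ℤ _ u) = SymmetricAlgebra.ι ℤ _ (dualIncl τ u) := by
  simp [polyIncl]

omit [Module.Finite ℤ N] in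
theorem polyIncl_mem_homogeneous {p : Poly (QuotLattice τ)} {d : ℤ}
    (hp : p ∈ homogeneous (QuotLattice τ) d) : polyIncl τ p ∈ homogeneous N d := by
  by_cases hd : 0 ≤ d
  · lift d to ℕ using hd
    rw [homogeneous_natCast] at hp ⊢
    have h1 := Submodule.mem_map_of_mem (f := (polyIncl τ).toLinearMap) hp
    rw [Submodule.map_pow] at h1
    have h2 : (LinearMap.range (SymmetricAlgebra.ι ℤ (DualLattice (QuotLattice τ)))).map
        (polyIncl τ).toLinearMap ≤ LinearMap.range (SymmetricAlgebra.ι ℤ (DualLattice N)) := by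
      rintro _ ⟨_, ⟨u, rfl⟩, rfl⟩
      exact ⟨dualIncl τ u, (polyIncl_ι τ u).symm⟩
    exact (pow_le_pow_left' h2 d) h1
  · rw [homogeneous, if_neg hd, Submodule.mem_bot] at hp
    rw [hp, map_zero]
    exact zero_mem _

theorem ratIncl_algebraMap (p : Poly (QuotLattice τ)) :
    ratIncl τ (algebraMap _ _ p) = algebraMap _ _ (polyIncl τ p) := by
  simp [ratIncl, IsFractionRing.map]

end Inclusion

/-! ### Cancellation of poles along the walls -/

section Arrangement

variable {N : Type*} [AddCommGroup N] [Module.Finite ℤ N]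

/-- A sum of multiplicities of the cones of a complete fan, weighted by polynomials that agree on
common walls, is a polynomial. Each cone is given by inequalities on `N / (N ∩ Span τ)`. -/
theorem exists_sum_part_mul_eq (τ : PointedCone ℝ (RealSpace N)) {α : Type*} (I : Finset α)
    (L : α → Finset (DualLattice (QuotLattice τ))) (f : α → Poly N) (k : ℤ)
    (hf : ∀ σ ∈ I, f σ ∈ homogeneous N k)
    (hL : ∀ σ ∈ I, ∀ u ∈ L σ, ∃ e, u e = 1)
    (hcover : ∀ y, ∃ σ ∈ I, ∀ u ∈ L σ, 0 ≤ u y)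
    (hdisj : ∀ σ ∈ I, ∀ σ' ∈ I, ∀ y, (∀ u ∈ L σ, 0 < u y) → (∀ u ∈ L σ', 0 < u y) → σ = σ')
    (hglue : ∀ σ ∈ I, ∀ σ' ∈ I, ∀ u : DualLattice (QuotLattice τ), (∃ e, u e = 1) → ∀ z,
      (∀ v ∈ L σ, 0 ≤ v z) → (∀ v ∈ L σ', 0 ≤ v z) →
      (∀ h, u h = 0 → ∃ k : ℕ, (∀ v ∈ L σ, 0 ≤ v (k • z + h)) ∧ ∀ v ∈ L σ', 0 ≤ v (k • z + h)) →
      SymmetricAlgebra.ι ℤ (DualLattice N) (dualIncl τ u) ∣ f σ - f σ') :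
    ∃ p ∈ homogeneous N (k - Module.finrank ℤ (QuotLattice τ)),
      ∑ σ ∈ I, ratIncl τ (part (L σ)) * algebraMap (Poly N) (RatFunc N) (f σ) =
        algebraMap (Poly N) (RatFunc N) p := by
  classical
  have := quotLattice_free τ
  obtain ⟨A, hAI, hIA, hA'⟩ := exists_representatives_up_to_sign (I.biUnion L) (by
    intro u hu
    obtain ⟨σ, hσ, hu⟩ := Finset.mem_biUnion.1 hu
    exact hL σ hσ u hu)
  have hA : ∀ u ∈ A, ∃ e, u e = 1 := by
    intro u hu
    obtain ⟨σ, hσ, hu⟩ := Finset.mem_biUnion.1 (hAI hu)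
    exact hL σ hσ u hu
  have hLA : ∀ σ ∈ I, ∀ u ∈ L σ, u ∈ A ∨ -u ∈ A := fun σ hσ u hu =>
    hIA u (Finset.mem_biUnion.2 ⟨σ, hσ, hu⟩)
  -- `F s` adds the polynomials of all cones whose inequalities occur in the sign pattern `s`. When
  -- the chamber has an interior point there is exactly one such cone; otherwise its part is zero
  -- and `F s` is irrelevant.
  let F : Finset (DualLattice (QuotLattice τ)) → Poly N := fun s =>
    ∑ σ ∈ I with L σ ⊆ signed A s, f σ
  have hF : ∀ s, F s ∈ homogeneous N k := fun s =>
    Submodule.sum_mem _ fun σ hσ => hf σ (Finset.mem_filter.1 hσ).1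
  have hsum : ∑ σ ∈ I, ratIncl τ (part (L σ)) * algebraMap (Poly N) (RatFunc N) (f σ) =
      ∑ s ∈ A.powerset, ratIncl τ (part (signed A s)) * algebraMap (Poly N) (RatFunc N) (F s) := by
    have h1 : ∀ σ ∈ I, ratIncl τ (part (L σ)) * algebraMap (Poly N) (RatFunc N) (f σ) =
        ∑ s ∈ A.powerset, if L σ ⊆ signed A s then
          ratIncl τ (part (signed A s)) * algebraMap (Poly N) (RatFunc N) (f σ) else 0 := by
      intro σ hσ
      rw [part_eq_sum_signed (zero_notMem_of_primitive (hL σ hσ)) hA, map_sum, Finset.sum_mul]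
      refine Finset.sum_congr rfl fun s _ => ?_
      rw [part_union_signed (hL σ hσ) (hLA σ hσ) hA]
      split_ifs <;> simp
    rw [Finset.sum_congr rfl h1, Finset.sum_comm]
    refine Finset.sum_congr rfl fun s _ => ?_
    rw [map_sum, Finset.mul_sum, Finset.sum_filter]
  have hchamber : ∀ s, (∃ y, ∀ v ∈ signed A s, 0 < v y) →
      ∃ σ ∈ I, L σ ⊆ signed A s ∧ F s = f σ := by
    rintro s ⟨y, hy⟩
    obtain ⟨σ, hσ, hσy⟩ := hcover y
    -- The interior point `y` lies in the image of `σ` and on none of the hyperplanes, so it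
    -- determines the sign of every inequality of `σ`.
    have hsub : L σ ⊆ signed A s := by
      intro v hv
      refine (mem_signed_or_neg_mem_signed s (hLA σ hσ v hv)).resolve_right fun h => ?_
      have h1 := hy _ h
      have h2 := hσy v hv
      rw [LinearMap.neg_apply] at h1
      omega
    refine ⟨σ, hσ, hsub, Finset.sum_eq_single_of_mem σ (Finset.mem_filter.2 ⟨hσ, hsub⟩) ?_⟩
    intro σ' hσ' hne
    obtain ⟨hσ', hsub'⟩ := Finset.mem_filter.1 hσ'
    exact absurd (hdisj σ' hσ' σ hσ y (fun u hu => hy u (hsub' hu)) fun u hu => hy u (hsub hu)) hne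
  rw [hsum]
  have hinj := dualIncl_injective τ
  have hprod : ∀ B : Finset (DualLattice (QuotLattice τ)),
      algebraMap (Poly N) (RatFunc N) (∏ u ∈ B.image (dualIncl τ), SymmetricAlgebra.ι ℤ _ u) =
        ratIncl τ (algebraMap _ _ (∏ u ∈ B, SymmetricAlgebra.ι ℤ _ u)) := by
    intro B
    rw [Finset.prod_image fun u _ v _ h => hinj h, ratIncl_algebraMap, map_prod (polyIncl τ)]
    simp only [polyIncl_ι]
  have hcard : (A.image (dualIncl τ)).card = A.card := Finset.card_image_of_injective _ hinj
  refine exists_mem_homogeneous_of_forall_erase (A := A.image (dualIncl τ)) ?_ ?_ ?_ ?_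
  · intro u hu
    obtain ⟨u, hu', rfl⟩ := Finset.mem_image.1 hu
    obtain ⟨e, he⟩ := hA u hu'
    obtain ⟨x, rfl⟩ := quotMap_surjective τ e
    exact ⟨x, he⟩
  · intro u hu v hv h
    obtain ⟨u, hu', rfl⟩ := Finset.mem_image.1 hu
    obtain ⟨v, hv', rfl⟩ := Finset.mem_image.1 hv
    rw [← map_neg] at h
    exact hA' u hu' v hv' (hinj h)
  · choose p hp hpart using fun s => exists_part_signed_mul_prod (s := s) hA hA'
    refine ⟨∑ s ∈ A.powerset, polyIncl τ (p s) * F s, Submodule.sum_mem _ fun s _ => ?_, ?_⟩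
    · have := mul_mem_homogeneous (polyIncl_mem_homogeneous τ (hp s)) (hF s)
      rwa [hcard, show (A.card : ℤ) + (k - Module.finrank ℤ (QuotLattice τ)) =
        A.card - Module.finrank ℤ (QuotLattice τ) + k by ring]
    · rw [hprod, Finset.sum_mul, map_sum]
      refine Finset.sum_congr rfl fun s _ => ?_
      rw [mul_right_comm, ← map_mul (ratIncl τ), hpart, ratIncl_algebraMap, map_mul]
  · intro u hu
    obtain ⟨u, hu', rfl⟩ := Finset.mem_image.1 hu
    rw [← Finset.image_erase hinj, hprod]
    obtain ⟨B, huB, rfl⟩ : ∃ B, u ∉ B ∧ A = insert u B :=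
      ⟨A.erase u, Finset.notMem_erase _ _, (Finset.insert_erase hu').symm⟩
    have hB : ∀ v ∈ B, ∃ e, v e = 1 := fun v hv => hA v (by simp [hv])
    have hB' : ∀ v ∈ B, ∀ w ∈ B, v ≠ -w := fun v hv w hw => hA' v (by simp [hv]) w (by simp [hw])
    have hu1 := hA u (by simp)
    have hu0 : u ≠ 0 := fun h => zero_notMem_of_primitive hA (by simp [← h])
    rw [Finset.erase_insert huB, Finset.sum_powerset_insert huB, ← Finset.sum_add_distrib,
      Finset.sum_mul]
    -- The chambers `s` and `insert u s` lie on opposite sides of `u = 0`; each pair is handled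
    -- separately.
    suffices h : ∀ s ∈ B.powerset, ∃ q,
        (ratIncl τ (part (signed (insert u B) s)) * algebraMap (Poly N) (RatFunc N) (F s) +
          ratIncl τ (part (signed (insert u B) (insert u s))) *
            algebraMap (Poly N) (RatFunc N) (F (insert u s))) *
        ratIncl τ (algebraMap _ _ (∏ v ∈ B, SymmetricAlgebra.ι ℤ _ v)) =
        algebraMap (Poly N) (RatFunc N) q by
      choose! q hq using h
      exact ⟨∑ s ∈ B.powerset, q s, by rw [map_sum]; exact Finset.sum_congr rfl hq⟩
    intro s hs
    have hus : u ∉ s := fun h => huB (Finset.mem_powerset.1 hs h)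
    have hcut := part_insert_add_part_insert_neg (L := signed B s)
      (zero_notMem_of_primitive fun v hv => primitive_of_mem_signed hB hv) hu0
    obtain ⟨p, -, hp⟩ := exists_part_signed_mul_prod (s := s) hB hB'
    have hp' := congrArg (ratIncl τ) hp
    rw [map_mul, ratIncl_algebraMap τ p] at hp'
    have hzero : ∀ t, (¬ ∃ y, ∀ v ∈ signed (insert u B) t, 0 < v y) →
        part (signed (insert u B) t) = 0 := fun t ht =>
      part_eq_zero_of_not_exists
        (zero_notMem_of_primitive fun v hv => primitive_of_mem_signed hA hv) ht
    rw [← signed_insert_insert huB, ← signed_insert_of_notMem hus] at hcut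
    by_cases h1 : ∃ y, ∀ v ∈ signed (insert u B) (insert u s), 0 < v y
    · by_cases h2 : ∃ y, ∀ v ∈ signed (insert u B) s, 0 < v y
      · obtain ⟨σ1, hσ1, hsub1, hF1⟩ := hchamber _ h1
        obtain ⟨σ2, hσ2, hsub2, hF2⟩ := hchamber _ h2
        obtain ⟨y1, hy1⟩ := h1
        obtain ⟨y2, hy2⟩ := h2
        rw [signed_insert_insert huB] at hy1 hsub1
        rw [signed_insert_of_notMem hus] at hy2 hsub2
        simp only [Finset.forall_mem_insert, LinearMap.neg_apply] at hy1 hy2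
        -- The combination of interior points of the two chambers that lies on `u = 0` is interior
        -- to their common wall.
        have hz : ∀ v ∈ signed B s, 0 < v ((-u y2) • y1 + u y1 • y2) := by
          intro v hv
          rw [map_add, map_smul, map_smul, smul_eq_mul, smul_eq_mul]
          exact add_pos (mul_pos hy2.1 (hy1.2 v hv)) (mul_pos hy1.1 (hy2.2 v hv))
        have huz : u ((-u y2) • y1 + u y1 • y2) = 0 := by
          rw [map_add, map_smul, map_smul, smul_eq_mul, smul_eq_mul]
          ring
        set z := (-u y2) • y1 + u y1 • y2
        have hwall : ∀ y, u y = 0 → (∀ v ∈ signed B s, 0 ≤ v y) →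
            (∀ v ∈ L σ1, 0 ≤ v y) ∧ ∀ v ∈ L σ2, 0 ≤ v y := by
          refine fun y hu hy => ⟨fun v hv => ?_, fun v hv => ?_⟩
          · rcases Finset.mem_insert.1 (hsub1 hv) with rfl | hv
            exacts [hu.ge, hy v hv]
          · rcases Finset.mem_insert.1 (hsub2 hv) with rfl | hv
            exacts [by simp [hu], hy v hv]
        obtain ⟨q, hq⟩ := hglue σ1 hσ1 σ2 hσ2 u hu1 z (hwall z huz fun v hv => (hz v hv).le).1
          (hwall z huz fun v hv => (hz v hv).le).2 (fun h hh => by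
            -- Each `v` is at least `1` at `z`, so this multiple of `z` outweighs `v h`.
            refine ⟨∑ v ∈ signed B s, (v h).natAbs, hwall _ (by simp [huz, hh]) fun v hv => ?_⟩
            have h3 : (v h).natAbs ≤ ∑ v ∈ signed B s, (v h).natAbs :=
              Finset.single_le_sum (f := fun v => (v h).natAbs) (fun _ _ => Nat.zero_le _) hv
            rw [map_add, map_nsmul, nsmul_eq_mul]
            generalize ∑ v ∈ signed B s, (v h).natAbs = n at h3
            have h4 := hz v hv
            have h5 : (n : ℤ) * 1 ≤ n * v z := by
              apply mul_le_mul_of_nonneg_left <;> omega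
            omega)
        obtain ⟨p', -, hp2⟩ := exists_part_signed_mul_prod (s := insert u s) hA hA'
        have hp2' := congrArg (ratIncl τ) hp2
        rw [map_mul, ratIncl_algebraMap τ p', Finset.prod_insert huB, map_mul (algebraMap _ _),
          map_mul (ratIncl τ), ratIncl_algebraMap τ (SymmetricAlgebra.ι ℤ _ u), polyIncl_ι] at hp2'
        -- Write `c₁ f₁ + c₂ f₂ = (c₁ + c₂) f₂ + c₁ (f₁ - f₂)`: the sum `c₁ + c₂` has no pole along
        -- `u`, and `f₁ - f₂ = u q` cancels that of `c₁`.
        refine ⟨polyIncl τ p * f σ2 + polyIncl τ p' * q, ?_⟩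
        have hq' := congrArg (algebraMap (Poly N) (RatFunc N)) hq
        rw [map_sub, map_mul] at hq'
        rw [hF1, hF2, map_add, map_mul, map_mul, ← hp', ← hp2', ← hcut, map_add (ratIncl τ)]
        linear_combination (ratIncl τ (part (signed (insert u B) (insert u s))) *
          ratIncl τ (algebraMap _ _ (∏ v ∈ B, SymmetricAlgebra.ι ℤ _ v))) * hq'
      -- If one side has no interior, its part is zero and the other side already has the part
      -- without `u`.
      · refine ⟨polyIncl τ p * F (insert u s), ?_⟩
        rw [hzero _ h2, add_zero] at hcut
        rw [hzero _ h2, hcut, map_zero, zero_mul, zero_add, mul_right_comm, hp', map_mul]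
    · refine ⟨polyIncl τ p * F s, ?_⟩
      rw [hzero _ h1, zero_add] at hcut
      rw [hzero _ h1, hcut, map_zero, zero_mul, add_zero, mul_right_comm, hp', map_mul]

end Arrangement

/-! ### Real and integral evaluation -/

section Pairing

variable {N : Type*} [AddCommGroup N]

theorem pairing_tmul (r : ℝ) (a : N) (u : DualLattice N) : pairing (r ⊗ₜ[ℤ] a) u = r * u a := by
  simp [pairing, mul_comm]

theorem pairing_latticeMap (x : N) (u : DualLattice N) : pairing (latticeMap N x) u = u x := by
  change pairing ((1 : ℝ) ⊗ₜ[ℤ] x) u = _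
  rw [pairing_tmul, one_mul]

theorem pairing_add (v w : RealSpace N) (u : DualLattice N) :
    pairing (v + w) u = pairing v u + pairing w u := by
  simp [pairing]

theorem pairing_smul (r : ℝ) (v : RealSpace N) (u : DualLattice N) :
    pairing (r • v) u = r * pairing v u := by
  induction v using TensorProduct.induction_on with
  | zero => simp [pairing]
  | tmul s a => rw [TensorProduct.smul_tmul', pairing_tmul, pairing_tmul, smul_eq_mul, mul_assoc]
  | add v w hv hw => rw [smul_add, pairing_add, pairing_add, hv, hw, mul_add]

/-- The pairing of `N_ℝ` with `u ∈ M`, as a linear function on `N_ℝ`. -/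
def pairingLeft (u : DualLattice N) : RealSpace N →ₗ[ℝ] ℝ where
  toFun v := pairing v u
  map_add' v w := pairing_add v w u
  map_smul' r v := pairing_smul r v u

theorem evalAt_latticeMap (x : N) (p : Poly N) : evalAt (latticeMap N x) p = (evalInt x p : ℝ) := by
  have h : evalAt (latticeMap N x) = (Algebra.ofId ℤ ℝ).comp (evalInt x) := by
    refine SymmetricAlgebra.algHom_ext (LinearMap.ext fun u => ?_)
    change evalAt (latticeMap N x) (SymmetricAlgebra.ι ℤ (DualLattice N) u) =
      ((evalInt x (SymmetricAlgebra.ι ℤ (DualLattice N) u) : ℤ) : ℝ)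
    rw [evalInt_ι, evalAt, SymmetricAlgebra.lift_ι_apply, pairing_latticeMap]
  rw [h]
  rfl

end Pairing

/-! ### Lattice points of rational cones -/

section Cones

variable {N : Type*} [AddCommGroup N]

theorem smul_mem_cone {σ : PointedCone ℝ (RealSpace N)} {r : ℝ} (hr : 0 ≤ r) {v : RealSpace N}
    (hv : v ∈ σ) : r • v ∈ σ :=
  σ.smul_mem hr hv

/-- The lattice points of a cone. -/
def conePoints (σ : PointedCone ℝ (RealSpace N)) : AddSubmonoid N :=
  σ.toAddSubmonoid.comap (latticeMap N)

theorem mem_conePoints {σ : PointedCone ℝ (RealSpace N)} {x : N} :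
    x ∈ conePoints σ ↔ latticeMap N x ∈ σ := Iff.rfl

theorem mem_conePoints_of_nsmul_mem {σ : PointedCone ℝ (RealSpace N)} {x : N} {m : ℕ} (hm : 0 < m)
    (h : m • x ∈ conePoints σ) : x ∈ conePoints σ := by
  rw [mem_conePoints, map_nsmul] at h
  have h1 := smul_mem_cone (r := (m : ℝ)⁻¹) (by positivity) h
  rwa [← Nat.cast_smul_eq_nsmul ℝ, smul_smul, inv_mul_cancel₀ (by positivity), one_smul] at h1

theorem conePoints_mono {σ σ' : PointedCone ℝ (RealSpace N)} (h : σ ≤ σ') :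
    conePoints σ ≤ conePoints σ' := fun _ hx => h hx

theorem closure_le_conePoints_hull (S : Set N) :
    AddSubmonoid.closure S ≤ conePoints (PointedCone.hull ℝ (latticeMap N '' S)) :=
  (AddSubmonoid.closure_le).2 fun s hs => PointedCone.subset_hull ⟨s, hs, rfl⟩

theorem pairing_nonneg_of_mem_hull {S : Set N} {u : DualLattice N} (hu : ∀ s ∈ S, 0 ≤ u s)
    {v : RealSpace N} (hv : v ∈ PointedCone.hull ℝ (latticeMap N '' S)) : 0 ≤ pairing v u := by
  induction hv using Submodule.span_induction with
  | mem v hv =>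
    obtain ⟨s, hs, rfl⟩ := hv
    rw [pairing_latticeMap]
    exact_mod_cast hu s hs
  | zero => simp [pairing]
  | add v w _ _ hv hw =>
    rw [pairing_add]
    exact add_nonneg hv hw
  | smul r v _ hv =>
    change 0 ≤ pairing ((r : ℝ) • v) u
    rw [pairing_smul]
    exact mul_nonneg r.2 hv

theorem mem_dualPoints_hull {S : Set N} {u : DualLattice N} :
    u ∈ dualPoints (PointedCone.hull ℝ (latticeMap N '' S)) ↔ ∀ s ∈ S, 0 ≤ u s := by
  refine ⟨fun h s hs => ?_, fun h v hv => pairing_nonneg_of_mem_hull h hv⟩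
  have := h _ (PointedCone.subset_hull ⟨s, hs, rfl⟩)
  rw [pairing_latticeMap] at this
  exact_mod_cast this

theorem IsFaceOf.mem_conePoints_left {F σ : PointedCone ℝ (RealSpace N)} (hF : F.IsFaceOf σ) {x y : N}
    (hx : x ∈ conePoints σ) (hy : y ∈ conePoints σ) (hxy : x + y ∈ conePoints F) :
    x ∈ conePoints F := by
  rw [mem_conePoints, map_add] at hxy
  exact hF.mem_of_add_mem_left hx hy hxy

theorem nonneg_of_mem_closure {S : Set N} {u : DualLattice N} (hu : ∀ s ∈ S, 0 ≤ u s) {x : N}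
    (hx : x ∈ AddSubmonoid.closure S) : 0 ≤ u x := by
  induction hx using AddSubmonoid.closure_induction with
  | mem s hs => exact hu s hs
  | zero => simp
  | add x y _ _ hx hy => simpa using add_nonneg hx hy

/-- A nonzero functional is a positive multiple of a primitive one. -/
theorem exists_primitive {u : DualLattice N} (hu : u ≠ 0) :
    ∃ v : DualLattice N, (∃ e, v e = 1) ∧ ∀ y, 0 ≤ v y ↔ 0 ≤ u y := by
  obtain ⟨d, hd⟩ := (IsPrincipalIdealRing.principal (LinearMap.range u)).principal
  have hd' : ∀ x, d ∣ u x := fun x => by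
    have : u x ∈ Submodule.span ℤ {d} := hd ▸ ⟨x, rfl⟩
    exact Ideal.mem_span_singleton.1 this
  have hdn : d ≠ 0 := by
    rintro rfl
    exact hu (LinearMap.ext fun x => zero_dvd_iff.1 (hd' x))
  obtain ⟨e, he⟩ : ∃ e, u e = |d| := by
    have : |d| ∈ LinearMap.range u := by
      rw [hd]
      exact Ideal.mem_span_singleton.2 ((dvd_abs d d).2 dvd_rfl)
    exact this
  have hpos : 0 < |d| := abs_pos.2 hdn
  choose c hc using fun x => (abs_dvd d (u x)).2 (hd' x)
  refine ⟨{ toFun := c, map_add' := fun x y => ?_, map_smul' := fun r x => ?_ }, ⟨e, ?_⟩, fun y => ?_⟩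
  · apply mul_left_cancel₀ hpos.ne'
    rw [← hc, map_add, hc x, hc y, mul_add]
  · apply mul_left_cancel₀ hpos.ne'
    rw [← hc, map_smul, hc x, RingHom.id_apply, smul_eq_mul, smul_eq_mul, mul_left_comm]
  · change c e = 1
    apply mul_left_cancel₀ hpos.ne'
    rw [← hc, he, mul_one]
  · change 0 ≤ c y ↔ _
    rw [hc y, mul_nonneg_iff_of_pos_left hpos]

variable [Module.Free ℤ N] [Module.Finite ℤ N]

theorem exists_primitive_description (S : Finset N) :
    ∃ A : Finset (DualLattice N), (∀ u ∈ A, ∃ e, u e = 1) ∧ ∀ x, (∀ u ∈ A, 0 ≤ u x) ↔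
      ∃ m : ℕ, 0 < m ∧ m • x ∈ AddSubmonoid.closure (S : Set N) := by
  classical
  obtain ⟨A, hA⟩ := exists_dual_description S
  choose! v hv1 hv2 using fun (u : DualLattice N) (hu : u ≠ 0) => exists_primitive hu
  refine ⟨(A.filter (· ≠ 0)).image v, fun w hw => ?_, fun x => ?_⟩
  · obtain ⟨u, hu, rfl⟩ := Finset.mem_image.1 hw
    exact hv1 u (Finset.mem_filter.1 hu).2
  · rw [← hA]
    simp only [Finset.forall_mem_image, Finset.mem_filter, and_imp]
    refine forall₂_congr fun u hu => ?_
    by_cases h0 : u = 0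
    · simp [h0]
    · rw [forall_prop_of_true h0, hv2 u h0]

omit [Module.Free ℤ N] [Module.Finite ℤ N] in
theorem mem_conePoints_hull_iff {S : Finset N} {A : Finset (DualLattice N)}
    (hA : ∀ x, (∀ u ∈ A, 0 ≤ u x) ↔ ∃ m : ℕ, 0 < m ∧ m • x ∈ AddSubmonoid.closure (S : Set N))
    {x : N} : x ∈ conePoints (PointedCone.hull ℝ (latticeMap N '' (S : Set N))) ↔
      ∀ u ∈ A, 0 ≤ u x := by
  constructor
  · intro h u hu
    have h1 := pairing_nonneg_of_mem_hull (u := u) (fun s hs =>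
      (hA s).2 ⟨1, one_pos, by simpa using AddSubmonoid.subset_closure hs⟩ u hu) h
    rw [pairing_latticeMap] at h1
    exact_mod_cast h1
  · intro h
    obtain ⟨m, hm, hx⟩ := (hA x).1 h
    exact mem_conePoints_of_nsmul_mem hm (closure_le_conePoints_hull _ hx)

/-- The integral inequalities of the generated monoid also hold on the real hull, so real
coefficients give no new lattice points up to multiples. -/
theorem exists_nsmul_mem_closure_of_mem_conePoints {S : Finset N} {x : N}
    (hx : x ∈ conePoints (PointedCone.hull ℝ (latticeMap N '' (S : Set N)))) :
    ∃ m : ℕ, 0 < m ∧ m • x ∈ AddSubmonoid.closure (S : Set N) := by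
  obtain ⟨A, -, hA⟩ := exists_primitive_description S
  exact (hA x).1 ((mem_conePoints_hull_iff hA).1 hx)

end Cones

/-! ### The quotient by the span of a cone -/

section Quotient

variable {N : Type*} [AddCommGroup N]

theorem quotMap_eq_zero_iff {τ : PointedCone ℝ (RealSpace N)} {x : N} :
    quotMap τ x = 0 ↔ latticeMap N x ∈ Submodule.span ℝ (τ : Set (RealSpace N)) :=
  QuotientAddGroup.eq_zero_iff (N := spanLattice τ) x

theorem quotMap_of_mem {τ : PointedCone ℝ (RealSpace N)} {x : N} (hx : x ∈ conePoints τ) :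
    quotMap τ x = 0 :=
  quotMap_eq_zero_iff.2 (Submodule.subset_span hx)

theorem coneImage_hull (τ : PointedCone ℝ (RealSpace N)) (S : Set N) :
    coneImage (PointedCone.hull ℝ (latticeMap N '' S)) τ =
      PointedCone.hull ℝ (latticeMap (QuotLattice τ) '' (quotMap τ '' S)) := by
  rw [coneImage, PointedCone.map, Submodule.map_span]
  congr 1
  rw [Set.image_image, Set.image_image]
  refine Set.image_congr fun s _ => ?_
  change (quotMap τ).baseChange ℝ ((1 : ℝ) ⊗ₜ[ℤ] s) = (1 : ℝ) ⊗ₜ[ℤ] quotMap τ s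
  rw [LinearMap.baseChange_tmul]

variable [Module.Free ℤ N] [Module.Finite ℤ N]

/-- A lattice point in the span of a cone is a difference of lattice points of the cone. -/
theorem exists_add_mem_conePoints {τ : PointedCone ℝ (RealSpace N)} {S : Finset N}
    (hS : τ = PointedCone.hull ℝ (latticeMap N '' (S : Set N))) {t : N} (ht : quotMap τ t = 0) :
    ∃ a ∈ conePoints τ, t + a ∈ conePoints τ := by
  obtain ⟨A, -, hA⟩ := exists_primitive_description S
  have hmem : ∀ x, x ∈ conePoints τ ↔ ∀ u ∈ A, 0 ≤ u x := fun x => by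
    rw [hS]
    exact mem_conePoints_hull_iff hA
  have hsS : ∀ s ∈ S, s ∈ conePoints τ := fun s hs => by
    rw [hS]
    exact closure_le_conePoints_hull _ (AddSubmonoid.subset_closure hs)
  have hw : ∑ s ∈ S, s ∈ conePoints τ := sum_mem hsS
  -- The sum of the generators is interior relative to the span: an inequality vanishing at it
  -- vanishes on the whole span, hence at `t`, and any other is at least `1` there and dominates `u
  -- t` after scaling.
  refine ⟨(∑ u ∈ A, (u t).natAbs) • ∑ s ∈ S, s, nsmul_mem hw _, (hmem _).2 fun u hu => ?_⟩
  have hle : (u t).natAbs ≤ ∑ u ∈ A, (u t).natAbs :=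
    Finset.single_le_sum (f := fun u : DualLattice N => (u t).natAbs) (fun _ _ => Nat.zero_le _) hu
  generalize ∑ u ∈ A, (u t).natAbs = n at hle
  rw [map_add, map_nsmul, nsmul_eq_mul]
  rcases ((hmem _).1 hw u hu).eq_or_lt with h | h
  · rw [map_sum, eq_comm, Finset.sum_eq_zero_iff_of_nonneg fun s hs => (hmem s).1 (hsS s hs) u hu] at h
    have h1 : Submodule.span ℝ (τ : Set (RealSpace N)) ≤ LinearMap.ker (pairingLeft u) := by
      rw [Submodule.span_le]
      intro v hv
      have h2 : 0 ≤ pairing v u := by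
        rw [hS] at hv
        exact pairing_nonneg_of_mem_hull (fun s hs => (h s hs).ge) hv
      have h3 : 0 ≤ pairing v (-u) := by
        rw [hS] at hv
        exact pairing_nonneg_of_mem_hull (fun s hs => by simp [h s hs]) hv
      rw [map_neg] at h3
      have h4 : pairing v u ≤ 0 := by linarith
      exact le_antisymm h4 h2
    have h2 : pairing (latticeMap N t) u = 0 := h1 (quotMap_eq_zero_iff.1 ht)
    rw [pairing_latticeMap, Int.cast_eq_zero] at h2
    rw [h2, map_sum, Finset.sum_eq_zero h]
    simp
  · have : (n : ℤ) * 1 ≤ n * u (∑ s ∈ S, s) := by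
      apply mul_le_mul_of_nonneg_left <;> omega
    omega

/-- Rank-nullity for the real projection, whose kernel is exactly the span of `τ` because the
generators of `τ` are lattice points. -/
theorem coneDim_add_finrank {τ : PointedCone ℝ (RealSpace N)} {S : Set N}
    (hS : τ = PointedCone.hull ℝ (latticeMap N '' S)) :
    coneDim τ + Module.finrank ℤ (QuotLattice τ) = Module.finrank ℤ N := by
  have := quotLattice_free τ
  have hker : LinearMap.ker ((quotMap τ).baseChange ℝ) =
      Submodule.span ℝ (τ : Set (RealSpace N)) := by
    apply le_antisymm
    · intro v hv
      obtain ⟨w, rfl⟩ := (lTensor_exact ℝ (LinearMap.exact_subtype_ker_map (quotMap τ))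
        (quotMap_surjective τ) v).1 hv
      induction w using TensorProduct.induction_on with
      | zero => simp
      | tmul r t =>
        have h := Submodule.smul_mem _ r (quotMap_eq_zero_iff.1 t.2)
        change r • ((1 : ℝ) ⊗ₜ[ℤ] (t : N)) ∈ _ at h
        rwa [TensorProduct.smul_tmul', smul_eq_mul, mul_one] at h
      | add x y hx hy =>
        have hmem (z) : LinearMap.lTensor ℝ (LinearMap.ker (quotMap τ)).subtype z ∈
            LinearMap.ker ((quotMap τ).baseChange ℝ) :=
          (lTensor_exact ℝ (LinearMap.exact_subtype_ker_map (quotMap τ))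
            (quotMap_surjective τ) _).2 ⟨z, rfl⟩
        rw [map_add]
        exact add_mem (hx (hmem x)) (hy (hmem y))
    · rw [Submodule.span_le]
      intro v hv
      have hv' : v ∈ PointedCone.hull ℝ (latticeMap N '' S) := hS ▸ hv
      clear hv
      induction hv' using Submodule.span_induction with
      | mem v hv =>
        obtain ⟨s, hs, rfl⟩ := hv
        have h0 : quotMap τ s = 0 := quotMap_of_mem (by
          rw [hS]
          exact closure_le_conePoints_hull _ (AddSubmonoid.subset_closure hs))
        change (quotMap τ).baseChange ℝ ((1 : ℝ) ⊗ₜ[ℤ] s) = 0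
        rw [LinearMap.baseChange_tmul, h0, TensorProduct.tmul_zero]
      | zero => exact zero_mem _
      | add v w _ _ hv hw => exact add_mem hv hw
      | smul r v _ hv => exact Submodule.smul_mem _ (r : ℝ) hv
  have hsurj : Function.Surjective ((quotMap τ).baseChange ℝ) :=
    LinearMap.lTensor_surjective ℝ (quotMap_surjective τ)
  have h1 := LinearMap.finrank_range_add_finrank_ker ((quotMap τ).baseChange ℝ)
  rw [hker, LinearMap.range_eq_top.2 hsurj, finrank_top, Module.finrank_baseChange,
    Module.finrank_baseChange, add_comm] at h1
  exact h1

end Quotient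

/-! ### Inequalities for the images of cones -/

section CutsOut

variable {N : Type*} [AddCommGroup N]

/-- The functionals in `L` on `N / (N ∩ Span τ)` cut out the image of the cone `σ`. -/
def CutsOut (τ σ : PointedCone ℝ (RealSpace N)) (L : Finset (DualLattice (QuotLattice τ))) : Prop :=
  ∀ y, (∀ u ∈ L, 0 ≤ u y) ↔ ∃ m : ℕ, 0 < m ∧ ∃ x ∈ conePoints σ, quotMap τ x = m • y

theorem CutsOut.nonneg {τ σ : PointedCone ℝ (RealSpace N)} {L : Finset (DualLattice (QuotLattice τ))}
    (hL : CutsOut τ σ L) {x : N} (hx : x ∈ conePoints σ) : ∀ u ∈ L, 0 ≤ u (quotMap τ x) :=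
  (hL _).2 ⟨1, one_pos, x, hx, (one_nsmul _).symm⟩

variable [Module.Free ℤ N] [Module.Finite ℤ N]

theorem exists_cutsOut (τ : PointedCone ℝ (RealSpace N)) {σ : PointedCone ℝ (RealSpace N)}
    {S : Finset N} (hS : σ = PointedCone.hull ℝ (latticeMap N '' (S : Set N))) :
    ∃ L : Finset (DualLattice (QuotLattice τ)), (∀ u ∈ L, ∃ e, u e = 1) ∧ CutsOut τ σ L ∧
      dualPoints (coneImage σ τ) = dualSet L := by
  classical
  have := quotLattice_free τ
  obtain ⟨L, hL, hLS⟩ := exists_primitive_description (S.image (quotMap τ))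
  have hcl : AddSubmonoid.closure ((S.image (quotMap τ) : Finset _) : Set (QuotLattice τ)) =
      (AddSubmonoid.closure (S : Set N)).map (quotMap τ).toAddMonoidHom := by
    rw [AddMonoidHom.map_mclosure, Finset.coe_image]
    rfl
  refine ⟨L, hL, fun y => ?_, ?_⟩
  · rw [hLS, hcl]
    constructor
    · rintro ⟨m, hm, x, hx, hxy⟩
      exact ⟨m, hm, x, hS ▸ closure_le_conePoints_hull _ hx, hxy⟩
    · rintro ⟨m, hm, x, hx, hxy⟩
      rw [hS] at hx
      obtain ⟨k, hk, hkx⟩ := exists_nsmul_mem_closure_of_mem_conePoints hx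
      refine ⟨k * m, mul_pos hk hm, _, hkx, ?_⟩
      rw [mul_nsmul', ← hxy]
      exact map_nsmul (quotMap τ) k x
  · ext u
    rw [hS, coneImage_hull, mem_dualPoints_hull]
    constructor
    · intro h y hy
      obtain ⟨m, hm, hmy⟩ := (hLS y).1 hy
      rw [Finset.coe_image] at hmy
      have := nonneg_of_mem_closure h hmy
      rw [map_nsmul, nsmul_eq_mul] at this
      exact nonneg_of_mul_nonneg_right this (by exact_mod_cast hm)
    · rintro h _ ⟨s, hs, rfl⟩
      refine h _ ((hLS _).2 ⟨1, one_pos, ?_⟩)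
      rw [one_nsmul, Finset.coe_image]
      exact AddSubmonoid.subset_closure ⟨s, hs, rfl⟩

/-- Lattice points of two cones containing `τ` with proportional images modulo the span of `τ` can
be replaced by a common one. -/
theorem exists_common_lift {τ σ σ' : PointedCone ℝ (RealSpace N)} {S : Finset N}
    (hS : τ = PointedCone.hull ℝ (latticeMap N '' (S : Set N))) (hσ : τ ≤ σ) (hσ' : τ ≤ σ')
    {L : Finset (DualLattice (QuotLattice τ))} {L' : Finset (DualLattice (QuotLattice τ))}
    (hL : CutsOut τ σ L) (hL' : CutsOut τ σ' L') {y : QuotLattice τ} (hy : ∀ u ∈ L, 0 ≤ u y)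
    (hy' : ∀ u ∈ L', 0 ≤ u y) :
    ∃ m : ℕ, 0 < m ∧ ∃ x ∈ conePoints σ ⊓ conePoints σ', quotMap τ x = m • y := by
  obtain ⟨m, hm, x, hx, hxy⟩ := (hL y).1 hy
  obtain ⟨m', hm', x', hx', hxy'⟩ := (hL' y).1 hy'
  -- The two lifts, scaled to the same image, differ by an element of the span of `τ`, which points
  -- of `τ` absorb in both cones.
  obtain ⟨a, ha, hta⟩ := exists_add_mem_conePoints hS (t := m' • x - m • x') (by
    rw [map_sub, map_nsmul, map_nsmul, hxy, hxy', nsmul_left_comm, sub_self])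
  refine ⟨m' * m, mul_pos hm' hm, m' • x + a, ⟨?_, ?_⟩, ?_⟩
  · exact add_mem (nsmul_mem hx _) (conePoints_mono hσ ha)
  · rw [show m' • x + a = m • x' + (m' • x - m • x' + a) by abel]
    exact add_mem (nsmul_mem hx' _) (conePoints_mono hσ' hta)
  · rw [map_add, quotMap_of_mem ha, add_zero, map_nsmul, hxy, mul_nsmul']

/-- The image of a cone modulo a face is strongly convex. -/
theorem CutsOut.eq_zero_of_forall_eq_zero {τ σ : PointedCone ℝ (RealSpace N)} {S : Finset N}
    (hS : τ = PointedCone.hull ℝ (latticeMap N '' (S : Set N))) (hF : τ.IsFaceOf σ)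
    {L : Finset (DualLattice (QuotLattice τ))} (hL : CutsOut τ σ L) {y : QuotLattice τ}
    (hy : ∀ u ∈ L, u y = 0) : y = 0 := by
  have := quotLattice_free τ
  obtain ⟨m, hm, x, hx, hxy⟩ := (hL y).1 fun u hu => (hy u hu).ge
  obtain ⟨m', hm', x', hx', hxy'⟩ := (hL (-y)).1 fun u hu => by simp [hy u hu]
  obtain ⟨a, ha, hta⟩ := exists_add_mem_conePoints hS (t := m' • x + m • x') (by
    rw [map_add, map_nsmul, map_nsmul, hxy, hxy', nsmul_left_comm, smul_neg, smul_neg,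
      add_neg_cancel])
  rw [add_assoc] at hta
  -- Lifts of `y` and `-y` add up, after a correction from `τ`, to a point of the face `τ`; hence
  -- the lift of `y` already lies in `τ`.
  have h := quotMap_of_mem (IsFaceOf.mem_conePoints_left hF (nsmul_mem hx m')
    (add_mem (nsmul_mem hx' m) (conePoints_mono hF.le ha)) hta)
  rw [map_nsmul, hxy, ← mul_nsmul', ← natCast_zsmul] at h
  exact (smul_eq_zero.1 h).resolve_left (by exact_mod_cast (mul_pos hm' hm).ne')

end CutsOut

/-! ### Images of the maximal cones: covering and disjoint interiors -/

section Fan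

variable {N : Type*} [AddCommGroup N]

theorem Fan.mem_maximalConesOver {Δ : Fan N} {τ σ : PointedCone ℝ (RealSpace N)} :
    σ ∈ Δ.maximalConesOver τ ↔ (σ ∈ Δ.cones ∧ Maximal (· ∈ Δ.cones) σ) ∧ τ ≤ σ := by
  classical
  simp [Fan.maximalConesOver, Fan.maximalCones]

theorem Fan.isFaceOf {Δ : Fan N} {τ σ : PointedCone ℝ (RealSpace N)} (hτ : τ ∈ Δ.cones)
    (hσ : σ ∈ Δ.cones) (h : τ ≤ σ) : τ.IsFaceOf σ := by
  have := (Δ.inter_face σ hσ τ hτ).1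
  rwa [inf_eq_right.2 h] at this

theorem hull_le_of_subset_conePoints {S : Set N} {σ : PointedCone ℝ (RealSpace N)}
    (h : ∀ s ∈ S, s ∈ conePoints σ) : PointedCone.hull ℝ (latticeMap N '' S) ≤ σ :=
  Submodule.span_le.2 (by
    rintro _ ⟨s, hs, rfl⟩
    exact h s hs)

variable [Module.Free ℤ N] [Module.Finite ℤ N]

/-- The images of the maximal cones containing `τ` cover the quotient lattice. -/
theorem Fan.exists_forall_nonneg {Δ : Fan N} (hΔ : Δ.IsComplete) {τ : PointedCone ℝ (RealSpace N)}
    (hτ : τ ∈ Δ.cones) {L : PointedCone ℝ (RealSpace N) → Finset (DualLattice (QuotLattice τ))}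
    (hL : ∀ σ ∈ Δ.cones, CutsOut τ σ (L σ)) (y : QuotLattice τ) :
    ∃ σ ∈ Δ.maximalConesOver τ, ∀ u ∈ L σ, 0 ≤ u y := by
  obtain ⟨x, rfl⟩ := quotMap_surjective τ y
  obtain ⟨T, hT⟩ := Δ.rational τ hτ
  have hTτ : ∀ s ∈ T, s ∈ conePoints τ := fun s hs => by
    rw [hT]
    exact closure_le_conePoints_hull _ (AddSubmonoid.subset_closure hs)
  set w := ∑ s ∈ T, s with hw
  have hwτ : w ∈ conePoints τ := sum_mem hTτ
  -- Push `x` towards the relative interior of `τ`. Some cone contains `x + k • w` for infinitely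
  -- many `k`, hence also `w`.
  have hcov : ∀ k : ℕ, ∃ σ : Δ.cones, x + k • w ∈ conePoints σ.1 := fun k => by
    have h : latticeMap N (x + k • w) ∈ Δ.support := by
      rw [hΔ]
      trivial
    obtain ⟨σ, hσ, h⟩ := h
    exact ⟨⟨σ, hσ⟩, h⟩
  choose g hg using hcov
  obtain ⟨⟨σ, hσ⟩, hinf⟩ := Finite.exists_infinite_fiber g
  have hinf' : (g ⁻¹' {⟨σ, hσ⟩}).Infinite := Set.infinite_coe_iff.1 hinf
  have hmem : ∀ k ∈ g ⁻¹' {⟨σ, hσ⟩}, x + k • w ∈ conePoints σ := fun k hk => by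
    have := hg k
    rwa [show g k = ⟨σ, hσ⟩ from hk] at this
  obtain ⟨S, hS⟩ := Δ.rational σ hσ
  have hwσ : w ∈ conePoints σ := by
    obtain ⟨A, -, hA⟩ := exists_primitive_description S
    rw [hS, mem_conePoints_hull_iff hA]
    intro u hu
    by_contra! hneg
    obtain ⟨k, hk, hlt⟩ := hinf'.exists_gt (u x).natAbs
    have h1 := hmem k hk
    rw [hS, mem_conePoints_hull_iff hA] at h1
    have h2 := h1 u hu
    rw [map_add, map_nsmul, nsmul_eq_mul] at h2
    have h3 : (k : ℤ) * u w ≤ k * (-1) := mul_le_mul_of_nonneg_left (by omega) (by omega)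
    omega
  -- The face `σ ⊓ τ` of `τ` contains the sum of the generators of `τ`, so it contains each
  -- generator.
  have hτσ : τ ≤ σ := by
    have hF := (Δ.inter_face σ hσ τ hτ).2
    rw [hT]
    refine hull_le_of_subset_conePoints fun s hs => ?_
    have h1 : w ∈ conePoints (σ ⊓ τ) := ⟨hwσ, hwτ⟩
    classical
    rw [hw, ← Finset.add_sum_erase T (fun s => s) hs] at h1
    exact (IsFaceOf.mem_conePoints_left hF (hTτ s hs)
      (sum_mem fun t ht => hTτ t (Finset.mem_of_mem_erase ht)) h1).1
  obtain ⟨σ', hle, hmax⟩ := Δ.cones.exists_le_maximal hσ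
  obtain ⟨k, hk⟩ := hinf'.nonempty
  refine ⟨σ', Fan.mem_maximalConesOver.2 ⟨⟨hmax.1, hmax⟩, hτσ.trans hle⟩, ?_⟩
  have h := (hL σ' hmax.1).nonneg (conePoints_mono hle (hmem k hk))
  rwa [map_add, map_nsmul, quotMap_of_mem hwτ, smul_zero, add_zero] at h

/-- If the images of two cones containing `τ` have a common interior lattice point, then the first
is contained in the second. -/
theorem Fan.le_of_forall_pos {Δ : Fan N} {τ σ σ' : PointedCone ℝ (RealSpace N)} (hτ : τ ∈ Δ.cones)
    (hσ : σ ∈ Δ.cones) (hσ' : σ' ∈ Δ.cones) (hτσ : τ ≤ σ) (hτσ' : τ ≤ σ')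
    {L L' : Finset (DualLattice (QuotLattice τ))} (hL : CutsOut τ σ L) (hL' : CutsOut τ σ' L')
    {y : QuotLattice τ} (hy : ∀ u ∈ L, 0 < u y) (hy' : ∀ u ∈ L', 0 < u y) : σ ≤ σ' := by
  classical
  obtain ⟨T, hT⟩ := Δ.rational τ hτ
  obtain ⟨S, hS⟩ := Δ.rational σ hσ
  have hSσ : ∀ s ∈ S, s ∈ conePoints σ := fun s hs => by
    rw [hS]
    exact closure_le_conePoints_hull _ (AddSubmonoid.subset_closure hs)
  rw [hS]
  refine hull_le_of_subset_conePoints fun s hs => ?_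
  -- For large `k`, `k • y` minus the image of `s` lies in both images. Thus a multiple of `s` plus
  -- a point of `σ` lies in the face `σ ⊓ σ'`, which forces `s` into `σ'`.
  obtain ⟨k, hk⟩ : ∃ k : ℕ, ∀ u ∈ L ∪ L', u (quotMap τ s) ≤ k :=
    ⟨∑ u ∈ L ∪ L', (u (quotMap τ s)).natAbs, fun u hu => by
      have := Finset.single_le_sum (f := fun u : DualLattice (QuotLattice τ) =>
        (u (quotMap τ s)).natAbs) (fun _ _ => Nat.zero_le _) hu
      omega⟩
  have hpos : ∀ u ∈ L ∪ L', 0 ≤ u (k • y - quotMap τ s) := fun u hu => by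
    have h1 := hk u hu
    have h2 : 0 < u y := by
      rcases Finset.mem_union.1 hu with h | h
      exacts [hy u h, hy' u h]
    have h3 : (k : ℤ) * 1 ≤ k * u y := mul_le_mul_of_nonneg_left (by omega) (by omega)
    rw [map_sub, map_nsmul, nsmul_eq_mul]
    omega
  obtain ⟨m₁, hm₁, x₁, hx₁, hq₁⟩ := exists_common_lift hT hτσ hτσ' hL hL' (fun u hu => (hy u hu).le)
    (fun u hu => (hy' u hu).le)
  obtain ⟨m₂, hm₂, x₂, hx₂, hq₂⟩ := exists_common_lift hT hτσ hτσ' hL hL'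
    (fun u hu => hpos u (Finset.mem_union_left _ hu))
    (fun u hu => hpos u (Finset.mem_union_right _ hu))
  obtain ⟨a, ha, hta⟩ := exists_add_mem_conePoints hT
    (t := (m₁ * m₂) • s + m₁ • x₂ - (m₂ * k) • x₁) (by
      rw [map_sub, map_add, map_nsmul, map_nsmul, map_nsmul, hq₁, hq₂]
      module)
  have hF := (Δ.inter_face σ hσ σ' hσ').1
  have h1 : (m₁ * m₂) • s + (m₁ • x₂ + a) ∈ conePoints (σ ⊓ σ') := by
    rw [show (m₁ * m₂) • s + (m₁ • x₂ + a) =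
      (m₂ * k) • x₁ + ((m₁ * m₂) • s + m₁ • x₂ - (m₂ * k) • x₁ + a) by abel]
    exact add_mem (nsmul_mem hx₁ _) (conePoints_mono (le_inf hτσ hτσ') hta)
  have h2 := IsFaceOf.mem_conePoints_left hF (nsmul_mem (hSσ s hs) _)
    (add_mem (nsmul_mem hx₂.1 _) (conePoints_mono hτσ ha)) h1
  exact (mem_conePoints_of_nsmul_mem (mul_pos hm₁ hm₂) h2).2

end Fan

/-! ### Agreement of the polynomials on common walls -/

section Glue

variable {N : Type*} [AddCommGroup N] {Δ : Fan N} {k : ℕ}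

theorem PiecewisePolynomial.restrict_mem (f : PiecewisePolynomial Δ k)
    {σ : PointedCone ℝ (RealSpace N)} (hσ : σ ∈ Δ.maximalCones) :
    f.restrict σ ∈ homogeneous N k := by
  rw [PiecewisePolynomial.restrict, dif_pos hσ]
  exact (f.exists_poly σ hσ).choose_spec.1

theorem PiecewisePolynomial.evalInt_restrict (f : PiecewisePolynomial Δ k)
    {σ : PointedCone ℝ (RealSpace N)} (hσ : σ ∈ Δ.maximalCones) {x : N} (hx : x ∈ conePoints σ) :
    (evalInt x (f.restrict σ) : ℝ) = f.toFun (latticeMap N x) := by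
  rw [PiecewisePolynomial.restrict, dif_pos hσ, (f.exists_poly σ hσ).choose_spec.2 _ hx,
    evalAt_latticeMap]

variable [Module.Free ℤ N] [Module.Finite ℤ N]

/-- The restrictions of a piecewise polynomial to two cones agree modulo `u`, if the intersection of
the images of the cones modulo `τ` has a facet in the hyperplane `u = 0`. -/
theorem PiecewisePolynomial.ι_dvd_restrict_sub_restrict (f : PiecewisePolynomial Δ k)
    {τ σ σ' : PointedCone ℝ (RealSpace N)} (hτ : τ ∈ Δ.cones)
    (hσ : σ ∈ Δ.maximalCones) (hσ' : σ' ∈ Δ.maximalCones) (hτσ : τ ≤ σ) (hτσ' : τ ≤ σ')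
    {L L' : Finset (DualLattice (QuotLattice τ))} (hL : CutsOut τ σ L) (hL' : CutsOut τ σ' L')
    {u : DualLattice (QuotLattice τ)} (hu : ∃ e, u e = 1) {z : QuotLattice τ}
    (hz : ∀ v ∈ L, 0 ≤ v z) (hz' : ∀ v ∈ L', 0 ≤ v z)
    (h : ∀ y, u y = 0 → ∃ k : ℕ, (∀ v ∈ L, 0 ≤ v (k • z + y)) ∧ ∀ v ∈ L', 0 ≤ v (k • z + y)) :
    SymmetricAlgebra.ι ℤ (DualLattice N) (dualIncl τ u) ∣ f.restrict σ - f.restrict σ' := by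
  obtain ⟨T, hT⟩ := Δ.rational τ hτ
  apply ι_dvd_of_evalInt
  · obtain ⟨e, he⟩ := hu
    obtain ⟨e, rfl⟩ := quotMap_surjective τ e
    exact ⟨e, he⟩
  intro y hy
  obtain ⟨l, hl, hl'⟩ := h (quotMap τ y) hy
  obtain ⟨m₀, hm₀, x₀, hx₀, hq₀⟩ := exists_common_lift hT hτσ hτσ' hL hL' hz hz'
  obtain ⟨m₁, hm₁, x₁, hx₁, hq₁⟩ := exists_common_lift hT hτσ hτσ' hL hL' hl hl'
  obtain ⟨a, ha, hta⟩ := exists_add_mem_conePoints hT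
    (t := m₀ • x₁ - (m₁ * l) • x₀ - (m₀ * m₁) • y) (by
      rw [map_sub, map_sub, map_nsmul, map_nsmul, map_nsmul, hq₁, hq₀]
      module)
  have hτ₂ : conePoints τ ≤ conePoints σ ⊓ conePoints σ' :=
    le_inf (conePoints_mono hτσ) (conePoints_mono hτσ')
  -- The difference of the polynomials vanishes on the lattice points of both cones, and a multiple
  -- of `y` is a difference of two such points. Adding the correction `a` to both terms keeps them
  -- in the cones.
  refine evalInt_eq_zero_of_nsmul_mem (W := conePoints σ ⊓ conePoints σ') (k := m₀ * m₁)
    (a := m₀ • x₁ + a)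
    (b := (m₁ * l) • x₀ + (m₀ • x₁ - (m₁ * l) • x₀ - (m₀ * m₁) • y + a))
    (fun w hw => ?_) (mul_pos hm₀ hm₁) (add_mem (nsmul_mem hx₁ _) (hτ₂ ha))
    (add_mem (nsmul_mem hx₀ _) (hτ₂ hta)) (by abel)
  have h1 := f.evalInt_restrict hσ hw.1
  rw [← f.evalInt_restrict hσ' hw.2] at h1
  rw [map_sub, sub_eq_zero]
  exact_mod_cast h1

end Glue

end ToricLocalization

end

theorem proposition1p2 {N : Type*} [AddCommGroup N] [Module.Free ℤ N] [Module.Finite ℤ N]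
    (Δ : ToricLocalization.Fan N) (hΔ : Δ.IsComplete) (k : ℕ)
    (f : ToricLocalization.PiecewisePolynomial Δ k)
    (τ : PointedCone ℝ (ToricLocalization.RealSpace N)) (hτ : τ ∈ Δ.cones) :
    ∃ c ∈ ToricLocalization.homogeneous N
        ((k : ℤ) + ToricLocalization.coneDim τ - Module.finrank ℤ N),
      ∑ σ ∈ Δ.maximalConesOver τ, ToricLocalization.relMult σ τ *
          algebraMap (ToricLocalization.Poly N) (ToricLocalization.RatFunc N) (f.restrict σ) =
        algebraMap (ToricLocalization.Poly N) (ToricLocalization.RatFunc N) c := by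
  classical
  have := ToricLocalization.quotLattice_free τ
  obtain ⟨T, hT⟩ := Δ.rational τ hτ
  have hdim := ToricLocalization.coneDim_add_finrank hT
  choose! S hS using Δ.rational
  choose! L hprim hL hdual using fun σ (hσ : σ ∈ Δ.cones) =>
    ToricLocalization.exists_cutsOut τ (hS σ hσ)
  have hI : ∀ σ ∈ Δ.maximalConesOver τ, σ ∈ Δ.cones ∧ σ ∈ Δ.maximalCones ∧ τ ≤ σ := fun σ hσ =>
    ⟨(ToricLocalization.Fan.mem_maximalConesOver.1 hσ).1.1, (Finset.mem_filter.1 hσ).1,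
      (Finset.mem_filter.1 hσ).2⟩
  obtain ⟨p, hp, hsum⟩ := ToricLocalization.exists_sum_part_mul_eq τ (Δ.maximalConesOver τ) L
    f.restrict k (fun σ hσ => f.restrict_mem (hI σ hσ).2.1) (fun σ hσ => hprim σ (hI σ hσ).1)
    (ToricLocalization.Fan.exists_forall_nonneg hΔ hτ hL)
    (fun σ hσ σ' hσ' y hy hy' => by
      have hle := ToricLocalization.Fan.le_of_forall_pos hτ (hI σ hσ).1 (hI σ' hσ').1 (hI σ hσ).2.2
        (hI σ' hσ').2.2 (hL σ (hI σ hσ).1) (hL σ' (hI σ' hσ').1) hy hy'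
      exact (ToricLocalization.Fan.mem_maximalConesOver.1 hσ).1.2.eq_of_le (hI σ' hσ').1 hle)
    (fun σ hσ σ' hσ' u hu z hz hz' h =>
      f.ι_dvd_restrict_sub_restrict hτ (hI σ hσ).2.1 (hI σ' hσ').2.1 (hI σ hσ).2.2 (hI σ' hσ').2.2
        (hL σ (hI σ hσ).1) (hL σ' (hI σ' hσ').1) hu hz hz' h)
  -- The sign in the multiplicity depends only on the rank of the quotient, so it is common to all
  -- summands.
  refine ⟨(-1) ^ Module.finrank ℤ (ToricLocalization.QuotLattice τ) * p, ?_, ?_⟩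
  · rw [show (k : ℤ) + ToricLocalization.coneDim τ - Module.finrank ℤ N =
      k - Module.finrank ℤ (ToricLocalization.QuotLattice τ) by omega]
    rcases neg_one_pow_eq_or (ToricLocalization.Poly N)
      (Module.finrank ℤ (ToricLocalization.QuotLattice τ)) with h | h
    · rwa [h, one_mul]
    · rw [h, neg_one_mul]
      exact neg_mem hp
  · rw [map_mul, map_pow, map_neg, map_one, ← hsum, Finset.mul_sum]
    refine Finset.sum_congr rfl fun σ hσ => ?_
    have hσ' := (hI σ hσ).1
    rw [ToricLocalization.relMult, ToricLocalization.mult,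
      ToricLocalization.principalPart_hilb_eq_part
        (ToricLocalization.zero_notMem_of_primitive (hprim σ hσ'))
        (fun y hy => (hL σ hσ').eq_zero_of_forall_eq_zero hT
          (ToricLocalization.Fan.isFaceOf hτ hσ' (hI σ hσ).2.2) hy) (hdual σ hσ'),
      map_mul, map_pow, map_neg, map_one, mul_assoc]
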